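/- Let $S$ be a complex surface. A $k$-web on $S$ is given by a holomorphic section of $\mathrm{Sym}^k\Omega^1_S\otimes N$, for some line bundle $N$, that has isolated zeros and whose discriminant is not identically zero (on any connected component of $S$); $\Delta(\cdot)$ denotes its discriminant divisor, and $\boxtimes$ (superposition) is given by the product of the defining sections. The curvature $K(\mathcal W)$ of a $k$-web $\mathcal W$ is the meromorphic $2$-form which, near every point outside $\Delta(\mathcal W)$, where $\mathcal W=\mathcal F_1\boxtimes\cdots\boxtimes\mathcal F_k$ with foliations $\mathcal F_i$ defined by holomorphic $1$-forms $\omega_i$, equals $\sum_{r<s<t}d\eta_{rst}$; here $\omega_i\wedge\omega_j=\delta_{ij}\,dx\wedge dy$ and $\eta_{rst}$ is the unique $1$-form with $d(\delta_{st}\omega_r)=\eta_{rst}\wedge\delta_{st}\omega_r$, $d(\delta_{tr}\omega_s)=\eta_{rst}\wedge\delta_{tr}\omega_s$, $d(\delta_{rs}\omega_t)=\eta_{rst}\wedge\delta_{rs}\omega_t$. Proposition. Let $\nu\le d$, let $\mathcal W_\nu$ be a $\nu$-web on $S$ and let $C$ be an irreducible component of (the support of) $\Delta(\mathcal W_\nu)$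 such that $C$ is totally invariant by $\mathcal W_\nu$ (over the regular part of $C$, wherever the section defining $\mathcal W_\nu$ is not zero, the only tangent direction of $\mathcal W_\nu$ is that of $C$) and $C$ has the minimal multiplicity $\nu-1$ in $\Delta(\mathcal W_\nu)$. Let $\mathcal W_{d-\nu}$ be a smooth $(d-\nu)$-web on $S$ (with $d-\nu$ distinct tangent lines at every point) which is transverse to $C$ (at the regular points of $C$, none of its tangent lines is tangent to $C$). Then the curvature of $\mathcal W_\nu\boxtimes\mathcal W_{d-\nu}$ is holomorphic along $C$: every point of $C$ at which the support of $\Delta(\mathcal W_\nu)$ is a smooth curve has a neighbourhood on which the discriminant of $\mathcal W_\nu\boxtimes\mathcal W_{d-\nu}$ is not identically zero and to which $K(\mathcal W_\nu\boxtimes\mathcal W_{d-\nu})$ extends as a holomorphic $2$-form. -/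

import Mathlib

open Filter Topology
open scoped Manifold ContDiff

namespace Webs

/-! ### Binary forms

A binary form of degree `k` (an element of `Sym^k` of the cotangent space of `ℂ²`) is a homogeneous
polynomial of degree `k` in the two variables `X 0 = dz` and `X 1 = dw`. -/

abbrev BinaryForm : Type := MvPolynomial (Fin 2) ℂ

/-- The value of a binary form on a tangent vector. -/
noncomputable def evalForm (P : BinaryForm) (v : ℂ × ℂ) : ℂ := MvPolynomial.eval ![v.1, v.2] P

/-- The linear form `a dz + b dw`. -/
noncomputable def linearForm (a : ℂ × ℂ) : BinaryForm :=
  MvPolynomial.C a.1 * MvPolynomial.X 0 + MvPolynomial.C a.2 * MvPolynomial.X 1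

/-- The discriminant of a binary form `P` of degree `k`, normalised as the resultant of the two
partial derivatives of `P`, which are binary forms of degree `k - 1` and are dehomogenised here
with their formal degrees kept. It differs from the other usual normalisation by the nonzero
constant `± k ^ (k - 2)`; it vanishes exactly when `P` has a multiple linear factor (for
`2 ≤ k`), and it equals `1` for `k ≤ 1`. -/
noncomputable def formDiscr (k : ℕ) (P : BinaryForm) : ℂ :=
  Polynomial.resultant
    (MvPolynomial.aeval ![(Polynomial.X : Polynomial ℂ), 1] (MvPolynomial.pderiv 0 P))
    (MvPolynomial.aeval ![(Polynomial.X : Polynomial ℂ), 1] (MvPolynomial.pderiv 1 P))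
    (k - 1) (k - 1)

/-! ### Differential forms on open subsets of `ℂ²`

A `1`-form `A dz + B dw` is the function `x ↦ (A x, B x)`, a `2`-form `h dz ∧ dw` is the
function `h`. -/

/-- `(a.1 dz + a.2 dw) ∧ (b.1 dz + b.2 dw) = wedge a b • dz ∧ dw`. -/
noncomputable def wedge (a b : ℂ × ℂ) : ℂ := a.1 * b.2 - a.2 * b.1

/-- The exterior derivative of a `1`-form: `d (A dz + B dw) = (∂_z B - ∂_w A) dz ∧ dw`. -/
noncomputable def extDer (α : ℂ × ℂ → ℂ × ℂ) (x : ℂ × ℂ) : ℂ :=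
  fderiv ℂ (fun y => (α y).2) x (1, 0) - fderiv ℂ (fun y => (α y).1) x (0, 1)

/-! ### The curvature of a web at a point outside its discriminant -/

/-- Near `x` the form `P` defines the completely decomposable web `F_1 ⊠ ... ⊠ F_k`, where `F_i` is
the foliation given by the holomorphic `1`-form `α i`, and the `F_i` are pairwise transverse
at `x`. -/
structure IsDecomposition {k : ℕ} (P : ℂ × ℂ → BinaryForm) (x : ℂ × ℂ)
    (α : Fin k → ℂ × ℂ → ℂ × ℂ) : Prop where
  analyticAt : ∀ i, AnalyticAt ℂ (α i) x
  transverse : ∀ i j, i ≠ j → wedge (α i x) (α j x) ≠ 0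
  eq_prod : ∃ u : ℂ × ℂ → ℂ, AnalyticAt ℂ u x ∧ u x ≠ 0 ∧
    ∀ᶠ y in 𝓝 x, P y = MvPolynomial.C (u y) * ∏ i, linearForm (α i y)

/-- `η` is, near `x`, the `1`-form attached to the `3`-web given by `ω₁, ω₂, ω₃`: with
`ω_i ∧ ω_j = δ_ij dz ∧ dw`, it satisfies `d (δ_ij ω_l) = η ∧ (δ_ij ω_l)` for every cyclic
permutation `(i, j, l)` of `(1, 2, 3)`. -/
structure IsEta (ω₁ ω₂ ω₃ : ℂ × ℂ → ℂ × ℂ) (x : ℂ × ℂ) (η : ℂ × ℂ → ℂ × ℂ) : Prop where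
  analyticAt : AnalyticAt ℂ η x
  eq₁ : ∀ᶠ y in 𝓝 x, extDer (fun t => wedge (ω₂ t) (ω₃ t) • ω₁ t) y =
    wedge (η y) (wedge (ω₂ y) (ω₃ y) • ω₁ y)
  eq₂ : ∀ᶠ y in 𝓝 x, extDer (fun t => wedge (ω₃ t) (ω₁ t) • ω₂ t) y =
    wedge (η y) (wedge (ω₃ y) (ω₁ y) • ω₂ y)
  eq₃ : ∀ᶠ y in 𝓝 x, extDer (fun t => wedge (ω₁ t) (ω₂ t) • ω₃ t) y =
    wedge (η y) (wedge (ω₁ y) (ω₂ y) • ω₃ y)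

/-- `c` is the coefficient at `x` of `K = d (∑_{r < s < t} η_rst)`, computed from some
decomposition, near `x`, of the `k`-web defined by `P`. -/
def IsCurvatureValue (k : ℕ) (P : ℂ × ℂ → BinaryForm) (x : ℂ × ℂ) (c : ℂ) : Prop :=
  ∃ (α : Fin k → ℂ × ℂ → ℂ × ℂ) (η : Fin k → Fin k → Fin k → ℂ × ℂ → ℂ × ℂ),
    IsDecomposition P x α ∧
    (∀ r s t, r < s → s < t → IsEta (α r) (α s) (α t) x (η r s t)) ∧
    c = extDer (fun y => ∑ r, ∑ s ∈ Finset.Ioi r, ∑ t ∈ Finset.Ioi s, η r s t y) x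

/-- The curvature at `x` of the `k`-web defined by `P` is the well-defined `2`-covector
`c dz ∧ dw`: it can be computed from a decomposition of the web near `x`, and every such
computation gives the same result. -/
def HasCurvatureAt (k : ℕ) (P : ℂ × ℂ → BinaryForm) (x : ℂ × ℂ) (c : ℂ) : Prop :=
  IsCurvatureValue k P x c ∧ ∀ c', IsCurvatureValue k P x c' → c' = c

section Surface

variable {S : Type*} [TopologicalSpace S] [ChartedSpace (ℂ × ℂ) S]

/-! ### Curves in a complex surface -/

/-- `f` is a reduced holomorphic local equation at `p` for `Z`, which is a smooth curve near `p`. -/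
structure IsLocalEquation (Z : Set S) (f : S → ℂ) (p : S) : Prop where
  contMDiffAt : ContMDiffAt 𝓘(ℂ, ℂ × ℂ) 𝓘(ℂ, ℂ) ω f p
  mfderiv_ne_zero : mfderiv 𝓘(ℂ, ℂ × ℂ) 𝓘(ℂ, ℂ) f p ≠ 0
  eventually_mem_iff : ∀ᶠ q in 𝓝 p, q ∈ Z ↔ f q = 0

/-- The points of `Z` near which `Z` is a smooth complex curve. -/
def regularPart (Z : Set S) : Set S := {p | p ∈ Z ∧ ∃ f, IsLocalEquation Z f p}

/-- The irreducible components of an analytic curve `Z` are the closures of the connected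
components of its regular part. -/
def IsIrreducibleComponent (Z C : Set S) : Prop :=
  ∃ p ∈ regularPart Z, C = closure (connectedComponentIn (regularPart Z) p)

variable (S) in
/-- A holomorphic section of `Sym^k Ω¹_S ⊗ N`, for some line bundle `N` on `S`, given by local
data: for every `p`, a trivialisation of `N` on a neighbourhood `dom p` of `p` turns it into a
holomorphic `k`-symmetric `1`-form, which is written in the chart at `p`; on overlaps these local
forms differ by nowhere zero holomorphic functions (the transition functions of `N`). -/
structure TwistedForm (k : ℕ) where
  dom : S → Set S
  form : S → ℂ × ℂ → BinaryForm
  isOpen_dom : ∀ p, IsOpen (dom p)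
  mem_dom : ∀ p, p ∈ dom p
  dom_subset : ∀ p, dom p ⊆ (chartAt (ℂ × ℂ) p).source
  isHomogeneous : ∀ p, ∀ x ∈ dom p, (form p (chartAt (ℂ × ℂ) p x)).IsHomogeneous k
  analyticAt : ∀ p, ∀ x ∈ dom p, ∀ m,
    AnalyticAt ℂ (fun y => (form p y).coeff m) (chartAt (ℂ × ℂ) p x)
  compatible : ∀ p q, ∀ x ∈ dom p ∩ dom q, ∃ g : ℂ × ℂ → ℂ,
    AnalyticAt ℂ g (chartAt (ℂ × ℂ) p x) ∧ g (chartAt (ℂ × ℂ) p x) ≠ 0 ∧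
    ∀ᶠ y in 𝓝 (chartAt (ℂ × ℂ) p x), ∀ v : ℂ × ℂ,
      evalForm (form q (chartAt (ℂ × ℂ) q ((chartAt (ℂ × ℂ) p).symm y)))
          (fderiv ℂ (fun t => chartAt (ℂ × ℂ) q ((chartAt (ℂ × ℂ) p).symm t)) y v) =
        g y * evalForm (form p y) v

namespace TwistedForm

variable {k l : ℕ}

/-- The value of the form at `p`, as a binary form on the tangent space at `p` (which is `ℂ²`,
through the chart at `p`). -/
noncomputable def formAt (W : TwistedForm S k) (p : S) : BinaryForm := W.form p (chartAt (ℂ × ℂ) p p)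

/-- The support of the discriminant divisor `Δ`. -/
def discrSet (W : TwistedForm S k) : Set S := {p | formDiscr k (W.formAt p) = 0}

/-- The product of two forms. If both define webs, the product defines their superposition. -/
noncomputable def mul (W : TwistedForm S k) (W' : TwistedForm S l) : TwistedForm S (k + l) where
  dom p := W.dom p ∩ W'.dom p
  form p y := W.form p y * W'.form p y
  isOpen_dom p := (W.isOpen_dom p).inter (W'.isOpen_dom p)
  mem_dom p := ⟨W.mem_dom p, W'.mem_dom p⟩
  dom_subset p := fun _ hx => W.dom_subset p hx.1
  isHomogeneous p x hx := (W.isHomogeneous p x hx.1).mul (W'.isHomogeneous p x hx.2)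
  analyticAt p x hx m := by
    simp only [MvPolynomial.coeff_mul]
    exact Finset.analyticAt_fun_sum _ fun i _ =>
      (W.analyticAt p x hx.1 i.1).mul (W'.analyticAt p x hx.2 i.2)
  compatible p q x hx := by
    obtain ⟨g, hg, hg0, h⟩ := W.compatible p q x ⟨hx.1.1, hx.2.1⟩
    obtain ⟨g', hg', hg0', h'⟩ := W'.compatible p q x ⟨hx.1.2, hx.2.2⟩
    refine ⟨fun y => g y * g' y, hg.mul hg', mul_ne_zero hg0 hg0', ?_⟩
    filter_upwards [h, h'] with y hy hy' v
    have e := hy v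
    have e' := hy' v
    simp only [evalForm, map_mul] at e e' ⊢
    rw [e, e']
    ring

/-- `p` does not lie in the polar set of the curvature: the discriminant does not vanish
identically near `p`, and in the chart at `p` the curvature, a `2`-form defined outside the
discriminant, extends to a holomorphic `2`-form on a neighbourhood of `p`. -/
def CurvatureHolomorphicAt (W : TwistedForm S k) (p : S) : Prop :=
  (∃ᶠ q in 𝓝 p, q ∉ W.discrSet) ∧
  ∃ κ : ℂ × ℂ → ℂ, AnalyticAt ℂ κ (chartAt (ℂ × ℂ) p p) ∧
    ∀ᶠ q in 𝓝 p, q ∉ W.discrSet →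
      HasCurvatureAt k (W.form p) (chartAt (ℂ × ℂ) p q) (κ (chartAt (ℂ × ℂ) p q))

end TwistedForm

variable (S) in
/-- A `k`-web on `S`: a section of `Sym^k Ω¹_S ⊗ N` with isolated zeros whose discriminant does
not vanish identically on any nonempty open set (equivalently, on any component of `S`). -/
structure Web (k : ℕ) extends TwistedForm S k where
  isolated_zeros : ∀ p, ∀ᶠ q in 𝓝[≠] p, toTwistedForm.formAt q ≠ 0
  discr_ne_zero : ∀ p, ∃ᶠ q in 𝓝 p, q ∉ toTwistedForm.discrSet

namespace Web

variable {k l : ℕ}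

/-- The (twisted) symmetric form defining the superposition `W ⊠ W'`. -/
noncomputable def superposition (W : Web S k) (W' : Web S l) : TwistedForm S (k + l) :=
  W.toTwistedForm.mul W'.toTwistedForm

/-- The web has `k` distinct tangent lines at every point of `S`. -/
def IsSmooth (W : Web S k) : Prop := ∀ p, W.formAt p ≠ 0 ∧ p ∉ W.discrSet

/-- `TC = TW|_C` over the regular part of `C`: at the regular points of `C` where the form
defining `W` is not zero, the only tangent direction of `W` is the tangent line of `C`. -/
def IsTotallyInvariant (W : Web S k) (C : Set S) : Prop :=
  ∀ p ∈ C, ∀ f, IsLocalEquation C f p → W.formAt p ≠ 0 →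
    ∀ v : ℂ × ℂ, evalForm (W.formAt p) v = 0 ↔ mfderiv 𝓘(ℂ, ℂ × ℂ) 𝓘(ℂ, ℂ) f p v = 0

/-- At the regular points of `C`, no tangent direction of `W` is tangent to `C`. -/
def IsTransverse (W : Web S k) (C : Set S) : Prop :=
  ∀ p ∈ C, ∀ f, IsLocalEquation C f p →
    ∀ v : ℂ × ℂ, v ≠ 0 → mfderiv 𝓘(ℂ, ℂ × ℂ) 𝓘(ℂ, ℂ) f p v = 0 → evalForm (W.formAt p) v ≠ 0

/-- `C` has multiplicity `m` in the divisor `Δ(W)`: near the points of `C` where the support of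
`Δ(W)` is smooth, the discriminant is a unit times the `m`-th power of a reduced equation
of `C`. -/
def HasMultiplicity (W : Web S k) (C : Set S) (m : ℕ) : Prop :=
  ∀ p ∈ C ∩ regularPart W.discrSet, ∃ f u : S → ℂ, IsLocalEquation C f p ∧
    ContMDiffAt 𝓘(ℂ, ℂ × ℂ) 𝓘(ℂ, ℂ) ω u p ∧ u p ≠ 0 ∧
    ∀ᶠ q in 𝓝 p, formDiscr k (W.form p (chartAt (ℂ × ℂ) p q)) = f q ^ m * u q

end Web

end Surface

end Webs

/-! Near a point of `C`, let `f` be a reduced equation of `C` and `ξ` a constant covector with `ξ ∧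
df ≠ 0`. The discriminant has degree `2 (ν - 1)` in the coefficients of a form but multiplicity only
`ν - 1` along `C`, so the form of the `ν`-web has no zero at the point (`ne_zero_of_formDiscr_eq`).
When its linear factors are written `df + λ ξ`, the `λ` are the roots of a polynomial that total
invariance forces into the shape `b λ ^ ν + f (a_{ν-1} λ ^ (ν-1) + ⋯ + a_0)` with `b` a unit
(`exists_quotients`). Hence every root is `O(τ)`, where `τ = |f| ^ (1/ν)`. Up to a unit the
discriminant is the product of the `ν (ν - 1)` differences of roots, and its order `f ^ (ν - 1)` is
`τ ^ (ν (ν - 1))`; so each difference has order exactly `τ`, which forces `a_0 ≠ 0` and gives each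
root order exactly `τ` (`IsRamified.isBigO_sub`, `IsRamified.isBigO_scale`). The roots thus behave
like the branches of `f ^ (1/ν)`, and implicit differentiation gives `dλ = λ / (ν f) df` up to
smaller terms (`IsRamified.isBigO_grad_root`).

All foliations are then normalised as `ξ + c df`. For the `ν`-web `c = 1 / λ` has order `1 / τ`; for
the smooth transverse web `c` is analytic across `C`. The form `η_rst` has an explicit expression in
the frame `ξ, df` (`etaForm_normalized`), and the estimates on `c` and `dc` give `η_rst = d log (ξ ∧
df) - (ε / ν) d log f + O(τ / |f|)`, with `ε = 1` if at least one of the three foliations belongs to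
the `ν`-web and `ε = 0` otherwise (`isBigO_jetA`, `isBigO_jetB`).

The roots may be permuted by monodromy around `C`, but the sum of `η_rst` over all triples is
symmetric and the normalisation fixes each form, so this sum is a single-valued analytic `1`-form
off `C` (`IsDecomposition.etaSum_eq`). Subtracting the logarithmic terms, which are closed, leaves a
form `G` with the same differential, namely the curvature, and with `f G = O(τ)`. By Riemann's
theorem (`exists_analytic_extension`) `G` extends analytically across `C`, hence so does `dG`. -/

namespace Webs

/-! ### Binary forms: restriction to lines and linear factors -/

lemma evalForm_mul (P Q : BinaryForm) (v : ℂ × ℂ) :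
    evalForm (P * Q) v = evalForm P v * evalForm Q v := by
  simp [evalForm]

lemma evalForm_C (u : ℂ) (v : ℂ × ℂ) : evalForm (MvPolynomial.C u) v = u := by
  simp [evalForm]

lemma evalForm_linearForm (a v : ℂ × ℂ) :
    evalForm (linearForm a) v = a.1 * v.1 + a.2 * v.2 := by
  simp [evalForm, linearForm]

lemma evalForm_prod {ι : Type*} (s : Finset ι) (f : ι → BinaryForm) (v : ℂ × ℂ) :
    evalForm (∏ i ∈ s, f i) v = ∏ i ∈ s, evalForm (f i) v := by
  simp [evalForm, map_prod]

lemma binaryForm_ext {P Q : BinaryForm} (h : ∀ v, evalForm P v = evalForm Q v) : P = Q := by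
  refine MvPolynomial.funext fun x => ?_
  have := h (x 0, x 1)
  have e : ![x 0, x 1] = x := by ext i; fin_cases i <;> rfl
  simpa [evalForm, e] using this

lemma isHomogeneous_linearForm (a : ℂ × ℂ) : (linearForm a).IsHomogeneous 1 := by
  unfold linearForm
  refine MvPolynomial.IsHomogeneous.add ?_ ?_
  · simpa using (MvPolynomial.isHomogeneous_C (Fin 2) a.1).mul (MvPolynomial.isHomogeneous_X ℂ 0)
  · simpa using (MvPolynomial.isHomogeneous_C (Fin 2) a.2).mul (MvPolynomial.isHomogeneous_X ℂ 1)

lemma evalForm_smul {k : ℕ} {P : BinaryForm} (hP : P.IsHomogeneous k) (c : ℂ) (v : ℂ × ℂ) :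
    evalForm P (c • v) = c ^ k * evalForm P v := by
  unfold evalForm
  rw [MvPolynomial.eval_eq', MvPolynomial.eval_eq', Finset.mul_sum]
  refine Finset.sum_congr rfl fun d hd => ?_
  have hdeg := hP (MvPolynomial.mem_support_iff.mp hd)
  have : d 0 + d 1 = k := by
    rw [← hdeg, Finsupp.weight_apply, Finsupp.sum_fintype] <;> simp
  simp only [Fin.prod_univ_two, Matrix.cons_val_zero, Matrix.cons_val_one, Prod.smul_fst,
    Prod.smul_snd, smul_eq_mul, mul_pow, ← this, pow_add]
  ring

/-- The univariate polynomial `t ↦ P (t a + b)`. -/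
noncomputable def restrictLine (P : BinaryForm) (a b : ℂ × ℂ) : Polynomial ℂ :=
  MvPolynomial.aeval ![Polynomial.C a.1 * Polynomial.X + Polynomial.C b.1,
    Polynomial.C a.2 * Polynomial.X + Polynomial.C b.2] P

lemma eval_restrictLine (P : BinaryForm) (a b : ℂ × ℂ) (t : ℂ) :
    (restrictLine P a b).eval t = evalForm P (t • a + b) := by
  unfold restrictLine evalForm
  induction P using MvPolynomial.induction_on with
  | C c => simp
  | add p q hp hq => simp only [map_add, Polynomial.eval_add, hp, hq]
  | mul_X p i hp =>
    simp only [map_mul, Polynomial.eval_mul, hp, MvPolynomial.aeval_X, MvPolynomial.eval_X]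
    congr 1
    fin_cases i
    · simp only [Fin.zero_eta, Matrix.cons_val_zero, Polynomial.eval_add, Polynomial.eval_mul,
        Polynomial.eval_C, Polynomial.eval_X, Prod.fst_add, Prod.smul_fst, smul_eq_mul]
      ring
    · simp only [Fin.mk_one, Matrix.cons_val_one, Matrix.cons_val_fin_one, Polynomial.eval_add,
        Polynomial.eval_mul, Polynomial.eval_C, Polynomial.eval_X, Prod.snd_add, Prod.smul_snd,
        smul_eq_mul]
      ring

lemma natDegree_restrictLine_le {k : ℕ} {P : BinaryForm} (hP : P.IsHomogeneous k) (a b : ℂ × ℂ) :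
    (restrictLine P a b).natDegree ≤ k := by
  unfold restrictLine
  rw [MvPolynomial.aeval_def, MvPolynomial.eval₂_eq']
  refine Polynomial.natDegree_sum_le_of_forall_le _ _ fun d hd => ?_
  have hdeg := hP (MvPolynomial.mem_support_iff.mp hd)
  have : d 0 + d 1 = k := by
    rw [← hdeg, Finsupp.weight_apply, Finsupp.sum_fintype] <;> simp
  rw [← this, Fin.prod_univ_two]
  simp only [Polynomial.algebraMap_eq, Matrix.cons_val_zero, Matrix.cons_val_one]
  have h (x y : ℂ) (n : ℕ) :
      ((Polynomial.C x * Polynomial.X + Polynomial.C y) ^ n).natDegree ≤ n := by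
    refine Polynomial.natDegree_pow_le.trans ?_
    simpa using Nat.mul_le_mul_left n (Polynomial.natDegree_linear_le (a := x) (b := y))
  refine (Polynomial.natDegree_C_mul_le _ _).trans (Polynomial.natDegree_mul_le.trans ?_)
  exact Nat.add_le_add (h _ _ _) (h _ _ _)

/-- A binary form is determined by its restriction to an affine line not through the origin. -/
lemma eq_of_eval_line_eq {k : ℕ} {P Q : BinaryForm} (hP : P.IsHomogeneous k)
    (hQ : Q.IsHomogeneous k) {a b : ℂ × ℂ} (hab : wedge a b ≠ 0)
    (h : ∀ t : ℂ, evalForm P (t • a + b) = evalForm Q (t • a + b)) : P = Q := by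
  have key (s t : ℂ) (ht : t ≠ 0) :
      evalForm P (t • b + s • a) = evalForm Q (t • b + s • a) := by
    have : t • b + s • a = t • ((s / t) • a + b) := by
      rw [smul_add, smul_smul, mul_div_cancel₀ _ ht, add_comm]
    rw [this, evalForm_smul hP, evalForm_smul hQ, h]
  -- For fixed `s` both sides are polynomials in `t`, so agreement for `t ≠ 0` extends to the
  -- multiples of `a`, which the scaling argument misses.
  have key' (s : ℂ) : restrictLine P b (s • a) = restrictLine Q b (s • a) := by
    refine Polynomial.eq_of_infinite_eval_eq _ _ (Set.Infinite.mono (s := {0}ᶜ) ?_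
      (Set.finite_singleton (0 : ℂ)).infinite_compl)
    intro t ht
    simpa [eval_restrictLine] using key s t ht
  refine binaryForm_ext fun v => ?_
  have hv : v = (wedge a v / wedge a b) • b + (wedge v b / wedge a b) • a := by
    ext
    · simp only [Prod.fst_add, Prod.smul_fst, smul_eq_mul]
      field_simp
      simp only [wedge]; ring
    · simp only [Prod.snd_add, Prod.smul_snd, smul_eq_mul]
      field_simp
      simp only [wedge]; ring
  rw [hv, ← eval_restrictLine, ← eval_restrictLine, key']

lemma isHomogeneous_C_mul_prod {k : ℕ} (u : ℂ) (a : Fin k → ℂ × ℂ) :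
    (MvPolynomial.C u * ∏ i, linearForm (a i)).IsHomogeneous k := by
  have h : (∏ i, linearForm (a i)).IsHomogeneous (∑ _i : Fin k, 1) :=
    MvPolynomial.IsHomogeneous.prod _ _ _ fun i _ => isHomogeneous_linearForm (a i)
  simpa using (MvPolynomial.isHomogeneous_C (Fin 2) u).mul h

lemma exists_fin_map_eq {α : Type*} {k : ℕ} (s : Multiset α) (hs : s.card = k) :
    ∃ a : Fin k → α, Multiset.map a Finset.univ.val = s := by
  obtain ⟨l, rfl⟩ := Quot.exists_rep s
  change l.length = k at hs
  subst hs
  refine ⟨l.get, ?_⟩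
  change Multiset.map l.get Finset.univ.val = (l : Multiset α)
  rw [Fin.univ_val_map, List.ofFn_get]

/-- A homogeneous form is a multiple of a product of linear forms. -/
lemma exists_factorization {k : ℕ} {P : BinaryForm} (hP : P.IsHomogeneous k) :
    ∃ (u : ℂ) (a : Fin k → ℂ × ℂ), P = MvPolynomial.C u * ∏ i, linearForm (a i) := by
  set p := restrictLine P (1, 0) (0, 1) with hp
  have hdeg : p.natDegree ≤ k := natDegree_restrictLine_le hP _ _
  have hsplit := IsAlgClosed.splits p
  have hcard : p.roots.card = p.natDegree := hsplit.natDegree_eq_card_roots.symm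
  -- A root `r` gives the factor `dz - r dw`. Each unit by which the degree falls short of `k` is a
  -- root at infinity and gives the factor `dw`.
  obtain ⟨a, ha⟩ := exists_fin_map_eq (k := k)
    (p.roots.map (fun r => ((1 : ℂ), -r)) + Multiset.replicate (k - p.natDegree) ((0 : ℂ), (1 : ℂ)))
    (by simp [hcard]; omega)
  refine ⟨p.leadingCoeff, a, eq_of_eval_line_eq hP (isHomogeneous_C_mul_prod _ _)
    (a := (1, 0)) (b := (0, 1)) (by simp [wedge]) fun t => ?_⟩
  rw [evalForm_mul, evalForm_C, evalForm_prod, ← eval_restrictLine, ← hp]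
  have : ∏ i, evalForm (linearForm (a i)) (t • ((1 : ℂ), (0 : ℂ)) + (0, 1)) =
      ((Multiset.map a Finset.univ.val).map fun c => c.1 * t + c.2).prod := by
    rw [Multiset.map_map]
    simp [Finset.prod, evalForm_linearForm]
  rw [this, ha]
  conv_lhs => rw [hsplit.eq_prod_roots]
  simp [Polynomial.eval_multiset_prod, Multiset.map_map, sub_eq_add_neg]

end Webs

/-! ### The discriminant of a product of linear forms -/

namespace Webs

open Polynomial

lemma aeval_pderiv_zero (P : BinaryForm) :
    MvPolynomial.aeval ![(X : ℂ[X]), 1] (MvPolynomial.pderiv 0 P) =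
      derivative (MvPolynomial.aeval ![(X : ℂ[X]), 1] P) := by
  induction P using MvPolynomial.induction_on with
  | C c => simp
  | add p q hp hq => simp only [map_add, hp, hq]
  | mul_X p i hp =>
    fin_cases i
    · simp [Derivation.leibniz, hp, mul_comm]
    · simp [Derivation.leibniz, hp, mul_comm, MvPolynomial.pderiv_X]

/-- Euler's identity for homogeneous polynomials, dehomogenised. -/
lemma aeval_pderiv_one {k : ℕ} {P : BinaryForm} (hP : P.IsHomogeneous k) :
    MvPolynomial.aeval ![(X : ℂ[X]), 1] (MvPolynomial.pderiv 1 P) =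
      C (k : ℂ) * MvPolynomial.aeval ![(X : ℂ[X]), 1] P -
        X * derivative (MvPolynomial.aeval ![(X : ℂ[X]), 1] P) := by
  have h := congrArg (MvPolynomial.aeval ![(X : ℂ[X]), 1]) hP.sum_X_mul_pderiv
  simp only [Fin.sum_univ_two, map_add, map_mul, MvPolynomial.aeval_X, aeval_pderiv_zero] at h
  simp at h
  rw [map_natCast, ← h]
  ring

lemma aeval_linearForm (a : ℂ × ℂ) :
    MvPolynomial.aeval ![(X : ℂ[X]), 1] (linearForm a) = C a.1 * X + C a.2 := by
  simp [linearForm]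

/-- The constant relating the discriminant of a form to the product of the differences of its
roots. -/
noncomputable def discrConst (k : ℕ) : ℂ := if k ≤ 1 then 1 else (k : ℂ) ^ (k - 2)

lemma discrConst_ne_zero (k : ℕ) : discrConst k ≠ 0 := by
  unfold discrConst
  split_ifs with h
  · exact one_ne_zero
  · exact pow_ne_zero _ (by norm_cast; omega)

lemma formDiscr_of_le_one {k : ℕ} (hk : k ≤ 1) (P : BinaryForm) : formDiscr k P = 1 := by
  have : k - 1 = 0 := by omega
  simp [formDiscr, this]

lemma formDiscr_C_mul (k : ℕ) (u : ℂ) (P : BinaryForm) :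
    formDiscr k (MvPolynomial.C u * P) = u ^ (2 * (k - 1)) * formDiscr k P := by
  have h (i : Fin 2) : MvPolynomial.aeval ![(X : ℂ[X]), 1]
      (MvPolynomial.pderiv i (MvPolynomial.C u * P)) =
      C u * MvPolynomial.aeval ![(X : ℂ[X]), 1] (MvPolynomial.pderiv i P) := by
    rw [MvPolynomial.pderiv_C_mul, map_mul, MvPolynomial.aeval_C, algebraMap_eq]
  unfold formDiscr
  rw [h 0, h 1, resultant_C_mul_left, resultant_C_mul_right]
  ring

/-- The product dehomogenises to `A q` with `q` monic of degree `k` and roots `r i`. Modulo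
multiples of `(A q)'`, the second partial derivative is `k A q`, so the resultant becomes a product
of the values `q' (r i)`, that is, of differences of roots. -/
lemma formDiscr_prod_of_ne_zero {k : ℕ} (a : Fin k → ℂ × ℂ) (ha : ∀ i, (a i).1 ≠ 0) :
    formDiscr k (∏ i, linearForm (a i)) =
      discrConst k * ∏ i, ∏ j ∈ Finset.univ.erase i, wedge (a i) (a j) := by
  obtain hk | hk := le_or_gt k 1
  · rw [formDiscr_of_le_one hk, discrConst, if_pos hk, one_mul]
    refine (Finset.prod_eq_one fun i _ => Finset.prod_eq_one fun j hj => ?_).symm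
    have := Finset.ne_of_mem_erase hj
    omega
  obtain ⟨n, rfl⟩ : ∃ n, k = n + 1 := ⟨k - 1, by omega⟩
  set A : ℂ := ∏ i, (a i).1 with hA
  have hA0 : A ≠ 0 := Finset.prod_ne_zero_iff.mpr fun i _ => ha i
  set r : Fin (n + 1) → ℂ := fun i => -((a i).2 / (a i).1) with hr
  set q : ℂ[X] := ∏ i, (X - C (r i)) with hq
  have hP : (∏ i, linearForm (a i)).IsHomogeneous (n + 1) := by
    simpa using isHomogeneous_C_mul_prod 1 a
  have hp : MvPolynomial.aeval ![(X : ℂ[X]), 1] (∏ i, linearForm (a i)) = C A * q := by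
    rw [map_prod, hA, map_prod, hq, ← Finset.prod_mul_distrib]
    refine Finset.prod_congr rfl fun i _ => ?_
    rw [aeval_linearForm, hr, mul_sub, ← C_mul, mul_neg, mul_div_cancel₀ _ (ha i), C_neg,
      sub_neg_eq_add]
  have hqdeg : q.natDegree = n + 1 := by simp [hq]
  have hqmonic : q.Monic := monic_prod_X_sub_C _ _
  have hdq : (derivative q).natDegree ≤ n := by
    have := natDegree_derivative_le q
    rwa [hqdeg] at this
  have hdqc : (derivative q).coeff n = (n : ℂ) + 1 := by
    rw [coeff_derivative, ← hqdeg, hqmonic.coeff_natDegree, one_mul]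
  set g : ℂ[X] := C (((n + 1 : ℕ) : ℂ)) * (C A * q) - X * derivative (C A * q) with hg
  -- The two terms of degree `n + 1` cancel because `q` is monic of degree `n + 1`.
  have hgdeg : g.natDegree ≤ n := by
    rw [natDegree_le_iff_coeff_eq_zero]
    intro N hN
    obtain ⟨M, rfl⟩ : ∃ M, N = M + 1 := ⟨N - 1, by omega⟩
    rw [hg, coeff_sub, coeff_X_mul, coeff_C_mul, derivative_C_mul, coeff_C_mul, coeff_C_mul,
      coeff_derivative]
    obtain h | h := (Nat.lt_succ_iff.mp hN).eq_or_lt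
    · rw [h]; push_cast; ring
    · have : q.coeff (M + 1) = 0 := coeff_eq_zero_of_natDegree_lt (by omega)
      rw [this]; ring
  have hres : (derivative (C A * q)).coeff n * resultant (derivative (C A * q)) g n n =
      ((n + 1 : ℕ) : ℂ) ^ n * (A ^ (n + 1) * A ^ n * ∏ i, (derivative q).eval (r i)) := by
    -- Raising the formal degree of `g` to `n + 1` costs one top coefficient `(n + 1) A` of the
    -- derivative, and makes room for adding `X (A q)'` to `g`, which leaves `(n + 1) A q`. This
    -- factor lowers the exponent of `k` from `k - 1` to the `k - 2` of `discrConst`.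
    have h1 := resultant_add_right_deg (derivative (C A * q)) g n n 1 hgdeg
    rw [pow_one] at h1
    rw [← h1, ← resultant_add_mul_right _ _ X n (n + 1) (by simp [add_comm]) (by
      rw [derivative_C_mul]; exact (natDegree_C_mul_le _ _).trans hdq)]
    rw [hg, mul_comm X, sub_add_cancel, resultant_C_mul_right, derivative_C_mul,
      resultant_C_mul_right, resultant_C_mul_left, resultant_comm]
    have h2 := resultant_prod_left Finset.univ (fun i => X - C (r i)) (derivative q) n
      (by simp) hdq
    rw [← hq, hqdeg] at h2
    rw [h2]
    have h3 (i : Fin (n + 1)) : (X - C (r i)).resultant (derivative q) (X - C (r i)).natDegree n =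
        (derivative q).eval (r i) := by
      rw [natDegree_X_sub_C, resultant_X_sub_C_left _ _ _ hdq]
    simp only [h3]
    rw [Even.neg_one_pow (Nat.even_mul_succ_self n)]
    ring
  have hroot (i : Fin (n + 1)) :
      (derivative q).eval (r i) = ∏ j ∈ Finset.univ.erase i, (r i - r j) := by
    rw [hq, derivative_prod_finset, eval_finsetSum, Finset.sum_eq_single i]
    · simp [eval_prod]
    · intro b _ hb
      rw [eval_mul, eval_prod, Finset.prod_eq_zero (Finset.mem_erase.mpr ⟨hb.symm, Finset.mem_univ i⟩),
        zero_mul]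
      simp
    · simp
  have hW : ∏ i, ∏ j ∈ Finset.univ.erase i, wedge (a i) (a j) =
      A ^ n * A ^ n * ∏ i, (derivative q).eval (r i) := by
    have h1 : ∏ i : Fin (n + 1), ∏ j ∈ Finset.univ.erase i, (a i).1 = A ^ n := by
      simp [hA, Finset.prod_pow]
    have h2 : ∏ i : Fin (n + 1), ∏ j ∈ Finset.univ.erase i, (a j).1 = A ^ n := by
      -- Multiplying by `A` restores the omitted diagonal factors `j = i`.
      have h3 : (∏ i : Fin (n + 1), ∏ j ∈ Finset.univ.erase i, (a j).1) * A = A ^ n * A := by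
        conv_lhs => rw [hA]
        rw [← Finset.prod_mul_distrib, ← pow_succ]
        calc _ = ∏ i : Fin (n + 1), A := Finset.prod_congr rfl fun i _ =>
              Finset.prod_erase_mul _ _ (Finset.mem_univ i)
          _ = _ := by simp
      exact mul_right_cancel₀ hA0 h3
    conv_rhs => lhs; rw [← h1]; rhs; rw [h1, ← h2]
    rw [← Finset.prod_mul_distrib, ← Finset.prod_mul_distrib]
    refine Finset.prod_congr rfl fun i _ => ?_
    rw [hroot, ← Finset.prod_mul_distrib, ← Finset.prod_mul_distrib]
    refine Finset.prod_congr rfl fun j _ => ?_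
    have := ha i
    have := ha j
    simp only [hr, wedge]
    field_simp
    ring
  have hF : formDiscr (n + 1) (∏ i, linearForm (a i)) =
      resultant (derivative (C A * q)) g n n := by
    unfold formDiscr
    rw [aeval_pderiv_zero, aeval_pderiv_one hP, hp, Nat.add_sub_cancel]
  rw [hW, hF, discrConst, if_neg (by omega)]
  rw [derivative_C_mul, coeff_C_mul, hdqc, ← derivative_C_mul] at hres
  have hn : ((n + 1 : ℕ) : ℂ) ≠ 0 := by norm_cast
  refine mul_left_cancel₀ (mul_ne_zero hA0 hn) ?_
  have : ((n + 1 : ℕ) : ℂ) ^ n = ((n + 1 : ℕ) : ℂ) * ((n + 1 : ℕ) : ℂ) ^ (n + 1 - 2) := by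
    rw [← pow_succ']; congr 1; omega
  rw [this] at hres
  push_cast at hres ⊢
  rw [hres]
  ring

/-- Families of polynomials whose coefficients depend continuously on a parameter. -/
def CoeffContinuous (p : ℂ → ℂ[X]) : Prop := ∀ n, Continuous fun t => (p t).coeff n

lemma CoeffContinuous.const (p : ℂ[X]) : CoeffContinuous fun _ => p := fun _ => continuous_const

lemma CoeffContinuous.add {p q : ℂ → ℂ[X]} (hp : CoeffContinuous p) (hq : CoeffContinuous q) :
    CoeffContinuous fun t => p t + q t := fun n => by
  simp only [coeff_add]
  exact (hp n).add (hq n)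

lemma CoeffContinuous.mul {p q : ℂ → ℂ[X]} (hp : CoeffContinuous p) (hq : CoeffContinuous q) :
    CoeffContinuous fun t => p t * q t := fun n => by
  simp only [coeff_mul]
  exact continuous_finsetSum _ fun i _ => (hp i.1).mul (hq i.2)

lemma CoeffContinuous.C {c : ℂ → ℂ} (hc : Continuous c) : CoeffContinuous fun t => C (c t) :=
  fun n => by
    simp only [coeff_C]
    split_ifs
    · exact hc
    · exact continuous_const

lemma continuous_resultant {p q : ℂ → ℂ[X]} (hp : CoeffContinuous p) (hq : CoeffContinuous q)
    (m n : ℕ) : Continuous fun t => resultant (p t) (q t) m n := by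
  unfold resultant
  refine Continuous.matrix_det (continuous_matrix fun i j => ?_)
  simp only [sylvester, Matrix.of_apply]
  induction j using Fin.addCases with
  | left j =>
    simp only [Fin.addCases_left]
    split_ifs
    · exact hq _
    · exact continuous_const
  | right j =>
    simp only [Fin.addCases_right]
    split_ifs
    · exact hp _
    · exact continuous_const

lemma coeffContinuous_aeval_linearForm {a : ℂ → ℂ × ℂ} (ha : Continuous a) :
    CoeffContinuous fun t => MvPolynomial.aeval ![(X : ℂ[X]), 1] (linearForm (a t)) := by
  simp only [aeval_linearForm]
  exact ((CoeffContinuous.C (continuous_fst.comp ha)).mul (.const X)).add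
    (.C (continuous_snd.comp ha))

lemma coeffContinuous_aeval_prod {ι : Type*} (s : Finset ι) {a : ℂ → ι → ℂ × ℂ}
    (ha : ∀ i, Continuous fun t => a t i) :
    CoeffContinuous (fun t => MvPolynomial.aeval ![(X : ℂ[X]), 1] (∏ i ∈ s, linearForm (a t i))) ∧
    ∀ l, CoeffContinuous fun t => MvPolynomial.aeval ![(X : ℂ[X]), 1]
      (MvPolynomial.pderiv l (∏ i ∈ s, linearForm (a t i))) := by
  classical
  induction s using Finset.induction with
  | empty =>
    refine ⟨?_, fun l => ?_⟩
    · simpa only [Finset.prod_empty, map_one] using CoeffContinuous.const 1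
    · have : MvPolynomial.pderiv l (1 : BinaryForm) = 0 := MvPolynomial.pderiv_one
      simpa only [Finset.prod_empty, this, map_zero] using CoeffContinuous.const 0
  | insert i s hi ih =>
    simp only [Finset.prod_insert hi, map_mul, MvPolynomial.pderiv_mul, map_add]
    have h := coeffContinuous_aeval_linearForm (ha i)
    refine ⟨h.mul ih.1, fun l => CoeffContinuous.add (CoeffContinuous.mul ?_ ih.1)
      (h.mul (ih.2 l))⟩
    have (t : ℂ) : MvPolynomial.pderiv l (linearForm (a t i)) =
        MvPolynomial.C (![(a t i).1, (a t i).2] l) := by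
      fin_cases l <;> simp [linearForm, MvPolynomial.pderiv_X]
    simp only [this, MvPolynomial.aeval_C, algebraMap_eq]
    refine CoeffContinuous.C ?_
    fin_cases l
    · exact continuous_fst.comp (ha i)
    · exact continuous_snd.comp (ha i)

lemma continuous_formDiscr_prod {k : ℕ} {a : ℂ → Fin k → ℂ × ℂ}
    (ha : ∀ i, Continuous fun t => a t i) :
    Continuous fun t => formDiscr k (∏ i, linearForm (a t i)) := by
  have h := (coeffContinuous_aeval_prod Finset.univ ha).2
  exact continuous_resultant (h 0) (h 1) _ _

/-- The discriminant of a product of linear forms. -/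
lemma formDiscr_prod {k : ℕ} (u : ℂ) (a : Fin k → ℂ × ℂ) :
    formDiscr k (MvPolynomial.C u * ∏ i, linearForm (a i)) =
      u ^ (2 * (k - 1)) *
        (discrConst k * ∏ i, ∏ j ∈ Finset.univ.erase i, wedge (a i) (a j)) := by
  rw [formDiscr_C_mul]
  congr 1
  -- Adding the same `t` to all first components makes them nonzero for all but finitely many `t`.
  -- Both sides are continuous in `t`, so the identity holds at `t = 0` too.
  have hbc (i : Fin k) : Continuous fun t : ℂ => a i + (t, 0) := by fun_prop
  have hFc := continuous_formDiscr_prod hbc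
  have hGc : Continuous fun t : ℂ => discrConst k *
      ∏ i, ∏ j ∈ Finset.univ.erase i, wedge (a i + (t, 0)) (a j + (t, 0)) := by
    simp only [wedge]
    fun_prop
  have hfin : (Set.range fun i => -(a i).1).Finite := Set.finite_range _
  have hdense : Dense (Set.range fun i => -(a i).1)ᶜ := hfin.countable.dense_compl ℂ
  have := congrFun (Continuous.ext_on hdense hFc hGc fun t ht =>
    formDiscr_prod_of_ne_zero _ fun i h0 => ht ⟨i, by
      simp only [Prod.fst_add] at h0
      linear_combination -h0⟩) 0
  have e (i : Fin k) : a i + ((0 : ℂ), (0 : ℂ)) = a i := by simp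
  simpa only [e] using this

end Webs

/-! ### Covectors of the plane under linear changes of coordinates -/

namespace Webs

lemma wedge_comm (a b : ℂ × ℂ) : wedge a b = -wedge b a := by simp only [wedge]; ring

lemma wedge_smul_left (c : ℂ) (a b : ℂ × ℂ) : wedge (c • a) b = c * wedge a b := by
  simp only [wedge, Prod.smul_fst, Prod.smul_snd, smul_eq_mul]; ring

lemma wedge_smul_right (c : ℂ) (a b : ℂ × ℂ) : wedge a (c • b) = c * wedge a b := by
  simp only [wedge, Prod.smul_fst, Prod.smul_snd, smul_eq_mul]; ring

lemma wedge_add_left (a b c : ℂ × ℂ) : wedge (a + b) c = wedge a c + wedge b c := by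
  simp only [wedge, Prod.fst_add, Prod.snd_add]; ring

lemma wedge_add_right (a b c : ℂ × ℂ) : wedge a (b + c) = wedge a b + wedge a c := by
  simp only [wedge, Prod.fst_add, Prod.snd_add]; ring

lemma wedge_self (a : ℂ × ℂ) : wedge a a = 0 := by simp only [wedge]; ring

/-- `linearForm a` as a linear functional composed with the linear map `L`. -/
noncomputable def pullCovector (L : ℂ × ℂ →L[ℂ] ℂ × ℂ) (a : ℂ × ℂ) : ℂ × ℂ :=
  (a.1 * (L (1, 0)).1 + a.2 * (L (1, 0)).2, a.1 * (L (0, 1)).1 + a.2 * (L (0, 1)).2)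

lemma evalForm_linearForm_pullCovector (L : ℂ × ℂ →L[ℂ] ℂ × ℂ) (a v : ℂ × ℂ) :
    evalForm (linearForm (pullCovector L a)) v = evalForm (linearForm a) (L v) := by
  have hv : v = v.1 • ((1 : ℂ), (0 : ℂ)) + v.2 • ((0 : ℂ), (1 : ℂ)) := by ext <;> simp
  conv_rhs => rw [hv, map_add, map_smul, map_smul]
  simp only [evalForm_linearForm, pullCovector, Prod.fst_add, Prod.snd_add, Prod.smul_fst,
    Prod.smul_snd, smul_eq_mul]
  ring

lemma wedge_pullCovector (L : ℂ × ℂ →L[ℂ] ℂ × ℂ) (a b : ℂ × ℂ) :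
    wedge (pullCovector L a) (pullCovector L b) = wedge (L (1, 0)) (L (0, 1)) * wedge a b := by
  simp only [wedge, pullCovector]; ring

/-- The wedge is the determinant of `L`. Were it zero, the two images would satisfy linear relations
whose coefficients are their own coordinates; injectivity would kill these coordinates, giving `L
(1, 0) = 0`. -/
lemma wedge_map_basis_ne_zero {L : ℂ × ℂ →L[ℂ] ℂ × ℂ} (hL : Function.Injective L) :
    wedge (L (1, 0)) (L (0, 1)) ≠ 0 := by
  intro h
  have key (v w : ℂ × ℂ) : (v.1 * w.2 - v.2 * w.1 = 0) →
      (w.1 • v - v.1 • w = 0) ∧ (w.2 • v - v.2 • w = 0) := by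
    intro h
    refine ⟨Prod.ext ?_ ?_, Prod.ext ?_ ?_⟩ <;>
      simp only [Prod.fst_sub, Prod.snd_sub, Prod.smul_fst, Prod.smul_snd, smul_eq_mul,
        Prod.fst_zero, Prod.snd_zero]
    · ring
    · linear_combination -h
    · linear_combination h
    · ring
  obtain ⟨h1, h2⟩ := key _ _ h
  rw [← map_smul, ← map_smul, ← map_sub] at h1 h2
  have e1 := hL (h1.trans (map_zero L).symm)
  have e2 := hL (h2.trans (map_zero L).symm)
  simp only [Prod.smul_mk, smul_eq_mul, mul_one, mul_zero, Prod.mk_sub_mk, sub_zero, zero_sub,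
    Prod.mk_eq_zero, neg_eq_zero] at e1 e2
  have h0 : L (1, 0) = 0 := Prod.ext e1.2 e2.2
  have := hL (h0.trans (map_zero L).symm)
  simp at this

/-- The vanishing of the discriminant is invariant under linear changes of coordinates. -/
lemma formDiscr_eq_zero_iff_of_comp {k : ℕ} {P Q : BinaryForm} (hQ : Q.IsHomogeneous k)
    {L : ℂ × ℂ →L[ℂ] ℂ × ℂ} (hL : Function.Injective L) {g : ℂ} (hg : g ≠ 0)
    (h : ∀ v, evalForm Q (L v) = g * evalForm P v) :
    formDiscr k P = 0 ↔ formDiscr k Q = 0 := by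
  obtain ⟨u, b, rfl⟩ := exists_factorization hQ
  have hP : P = MvPolynomial.C (g⁻¹ * u) * ∏ i, linearForm (pullCovector L (b i)) := by
    refine binaryForm_ext fun v => mul_left_cancel₀ hg ?_
    rw [← h]
    simp only [evalForm_mul, evalForm_C, evalForm_prod, evalForm_linearForm_pullCovector]
    field_simp
  rw [hP, formDiscr_prod, formDiscr_prod]
  simp only [wedge_pullCovector, mul_eq_zero, pow_eq_zero_iff', discrConst_ne_zero, false_or,
    Finset.prod_eq_zero_iff, wedge_map_basis_ne_zero hL, inv_eq_zero, hg]

/-- The discriminant of a product vanishes where the discriminant of a factor does. -/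
lemma formDiscr_mul_eq_zero {k l : ℕ} {P Q : BinaryForm} (hP : P.IsHomogeneous k)
    (hQ : Q.IsHomogeneous l) (h : formDiscr k P = 0) : formDiscr (k + l) (P * Q) = 0 := by
  obtain ⟨u, a, rfl⟩ := exists_factorization hP
  obtain ⟨v, b, rfl⟩ := exists_factorization hQ
  have e : (MvPolynomial.C u * ∏ i, linearForm (a i)) * (MvPolynomial.C v * ∏ i, linearForm (b i)) =
      MvPolynomial.C (u * v) * ∏ i, linearForm (Fin.append a b i) := by
    rw [Fin.prod_univ_add]
    simp only [Fin.append_left, Fin.append_right, map_mul]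
    ring
  rw [e, formDiscr_prod]
  rw [formDiscr_prod] at h
  simp only [mul_eq_zero, pow_eq_zero_iff', discrConst_ne_zero, false_or,
    Finset.prod_eq_zero_iff, Finset.mem_univ, true_and, Finset.mem_erase, and_true] at h ⊢
  obtain ⟨h, hk⟩ | ⟨i, j, hij, h⟩ := h
  · left
    exact ⟨Or.inl h, by omega⟩
  · right
    refine ⟨Fin.castAdd l i, Fin.castAdd l j, by simpa using hij, by simpa using h⟩

/-! ### Exterior calculus -/

/-- The differential of a function, as a `1`-form. -/
noncomputable def grad (h : ℂ × ℂ → ℂ) (x : ℂ × ℂ) : ℂ × ℂ :=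
  (fderiv ℂ h x (1, 0), fderiv ℂ h x (0, 1))

lemma analyticAt_wedge {E : Type*} [NormedAddCommGroup E] [NormedSpace ℂ E]
    {α β : E → ℂ × ℂ} {x : E} (hα : AnalyticAt ℂ α x)
    (hβ : AnalyticAt ℂ β x) : AnalyticAt ℂ (fun y => wedge (α y) (β y)) x := by
  have h1 := (ContinuousLinearMap.fst ℂ ℂ ℂ).analyticAt
  have h2 := (ContinuousLinearMap.snd ℂ ℂ ℂ).analyticAt
  exact (((h1 _).comp hα).mul ((h2 _).comp hβ)).sub (((h2 _).comp hα).mul ((h1 _).comp hβ))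

lemma analyticAt_fst_comp {E : Type*} [NormedAddCommGroup E] [NormedSpace ℂ E]
    {α : E → ℂ × ℂ} {x : E} (hα : AnalyticAt ℂ α x) :
    AnalyticAt ℂ (fun y => (α y).1) x :=
  ((ContinuousLinearMap.fst ℂ ℂ ℂ).analyticAt _).comp hα

lemma analyticAt_snd_comp {E : Type*} [NormedAddCommGroup E] [NormedSpace ℂ E]
    {α : E → ℂ × ℂ} {x : E} (hα : AnalyticAt ℂ α x) :
    AnalyticAt ℂ (fun y => (α y).2) x :=
  ((ContinuousLinearMap.snd ℂ ℂ ℂ).analyticAt _).comp hα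

lemma analyticAt_fderiv_apply {h : ℂ × ℂ → ℂ} {x : ℂ × ℂ} (hh : AnalyticAt ℂ h x) (v : ℂ × ℂ) :
    AnalyticAt ℂ (fun y => fderiv ℂ h y v) x :=
  ((ContinuousLinearMap.apply ℂ ℂ v).analyticAt _).comp hh.fderiv

lemma analyticAt_grad {h : ℂ × ℂ → ℂ} {x : ℂ × ℂ} (hh : AnalyticAt ℂ h x) :
    AnalyticAt ℂ (grad h) x :=
  (analyticAt_fderiv_apply hh _).prod (analyticAt_fderiv_apply hh _)

lemma analyticAt_extDer {α : ℂ × ℂ → ℂ × ℂ} {x : ℂ × ℂ} (hα : AnalyticAt ℂ α x) :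
    AnalyticAt ℂ (extDer α) x :=
  (analyticAt_fderiv_apply (analyticAt_snd_comp hα) _).sub
    (analyticAt_fderiv_apply (analyticAt_fst_comp hα) _)

lemma grad_mul {g h : ℂ × ℂ → ℂ} {x : ℂ × ℂ} (hg : DifferentiableAt ℂ g x)
    (hh : DifferentiableAt ℂ h x) :
    grad (fun y => g y * h y) x = g x • grad h x + h x • grad g x := by
  simp only [grad]
  rw [fderiv_fun_mul hg hh]
  ext <;> simp

lemma grad_sub {g h : ℂ × ℂ → ℂ} {x : ℂ × ℂ} (hg : DifferentiableAt ℂ g x)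
    (hh : DifferentiableAt ℂ h x) :
    grad (fun y => g y - h y) x = grad g x - grad h x := by
  simp only [grad]
  rw [fderiv_fun_sub hg hh]
  ext <;> simp

lemma grad_inv {g : ℂ × ℂ → ℂ} {x : ℂ × ℂ} (hg : DifferentiableAt ℂ g x) (h0 : g x ≠ 0) :
    grad (fun y => (g y)⁻¹) x = (-(g x ^ 2)⁻¹) • grad g x := by
  have := (hasDerivAt_inv h0).comp_hasFDerivAt x hg.hasFDerivAt
  have e : fderiv ℂ (fun y => (g y)⁻¹) x = (-(g x ^ 2)⁻¹) • fderiv ℂ g x := this.fderiv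
  simp only [grad]
  rw [e]
  ext <;> simp

lemma grad_congr {g h : ℂ × ℂ → ℂ} {x : ℂ × ℂ} (H : g =ᶠ[𝓝 x] h) : grad g =ᶠ[𝓝 x] grad h := by
  filter_upwards [H.eventuallyEq_nhds] with y hy
  simp only [grad, hy.fderiv_eq]

lemma extDer_congr {α β : ℂ × ℂ → ℂ × ℂ} {x : ℂ × ℂ} (H : α =ᶠ[𝓝 x] β) :
    extDer α =ᶠ[𝓝 x] extDer β := by
  filter_upwards [H.eventuallyEq_nhds] with y hy
  have h1 : (fun t => (α t).1) =ᶠ[𝓝 y] fun t => (β t).1 := hy.fun_comp Prod.fst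
  have h2 : (fun t => (α t).2) =ᶠ[𝓝 y] fun t => (β t).2 := hy.fun_comp Prod.snd
  simp only [extDer, h1.fderiv_eq, h2.fderiv_eq]

lemma extDer_add {α β : ℂ × ℂ → ℂ × ℂ} {x : ℂ × ℂ} (hα : DifferentiableAt ℂ α x)
    (hβ : DifferentiableAt ℂ β x) :
    extDer (fun y => α y + β y) x = extDer α x + extDer β x := by
  simp only [extDer, Prod.fst_add, Prod.snd_add]
  rw [fderiv_fun_add hα.snd hβ.snd, fderiv_fun_add hα.fst hβ.fst]
  simp only [add_apply]
  ring

lemma extDer_neg (α : ℂ × ℂ → ℂ × ℂ) (x : ℂ × ℂ) :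
    extDer (fun y => -α y) x = -extDer α x := by
  simp only [extDer, Prod.fst_neg, Prod.snd_neg, fderiv_fun_neg, neg_apply]
  ring

lemma extDer_sum {ι : Type*} (s : Finset ι) {α : ι → ℂ × ℂ → ℂ × ℂ} {x : ℂ × ℂ}
    (hα : ∀ i ∈ s, DifferentiableAt ℂ (α i) x) :
    extDer (fun y => ∑ i ∈ s, α i y) x = ∑ i ∈ s, extDer (α i) x := by
  classical
  induction s using Finset.induction with
  | empty => simp [extDer]
  | insert i s hi ih =>
    simp only [Finset.sum_insert hi]
    rw [extDer_add (hα i (Finset.mem_insert_self _ _))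
      (DifferentiableAt.fun_sum fun j hj => hα j (Finset.mem_insert_of_mem hj)),
      ih fun j hj => hα j (Finset.mem_insert_of_mem hj)]

lemma extDer_smul {h : ℂ × ℂ → ℂ} {α : ℂ × ℂ → ℂ × ℂ} {x : ℂ × ℂ} (hh : DifferentiableAt ℂ h x)
    (hα : DifferentiableAt ℂ α x) :
    extDer (fun y => h y • α y) x = wedge (grad h x) (α x) + h x * extDer α x := by
  simp only [extDer, Prod.smul_fst, Prod.smul_snd, smul_eq_mul]
  rw [fderiv_fun_mul hh hα.snd, fderiv_fun_mul hh hα.fst]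
  simp only [add_apply, smul_apply, smul_eq_mul, wedge,
    grad]
  ring

lemma extDer_grad {h : ℂ × ℂ → ℂ} {x : ℂ × ℂ} (hh : AnalyticAt ℂ h x) : extDer (grad h) x = 0 := by
  have hs : IsSymmSndFDerivAt ℂ h x :=
    hh.contDiffAt.isSymmSndFDerivAt (n := ω) (by simp)
  have hd : DifferentiableAt ℂ (fderiv ℂ h) x := hh.fderiv.differentiableAt
  have e (v w : ℂ × ℂ) : fderiv ℂ (fun y => fderiv ℂ h y v) x w = fderiv ℂ (fderiv ℂ h) x w v := by
    rw [fderiv_clm_apply hd (differentiableAt_const v)]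
    simp
  simp only [extDer, grad, e]
  rw [hs.eq, sub_self]

/-- Changes of the defining forms, the function `ξ ∧ df` and the pole along `C` all enter the sum of
the `η` through such closed terms, so none of them contributes to the curvature. -/
lemma extDer_logDeriv {h : ℂ × ℂ → ℂ} {x : ℂ × ℂ} (hh : AnalyticAt ℂ h x) (h0 : h x ≠ 0) :
    extDer (fun y => (h y)⁻¹ • grad h y) x = 0 := by
  rw [extDer_smul (h := fun y => (h y)⁻¹) (hh.inv h0).differentiableAt (analyticAt_grad hh).differentiableAt,
    grad_inv hh.differentiableAt h0, extDer_grad hh, wedge_smul_left, wedge_self]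
  simp

end Webs

/-! ### The form attached to a `3`-web: existence, uniqueness, symmetry -/

namespace Webs

lemma analyticAt_logDeriv {h : ℂ × ℂ → ℂ} {x : ℂ × ℂ} (hh : AnalyticAt ℂ h x) (h0 : h x ≠ 0) :
    AnalyticAt ℂ (fun y => (h y)⁻¹ • grad h y) x :=
  AnalyticAt.smul (f := fun y => (h y)⁻¹) (hh.inv h0) (analyticAt_grad hh)

lemma analyticAt_wedge_smul {ω₁ ω₂ ω₃ : ℂ × ℂ → ℂ × ℂ} {x : ℂ × ℂ} (h₁ : AnalyticAt ℂ ω₁ x)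
    (h₂ : AnalyticAt ℂ ω₂ x) (h₃ : AnalyticAt ℂ ω₃ x) :
    AnalyticAt ℂ (fun t => wedge (ω₁ t) (ω₂ t) • ω₃ t) x :=
  (analyticAt_wedge h₁ h₂).smul h₃

lemma wedge_neg_right (a b : ℂ × ℂ) : wedge a (-b) = -wedge a b := by
  simp only [wedge, Prod.fst_neg, Prod.snd_neg]; ring

/-- The linear relation between three covectors of a plane. It makes the third equation defining `η`
a consequence of the other two. -/
lemma wedge_smul_cyclic (a b c : ℂ × ℂ) :
    wedge a b • c = -(wedge b c • a + wedge c a • b) := by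
  ext <;> simp only [wedge, Prod.smul_fst, Prod.smul_snd, smul_eq_mul, Prod.fst_neg, Prod.snd_neg,
    Prod.fst_add, Prod.snd_add] <;> ring

/-- The explicit solution of the equations defining the `1`-form attached to a `3`-web. -/
noncomputable def etaForm (ω₁ ω₂ ω₃ : ℂ × ℂ → ℂ × ℂ) (y : ℂ × ℂ) : ℂ × ℂ :=
  (wedge (wedge (ω₃ y) (ω₁ y) • ω₂ y) (wedge (ω₂ y) (ω₃ y) • ω₁ y))⁻¹ •
    (extDer (fun t => wedge (ω₂ t) (ω₃ t) • ω₁ t) y • (wedge (ω₃ y) (ω₁ y) • ω₂ y) -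
      extDer (fun t => wedge (ω₃ t) (ω₁ t) • ω₂ t) y • (wedge (ω₂ y) (ω₃ y) • ω₁ y))

section Eta

variable {ω₁ ω₂ ω₃ : ℂ × ℂ → ℂ × ℂ} {x : ℂ × ℂ}

lemma eventually_wedge_ne_zero (h₁ : AnalyticAt ℂ ω₁ x) (h₂ : AnalyticAt ℂ ω₂ x)
    (h : wedge (ω₁ x) (ω₂ x) ≠ 0) : ∀ᶠ y in 𝓝 x, wedge (ω₁ y) (ω₂ y) ≠ 0 :=
  (analyticAt_wedge h₁ h₂).continuousAt.eventually_ne h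

lemma wedge_wedge_smul_ne_zero {a b c : ℂ × ℂ} (h₁₂ : wedge a b ≠ 0) (h₂₃ : wedge b c ≠ 0)
    (h₃₁ : wedge c a ≠ 0) : wedge (wedge c a • b) (wedge b c • a) ≠ 0 := by
  rw [wedge_smul_left, wedge_smul_right, wedge_comm b a]
  exact mul_ne_zero h₃₁ (mul_ne_zero h₂₃ (neg_ne_zero.mpr h₁₂))

lemma analyticAt_etaForm (h₁ : AnalyticAt ℂ ω₁ x) (h₂ : AnalyticAt ℂ ω₂ x)
    (h₃ : AnalyticAt ℂ ω₃ x) (h₁₂ : wedge (ω₁ x) (ω₂ x) ≠ 0) (h₂₃ : wedge (ω₂ x) (ω₃ x) ≠ 0)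
    (h₃₁ : wedge (ω₃ x) (ω₁ x) ≠ 0) : AnalyticAt ℂ (etaForm ω₁ ω₂ ω₃) x := by
  have ha := analyticAt_wedge_smul h₂ h₃ h₁
  have hb := analyticAt_wedge_smul h₃ h₁ h₂
  exact ((analyticAt_wedge hb ha).inv (wedge_wedge_smul_ne_zero h₁₂ h₂₃ h₃₁)).smul
    (((analyticAt_extDer ha).smul hb).sub ((analyticAt_extDer hb).smul ha))

lemma isEta_etaForm (h₁ : AnalyticAt ℂ ω₁ x) (h₂ : AnalyticAt ℂ ω₂ x) (h₃ : AnalyticAt ℂ ω₃ x)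
    (h₁₂ : wedge (ω₁ x) (ω₂ x) ≠ 0) (h₂₃ : wedge (ω₂ x) (ω₃ x) ≠ 0)
    (h₃₁ : wedge (ω₃ x) (ω₁ x) ≠ 0) : IsEta ω₁ ω₂ ω₃ x (etaForm ω₁ ω₂ ω₃) := by
  have ev : ∀ᶠ y in 𝓝 x,
      extDer (fun t => wedge (ω₂ t) (ω₃ t) • ω₁ t) y =
        wedge (etaForm ω₁ ω₂ ω₃ y) (wedge (ω₂ y) (ω₃ y) • ω₁ y) ∧
      extDer (fun t => wedge (ω₃ t) (ω₁ t) • ω₂ t) y =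
        wedge (etaForm ω₁ ω₂ ω₃ y) (wedge (ω₃ y) (ω₁ y) • ω₂ y) ∧
      extDer (fun t => wedge (ω₁ t) (ω₂ t) • ω₃ t) y =
        wedge (etaForm ω₁ ω₂ ω₃ y) (wedge (ω₁ y) (ω₂ y) • ω₃ y) := by
    filter_upwards [h₁.eventually_analyticAt, h₂.eventually_analyticAt, h₃.eventually_analyticAt,
      eventually_wedge_ne_zero h₁ h₂ h₁₂, eventually_wedge_ne_zero h₂ h₃ h₂₃,
      eventually_wedge_ne_zero h₃ h₁ h₃₁] with y k₁ k₂ k₃ k₁₂ k₂₃ k₃₁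
    have ha := analyticAt_wedge_smul k₂ k₃ k₁
    have hb := analyticAt_wedge_smul k₃ k₁ k₂
    have hne := wedge_wedge_smul_ne_zero k₁₂ k₂₃ k₃₁
    have e : extDer (fun t => wedge (ω₁ t) (ω₂ t) • ω₃ t) y =
        -(extDer (fun t => wedge (ω₂ t) (ω₃ t) • ω₁ t) y +
          extDer (fun t => wedge (ω₃ t) (ω₁ t) • ω₂ t) y) := by
      simp only [wedge_smul_cyclic (ω₁ _) (ω₂ _) (ω₃ _)]
      rw [extDer_neg, extDer_add ha.differentiableAt hb.differentiableAt]
    rw [e, wedge_smul_cyclic (ω₁ y) (ω₂ y) (ω₃ y)]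
    unfold etaForm
    set a := wedge (ω₂ y) (ω₃ y) • ω₁ y
    set b := wedge (ω₃ y) (ω₁ y) • ω₂ y
    generalize extDer (fun t => wedge (ω₂ t) (ω₃ t) • ω₁ t) y = p
    generalize extDer (fun t => wedge (ω₃ t) (ω₁ t) • ω₂ t) y = q
    have hp : wedge ((wedge b a)⁻¹ • (p • b - q • a)) a = p := by
      rw [wedge_smul_left, inv_mul_eq_iff_eq_mul₀ hne]
      simp only [wedge, Prod.fst_sub, Prod.snd_sub, Prod.smul_fst, Prod.smul_snd, smul_eq_mul]
      ring
    have hq : wedge ((wedge b a)⁻¹ • (p • b - q • a)) b = q := by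
      rw [wedge_smul_left, inv_mul_eq_iff_eq_mul₀ hne]
      simp only [wedge, Prod.fst_sub, Prod.snd_sub, Prod.smul_fst, Prod.smul_snd, smul_eq_mul]
      ring
    refine ⟨hp.symm, hq.symm, ?_⟩
    have : -(a + b) = (-1 : ℂ) • (a + b) := (neg_one_smul ℂ _).symm
    rw [this, wedge_smul_right, wedge_add_right, hp, hq, neg_one_mul]
  exact ⟨analyticAt_etaForm h₁ h₂ h₃ h₁₂ h₂₃ h₃₁, ev.mono fun y h => h.1, ev.mono fun y h => h.2.1,
    ev.mono fun y h => h.2.2⟩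

lemma eq_of_wedge_eq {a b p q : ℂ × ℂ} (h : wedge b a ≠ 0) (ha : wedge p a = wedge q a)
    (hb : wedge p b = wedge q b) : p = q := by
  simp only [wedge] at *
  have e (r : ℂ × ℂ) : r = ((b.1 * a.2 - b.2 * a.1)⁻¹ * ((r.1 * a.2 - r.2 * a.1) * b.1 -
        (r.1 * b.2 - r.2 * b.1) * a.1), (b.1 * a.2 - b.2 * a.1)⁻¹ *
        ((r.1 * a.2 - r.2 * a.1) * b.2 - (r.1 * b.2 - r.2 * b.1) * a.2)) := by
    refine Prod.ext ?_ ?_ <;> simp only <;> rw [eq_inv_mul_iff_mul_eq₀ h] <;> ring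
  rw [e p, e q, ha, hb]

lemma IsEta.eventuallyEq {η η' : ℂ × ℂ → ℂ × ℂ} (h : IsEta ω₁ ω₂ ω₃ x η)
    (h' : IsEta ω₁ ω₂ ω₃ x η') (h₁ : AnalyticAt ℂ ω₁ x) (h₂ : AnalyticAt ℂ ω₂ x)
    (h₃ : AnalyticAt ℂ ω₃ x) (h₁₂ : wedge (ω₁ x) (ω₂ x) ≠ 0) (h₂₃ : wedge (ω₂ x) (ω₃ x) ≠ 0)
    (h₃₁ : wedge (ω₃ x) (ω₁ x) ≠ 0) : η =ᶠ[𝓝 x] η' := by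
  filter_upwards [h.eq₁, h.eq₂, h'.eq₁, h'.eq₂, eventually_wedge_ne_zero h₁ h₂ h₁₂,
    eventually_wedge_ne_zero h₂ h₃ h₂₃, eventually_wedge_ne_zero h₃ h₁ h₃₁]
    with y e₁ e₂ e₁' e₂' k₁₂ k₂₃ k₃₁
  exact eq_of_wedge_eq (wedge_wedge_smul_ne_zero k₁₂ k₂₃ k₃₁) (e₁.symm.trans e₁') (e₂.symm.trans e₂')

lemma IsEta.rotate {η : ℂ × ℂ → ℂ × ℂ} (h : IsEta ω₁ ω₂ ω₃ x η) : IsEta ω₂ ω₃ ω₁ x η :=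
  ⟨h.analyticAt, h.eq₂, h.eq₃, h.eq₁⟩

/-- A transposition changes the sign of both sides of each equation. Together with `IsEta.rotate`,
`η` depends only on the unordered triple. -/
lemma IsEta.swap {η : ℂ × ℂ → ℂ × ℂ} (h : IsEta ω₁ ω₂ ω₃ x η) : IsEta ω₂ ω₁ ω₃ x η := by
  have key (α β γ : ℂ × ℂ → ℂ × ℂ) (y : ℂ × ℂ)
      (e : extDer (fun t => wedge (α t) (β t) • γ t) y = wedge (η y) (wedge (α y) (β y) • γ y)) :
      extDer (fun t => wedge (β t) (α t) • γ t) y = wedge (η y) (wedge (β y) (α y) • γ y) := by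
    have h' : ∀ t, wedge (β t) (α t) • γ t = -(wedge (α t) (β t) • γ t) := fun t => by
      rw [wedge_comm, neg_smul]
    simp only [h']
    rw [extDer_neg, e, wedge_neg_right]
  exact ⟨h.analyticAt, h.eq₂.mono fun y e => key _ _ _ y e, h.eq₁.mono fun y e => key _ _ _ y e,
    h.eq₃.mono fun y e => key _ _ _ y e⟩

/-- All three products `δ_ij ω_l` are multiplied by the same function `g₁ g₂ g₃`, so `η` changes by
the logarithmic differential of that function. -/
lemma IsEta.smul {η : ℂ × ℂ → ℂ × ℂ} (h : IsEta ω₁ ω₂ ω₃ x η) {g₁ g₂ g₃ : ℂ × ℂ → ℂ}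
    (h₁ : AnalyticAt ℂ ω₁ x) (h₂ : AnalyticAt ℂ ω₂ x) (h₃ : AnalyticAt ℂ ω₃ x)
    (hg₁ : AnalyticAt ℂ g₁ x) (hg₂ : AnalyticAt ℂ g₂ x) (hg₃ : AnalyticAt ℂ g₃ x)
    (h0 : g₁ x * g₂ x * g₃ x ≠ 0) :
    IsEta (fun y => g₁ y • ω₁ y) (fun y => g₂ y • ω₂ y) (fun y => g₃ y • ω₃ y) x
      (fun y => η y + (g₁ y * g₂ y * g₃ y)⁻¹ • grad (fun t => g₁ t * g₂ t * g₃ t) y) := by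
  have hG : AnalyticAt ℂ (fun y => g₁ y * g₂ y * g₃ y) x := (hg₁.mul hg₂).mul hg₃
  have key (α β γ : ℂ × ℂ → ℂ × ℂ) (a b c : ℂ × ℂ → ℂ) (hα : AnalyticAt ℂ α x)
      (hβ : AnalyticAt ℂ β x) (hγ : AnalyticAt ℂ γ x)
      (e : ∀ᶠ y in 𝓝 x, extDer (fun t => wedge (α t) (β t) • γ t) y =
        wedge (η y) (wedge (α y) (β y) • γ y))
      (habc : ∀ t, a t * b t * c t = g₁ t * g₂ t * g₃ t) :
      ∀ᶠ y in 𝓝 x, extDer (fun t => wedge (a t • α t) (b t • β t) • (c t • γ t)) y =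
        wedge (η y + (g₁ y * g₂ y * g₃ y)⁻¹ • grad (fun t => g₁ t * g₂ t * g₃ t) y)
          (wedge (a y • α y) (b y • β y) • (c y • γ y)) := by
    filter_upwards [e, hG.eventually_analyticAt, hG.continuousAt.eventually_ne h0,
      (analyticAt_wedge_smul hα hβ hγ).eventually_analyticAt] with y ey hGy h0y hy
    have e' (t : ℂ × ℂ) : wedge (a t • α t) (b t • β t) • (c t • γ t) =
        (g₁ t * g₂ t * g₃ t) • (wedge (α t) (β t) • γ t) := by
      rw [wedge_smul_left, wedge_smul_right, smul_smul, smul_smul, ← habc]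
      congr 1; ring
    simp only [e']
    rw [extDer_smul (h := fun t => g₁ t * g₂ t * g₃ t) hGy.differentiableAt hy.differentiableAt, ey,
      wedge_smul_right (g₁ y * g₂ y * g₃ y), wedge_add_left, wedge_smul_left, mul_add,
      ← mul_assoc _ (_ ⁻¹) (wedge _ _)]
    rw [mul_inv_cancel₀ h0y, one_mul, add_comm]
  exact ⟨h.analyticAt.add ((hG.inv h0).smul (analyticAt_grad hG)),
    key _ _ _ _ _ _ h₂ h₃ h₁ h.eq₁ fun t => by ring,
    key _ _ _ _ _ _ h₃ h₁ h₂ h.eq₂ fun t => by ring,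
    key _ _ _ _ _ _ h₁ h₂ h₃ h.eq₃ fun t => by ring⟩

lemma IsEta.congr {η : ℂ × ℂ → ℂ × ℂ} (h : IsEta ω₁ ω₂ ω₃ x η) {ω₁' ω₂' ω₃' : ℂ × ℂ → ℂ × ℂ}
    (h₁ : ω₁' =ᶠ[𝓝 x] ω₁) (h₂ : ω₂' =ᶠ[𝓝 x] ω₂) (h₃ : ω₃' =ᶠ[𝓝 x] ω₃) :
    IsEta ω₁' ω₂' ω₃' x η := by
  have key {α β γ α' β' γ' : ℂ × ℂ → ℂ × ℂ} (hα : α' =ᶠ[𝓝 x] α) (hβ : β' =ᶠ[𝓝 x] β)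
      (hγ : γ' =ᶠ[𝓝 x] γ) (e : ∀ᶠ y in 𝓝 x, extDer (fun t => wedge (α t) (β t) • γ t) y =
        wedge (η y) (wedge (α y) (β y) • γ y)) :
      ∀ᶠ y in 𝓝 x, extDer (fun t => wedge (α' t) (β' t) • γ' t) y =
        wedge (η y) (wedge (α' y) (β' y) • γ' y) := by
    have h : (fun t => wedge (α' t) (β' t) • γ' t) =ᶠ[𝓝 x] fun t => wedge (α t) (β t) • γ t := by
      filter_upwards [hα, hβ, hγ] with y a b c
      rw [a, b, c]
    filter_upwards [extDer_congr h, h, e] with y h1 h2 h3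
    rw [h1, h3, h2]
  exact ⟨h.analyticAt, key h₂ h₃ h₁ h.eq₁, key h₃ h₁ h₂ h.eq₂, key h₁ h₂ h₃ h.eq₃⟩

end Eta

/-! ### Uniqueness of the curvature -/

lemma eval_linearForm_kernel (a b : ℂ × ℂ) :
    evalForm (linearForm a) (b.2, -b.1) = wedge a b := by
  rw [evalForm_linearForm]; simp only [wedge]; ring

lemma ne_zero_of_wedge_ne_zero_left {a b : ℂ × ℂ} (h : wedge a b ≠ 0) : a ≠ 0 := by
  rintro rfl; simp [wedge] at h

lemma wedge_eq_zero_trans {a b c : ℂ × ℂ} (hc : c ≠ 0) (ha : wedge a c = 0) (hb : wedge b c = 0) :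
    wedge a b = 0 := by
  by_contra h
  refine hc (eq_of_wedge_eq h ?_ ?_)
  · rw [wedge_comm, hb]; simp [wedge]
  · rw [wedge_comm, ha]; simp [wedge]

lemma exists_eq_smul_of_wedge_eq_zero {α β : ℂ × ℂ → ℂ × ℂ} {x : ℂ × ℂ} (hα : AnalyticAt ℂ α x)
    (hβ : AnalyticAt ℂ β x) (hα0 : α x ≠ 0) (hβ0 : β x ≠ 0)
    (h : ∀ᶠ y in 𝓝 x, wedge (β y) (α y) = 0) :
    ∃ g : ℂ × ℂ → ℂ, AnalyticAt ℂ g x ∧ g x ≠ 0 ∧ ∀ᶠ y in 𝓝 x, β y = g y • α y := by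
  have main : ∃ g : ℂ × ℂ → ℂ, AnalyticAt ℂ g x ∧ ∀ᶠ y in 𝓝 x, β y = g y • α y := by
    by_cases h1 : (α x).1 = 0
    · have h2 : (α x).2 ≠ 0 := fun h2 => hα0 (Prod.ext h1 h2)
      refine ⟨fun y => (β y).2 / (α y).2,
        (analyticAt_snd_comp hβ).div (analyticAt_snd_comp hα) h2, ?_⟩
      filter_upwards [h, (analyticAt_snd_comp hα).continuousAt.eventually_ne h2] with y hy h2y
      simp only [wedge] at hy
      ext
      · simp only [Prod.smul_fst, smul_eq_mul]; field_simp; linear_combination hy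
      · simp only [Prod.smul_snd, smul_eq_mul]; field_simp
    · refine ⟨fun y => (β y).1 / (α y).1,
        (analyticAt_fst_comp hβ).div (analyticAt_fst_comp hα) h1, ?_⟩
      filter_upwards [h, (analyticAt_fst_comp hα).continuousAt.eventually_ne h1] with y hy h1y
      simp only [wedge] at hy
      ext
      · simp only [Prod.smul_fst, smul_eq_mul]; field_simp
      · simp only [Prod.smul_snd, smul_eq_mul]; field_simp; linear_combination -hy
  obtain ⟨g, hg, he⟩ := main
  refine ⟨g, hg, fun h0 => hβ0 ?_, he⟩
  rw [he.self_of_nhds, h0, zero_smul]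

lemma IsDecomposition.ne_zero {k : ℕ} {P : ℂ × ℂ → BinaryForm} {x : ℂ × ℂ}
    {α : Fin k → ℂ × ℂ → ℂ × ℂ} (h : IsDecomposition P x α) (hk : 2 ≤ k) (i : Fin k) :
    α i x ≠ 0 := by
  have : Nontrivial (Fin k) := Fin.nontrivial_iff_two_le.mpr hk
  obtain ⟨j, hj⟩ := exists_ne i
  exact ne_zero_of_wedge_ne_zero_left (h.transverse i j hj.symm)

/-- Two local decompositions of a web differ by a permutation and by units. -/
lemma IsDecomposition.exists_perm {k : ℕ} {P : ℂ × ℂ → BinaryForm} {x : ℂ × ℂ}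
    {α β : Fin k → ℂ × ℂ → ℂ × ℂ} (hα : IsDecomposition P x α) (hβ : IsDecomposition P x β)
    (hk : 2 ≤ k) :
    ∃ (σ : Equiv.Perm (Fin k)) (g : Fin k → ℂ × ℂ → ℂ), ∀ i, AnalyticAt ℂ (g i) x ∧ g i x ≠ 0 ∧
      ∀ᶠ y in 𝓝 x, β (σ i) y = g i y • α i y := by
  obtain ⟨u, hu, hu0, hPu⟩ := hα.eq_prod
  obtain ⟨v, hv, hv0, hPv⟩ := hβ.eq_prod
  -- Evaluation on the kernel of `α i` kills the first factorization, hence also some factor of the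
  -- second.
  have hprod (i : Fin k) : ∀ᶠ y in 𝓝 x, ∏ j, wedge (β j y) (α i y) = 0 := by
    filter_upwards [hPu, hPv, hv.continuousAt.eventually_ne hv0] with y h1 h2 h3
    have e := congrArg (fun Q => evalForm Q ((α i y).2, -(α i y).1)) (h1.symm.trans h2)
    simp only [evalForm_mul, evalForm_C, evalForm_prod, eval_linearForm_kernel] at e
    rw [Finset.prod_eq_zero (Finset.mem_univ i) (wedge_self _), mul_zero] at e
    exact (mul_eq_zero.mp e.symm).resolve_left h3
  have hex (i : Fin k) : ∃ j, wedge (β j x) (α i x) = 0 := by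
    obtain ⟨j, -, hj⟩ := Finset.prod_eq_zero_iff.mp (hprod i).self_of_nhds
    exact ⟨j, hj⟩
  choose s hs using hex
  have hinj : Function.Injective s := by
    intro i i' h
    by_contra hne
    refine hα.transverse i i' hne ?_
    refine wedge_eq_zero_trans (hβ.ne_zero hk (s i)) ?_ ?_
    · rw [wedge_comm, hs, neg_zero]
    · rw [wedge_comm, h, hs, neg_zero]
  let σ : Equiv.Perm (Fin k) := Equiv.ofBijective s (Finite.injective_iff_bijective.mp hinj)
  -- The other `β j` are transverse to `α i` at `x`, hence near `x`; so the vanishing factor keeps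
  -- the index `σ i` at nearby points.
  have hw (i : Fin k) : ∀ᶠ y in 𝓝 x, wedge (β (σ i) y) (α i y) = 0 := by
    have hne (j : Fin k) (hj : j ≠ σ i) : ∀ᶠ y in 𝓝 x, wedge (β j y) (α i y) ≠ 0 := by
      refine eventually_wedge_ne_zero (hβ.analyticAt j) (hα.analyticAt i) fun h0 => ?_
      exact hβ.transverse j (σ i) hj (wedge_eq_zero_trans (hα.ne_zero hk i) h0 (hs i))
    have hall : ∀ᶠ y in 𝓝 x, ∀ j, j ≠ σ i → wedge (β j y) (α i y) ≠ 0 := by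
      rw [eventually_all]
      intro j
      by_cases hj : j = σ i
      · exact Eventually.of_forall fun y h => absurd hj h
      · exact (hne j hj).mono fun y h _ => h
    filter_upwards [hall, hprod i] with y h1 h2
    obtain ⟨j, -, hj⟩ := Finset.prod_eq_zero_iff.mp h2
    by_cases hji : j = σ i
    · rwa [hji] at hj
    · exact absurd hj (h1 j hji)
  choose g hg using fun i => exists_eq_smul_of_wedge_eq_zero (hα.analyticAt i)
    (hβ.analyticAt (σ i)) (hα.ne_zero hk i) (hβ.ne_zero hk (σ i)) (hw i)
  exact ⟨σ, g, hg⟩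

lemma sum_lt_lt_eq {k : ℕ} {M : Type*} [AddCommMonoid M] (F : Fin k → Fin k → Fin k → M) :
    ∑ r, ∑ s ∈ Finset.Ioi r, ∑ t ∈ Finset.Ioi s, F r s t =
      ∑ r, ∑ s, ∑ t, if r < s ∧ s < t then F r s t else 0 := by
  refine Finset.sum_congr rfl fun r _ => ?_
  rw [← Finset.sum_filter_of_ne (s := Finset.univ) (p := fun s => r < s)]
  · refine Finset.sum_congr (by ext; simp) fun s hs => ?_
    rw [← Finset.sum_filter]
    refine Finset.sum_congr ?_ fun _ _ => rfl
    ext t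
    have : r < s := by simpa using hs
    simp [this]
  · intro s _ h
    by_contra hrs
    exact h (Finset.sum_eq_zero fun t _ => by simp [hrs])

/-- Six times the sum of a symmetric function over increasing triples is its sum over triples of
distinct indices. -/
lemma six_mul_sum_lt_lt {k : ℕ} (F : Fin k → Fin k → Fin k → ℂ)
    (hswap : ∀ r s t, r ≠ s → s ≠ t → r ≠ t → F s r t = F r s t)
    (hrot : ∀ r s t, r ≠ s → s ≠ t → r ≠ t → F s t r = F r s t) :
    6 * ∑ r, ∑ s ∈ Finset.Ioi r, ∑ t ∈ Finset.Ioi s, F r s t =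
      ∑ r, ∑ s, ∑ t, if r ≠ s ∧ s ≠ t ∧ r ≠ t then F r s t else 0 := by
  rw [sum_lt_lt_eq]
  set T : Fin k → Fin k → Fin k → ℂ := fun r s t => if r < s ∧ s < t then F r s t else 0 with hT
  have key (r s t : Fin k) : (if r ≠ s ∧ s ≠ t ∧ r ≠ t then F r s t else 0) =
      T r s t + T s t r + T t r s + T s r t + T r t s + T t s r := by
    by_cases h : r ≠ s ∧ s ≠ t ∧ r ≠ t
    · obtain ⟨h1, h2, h3⟩ := h
      rw [if_pos ⟨h1, h2, h3⟩]
      have e1 := hswap r s t h1 h2 h3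
      have e2 := hrot r s t h1 h2 h3
      have e3 := hrot s t r h2 h3.symm h1.symm
      have e4 := hswap s t r h2 h3.symm h1.symm
      have e5 := hswap t r s h3.symm h1 h2.symm
      simp only [hT]
      rcases lt_or_gt_of_ne h1 with a | a <;> rcases lt_or_gt_of_ne h2 with b | b <;>
        rcases lt_or_gt_of_ne h3 with c | c <;>
        first
        | (exfalso; order)
        | simp [a, b, c, a.not_gt, b.not_gt, c.not_gt, e1, e2, e3, e4, e5]
    · rw [if_neg h]
      have h' : r = s ∨ s = t ∨ r = t := by tauto
      simp only [hT]
      rcases h' with rfl | rfl | rfl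
      · simp; grind
      · simp; grind
      · simp; grind
  simp only [key, Finset.sum_add_distrib]
  have c1 (T : Fin k → Fin k → Fin k → ℂ) :
      ∑ r, ∑ s, ∑ t, T s t r = ∑ r, ∑ s, ∑ t, T r s t := by
    rw [Finset.sum_comm]
    exact Finset.sum_congr rfl fun s _ => Finset.sum_comm
  have c2 : ∑ r, ∑ s, ∑ t, T t r s = ∑ r, ∑ s, ∑ t, T r s t :=
    (c1 fun r s t => T t r s).symm
  have c3 : ∑ r, ∑ s, ∑ t, T s r t = ∑ r, ∑ s, ∑ t, T r s t := Finset.sum_comm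
  have c4 : ∑ r, ∑ s, ∑ t, T r t s = ∑ r, ∑ s, ∑ t, T r s t :=
    Finset.sum_congr rfl fun r _ => Finset.sum_comm
  have c5 : ∑ r, ∑ s, ∑ t, T t s r = ∑ r, ∑ s, ∑ t, T r s t :=
    (c1 fun r s t => T s r t).trans c3
  rw [c1 T, c2, c3, c4, c5]
  ring

/-- A permutation does not preserve the increasing triples, but it does preserve the triples of
distinct indices, whose sum is six times this one. -/
lemma sum_lt_lt_perm {k : ℕ} (F : Fin k → Fin k → Fin k → ℂ)
    (hswap : ∀ r s t, r ≠ s → s ≠ t → r ≠ t → F s r t = F r s t)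
    (hrot : ∀ r s t, r ≠ s → s ≠ t → r ≠ t → F s t r = F r s t) (σ : Equiv.Perm (Fin k)) :
    ∑ r, ∑ s ∈ Finset.Ioi r, ∑ t ∈ Finset.Ioi s, F (σ r) (σ s) (σ t) =
      ∑ r, ∑ s ∈ Finset.Ioi r, ∑ t ∈ Finset.Ioi s, F r s t := by
  have h6 : (6 : ℂ) ≠ 0 := by norm_num
  refine mul_left_cancel₀ h6 ?_
  rw [six_mul_sum_lt_lt F hswap hrot, six_mul_sum_lt_lt (fun r s t => F (σ r) (σ s) (σ t))
    (fun r s t h1 h2 h3 => hswap _ _ _ (σ.injective.ne h1) (σ.injective.ne h2) (σ.injective.ne h3))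
    (fun r s t h1 h2 h3 => hrot _ _ _ (σ.injective.ne h1) (σ.injective.ne h2) (σ.injective.ne h3))]
  conv_rhs => rw [← Equiv.sum_comp σ]
  refine Finset.sum_congr rfl fun r _ => ?_
  conv_rhs => rw [← Equiv.sum_comp σ]
  refine Finset.sum_congr rfl fun s _ => ?_
  conv_rhs => rw [← Equiv.sum_comp σ]
  simp only [ne_eq, EmbeddingLike.apply_eq_iff_eq]

/-- The curvature of a `3`-web, for explicitly given `1`-forms. -/
noncomputable def tripleCurvature (ω₁ ω₂ ω₃ : ℂ × ℂ → ℂ × ℂ) (x : ℂ × ℂ) : ℂ :=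
  extDer (etaForm ω₁ ω₂ ω₃) x

section

variable {k : ℕ} {P : ℂ × ℂ → BinaryForm} {x : ℂ × ℂ} {α β : Fin k → ℂ × ℂ → ℂ × ℂ}

lemma IsDecomposition.isEta_etaForm (hα : IsDecomposition P x α) {r s t : Fin k} (h₁ : r ≠ s)
    (h₂ : s ≠ t) (h₃ : r ≠ t) : IsEta (α r) (α s) (α t) x (etaForm (α r) (α s) (α t)) :=
  Webs.isEta_etaForm (hα.analyticAt r) (hα.analyticAt s) (hα.analyticAt t) (hα.transverse _ _ h₁)
    (hα.transverse _ _ h₂) (hα.transverse _ _ h₃.symm)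

lemma IsDecomposition.etaForm_eventuallyEq (hα : IsDecomposition P x α) {r s t : Fin k}
    (h₁ : r ≠ s) (h₂ : s ≠ t) (h₃ : r ≠ t) {η : ℂ × ℂ → ℂ × ℂ}
    (h : IsEta (α r) (α s) (α t) x η) : η =ᶠ[𝓝 x] etaForm (α r) (α s) (α t) :=
  h.eventuallyEq (hα.isEta_etaForm h₁ h₂ h₃) (hα.analyticAt r) (hα.analyticAt s) (hα.analyticAt t)
    (hα.transverse _ _ h₁) (hα.transverse _ _ h₂) (hα.transverse _ _ h₃.symm)

lemma IsDecomposition.etaForm_swap (hα : IsDecomposition P x α) {r s t : Fin k}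
    (h₁ : r ≠ s) (h₂ : s ≠ t) (h₃ : r ≠ t) :
    etaForm (α s) (α r) (α t) =ᶠ[𝓝 x] etaForm (α r) (α s) (α t) :=
  hα.etaForm_eventuallyEq h₁ h₂ h₃ (hα.isEta_etaForm h₁.symm h₃ h₂).swap

lemma IsDecomposition.etaForm_rotate (hα : IsDecomposition P x α) {r s t : Fin k}
    (h₁ : r ≠ s) (h₂ : s ≠ t) (h₃ : r ≠ t) :
    etaForm (α s) (α t) (α r) =ᶠ[𝓝 x] etaForm (α r) (α s) (α t) :=
  (hα.etaForm_eventuallyEq h₂ h₃.symm h₁.symm (hα.isEta_etaForm h₁ h₂ h₃).rotate).symm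

/-- The value at `x` of the curvature computed from a decomposition does not depend on it. -/
lemma IsDecomposition.sum_tripleCurvature_eq (hα : IsDecomposition P x α)
    (hβ : IsDecomposition P x β) :
    ∑ r, ∑ s ∈ Finset.Ioi r, ∑ t ∈ Finset.Ioi s, tripleCurvature (β r) (β s) (β t) x =
      ∑ r, ∑ s ∈ Finset.Ioi r, ∑ t ∈ Finset.Ioi s, tripleCurvature (α r) (α s) (α t) x := by
  obtain hk | hk := lt_or_ge k 2
  · refine Finset.sum_congr rfl fun r _ => Finset.sum_congr rfl fun s hs => ?_
    have h : r < s := by simpa using hs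
    have h' : (r : ℕ) < s := h
    omega
  obtain ⟨σ, g, hg⟩ := hα.exists_perm hβ hk
  rw [← sum_lt_lt_perm (fun r s t => tripleCurvature (β r) (β s) (β t) x)
    (fun r s t h₁ h₂ h₃ => (extDer_congr (hβ.etaForm_swap h₁ h₂ h₃)).self_of_nhds)
    (fun r s t h₁ h₂ h₃ => (extDer_congr (hβ.etaForm_rotate h₁ h₂ h₃)).self_of_nhds) σ]
  refine Finset.sum_congr rfl fun r _ => Finset.sum_congr rfl fun s hs =>
    Finset.sum_congr rfl fun t ht => ?_
  have h₁ : r ≠ s := ne_of_lt (by simpa using hs)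
  have h₂ : s ≠ t := ne_of_lt (by simpa using ht)
  have h₃ : r ≠ t := ne_of_lt (lt_trans (b := s) (by simpa using hs) (by simpa using ht))
  have hG : AnalyticAt ℂ (fun y => g r y * g s y * g t y) x :=
    ((hg r).1.mul (hg s).1).mul (hg t).1
  have hG0 : g r x * g s x * g t x ≠ 0 :=
    mul_ne_zero (mul_ne_zero (hg r).2.1 (hg s).2.1) (hg t).2.1
  have e := hα.isEta_etaForm h₁ h₂ h₃
  have e' := (e.smul (hα.analyticAt r) (hα.analyticAt s) (hα.analyticAt t) (hg r).1 (hg s).1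
    (hg t).1 hG0).congr (hg r).2.2 (hg s).2.2 (hg t).2.2
  have e'' := hβ.etaForm_eventuallyEq (σ.injective.ne h₁) (σ.injective.ne h₂) (σ.injective.ne h₃) e'
  change extDer _ x = extDer _ x
  rw [← (extDer_congr e'').self_of_nhds, extDer_add e.analyticAt.differentiableAt
    (analyticAt_logDeriv hG hG0).differentiableAt, extDer_logDeriv hG hG0, add_zero]

/-- Outside the discriminant the curvature is well defined. -/
lemma IsDecomposition.hasCurvatureAt (hα : IsDecomposition P x α) :
    HasCurvatureAt k P x
      (∑ r, ∑ s ∈ Finset.Ioi r, ∑ t ∈ Finset.Ioi s, tripleCurvature (α r) (α s) (α t) x) := by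
  have hsum (β : Fin k → ℂ × ℂ → ℂ × ℂ) (hβ : IsDecomposition P x β)
      (η : Fin k → Fin k → Fin k → ℂ × ℂ → ℂ × ℂ)
      (hη : ∀ r s t, r < s → s < t → IsEta (β r) (β s) (β t) x (η r s t)) :
      extDer (fun y => ∑ r, ∑ s ∈ Finset.Ioi r, ∑ t ∈ Finset.Ioi s, η r s t y) x =
      ∑ r, ∑ s ∈ Finset.Ioi r, ∑ t ∈ Finset.Ioi s, tripleCurvature (β r) (β s) (β t) x := by
    have hd (r s t : Fin k) (hs : s ∈ Finset.Ioi r) (ht : t ∈ Finset.Ioi s) :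
        DifferentiableAt ℂ (η r s t) x :=
      (hη r s t (by simpa using hs) (by simpa using ht)).analyticAt.differentiableAt
    rw [extDer_sum _ fun r _ => DifferentiableAt.fun_sum fun s hs =>
      DifferentiableAt.fun_sum fun t ht => hd r s t hs ht]
    refine Finset.sum_congr rfl fun r _ => ?_
    rw [extDer_sum _ fun s hs => DifferentiableAt.fun_sum fun t ht => hd r s t hs ht]
    refine Finset.sum_congr rfl fun s hs => ?_
    rw [extDer_sum _ fun t ht => hd r s t hs ht]
    refine Finset.sum_congr rfl fun t ht => ?_
    have hrs : r < s := by simpa using hs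
    have hst : s < t := by simpa using ht
    exact (extDer_congr (hβ.etaForm_eventuallyEq hrs.ne hst.ne (hrs.trans hst).ne
      (hη r s t hrs hst))).self_of_nhds
  refine ⟨⟨α, fun r s t => etaForm (α r) (α s) (α t), hα, fun r s t hrs hst =>
    hα.isEta_etaForm hrs.ne hst.ne (hrs.trans hst).ne, ?_⟩, ?_⟩
  · rw [hsum α hα _ fun r s t hrs hst => hα.isEta_etaForm hrs.ne hst.ne (hrs.trans hst).ne]
  · rintro c ⟨β, η, hβ, hη, rfl⟩
    rw [hsum β hβ η hη, hα.sum_tripleCurvature_eq hβ]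

end

end Webs

namespace Webs

/-! ### Webs given by `1`-forms `ξ + c_i df` -/

section Jets

variable {ι : Type*}

/-- For `1`-forms `ω_i = dx + c_i dY` with `d c_i = x_i dx + y_i dY`, the equation satisfied by
`η_rst` along `ω_r`. -/
noncomputable def jetS (c x y : ι → ℂ) (r s t : ι) : ℂ :=
  x r + (c r * (x t - x s) - (y t - y s)) / (c t - c s)

/-- The coefficient of `dx` in `η_rst`. -/
noncomputable def jetA (c x y : ι → ℂ) (r s t : ι) : ℂ :=
  (jetS c x y r s t - jetS c x y s t r) / (c r - c s)

/-- The coefficient of `dY` in `η_rst`. -/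
noncomputable def jetB (c x y : ι → ℂ) (r s t : ι) : ℂ :=
  jetA c x y r s t * c r - jetS c x y r s t

end Jets

/-- The component of a covector along `ξ` in the frame `ξ, φ`. -/
noncomputable def frameFst (ξ φ a : ℂ × ℂ) : ℂ := wedge a φ / wedge ξ φ

/-- The component of a covector along `φ` in the frame `ξ, φ`. -/
noncomputable def frameSnd (ξ φ a : ℂ × ℂ) : ℂ := wedge ξ a / wedge ξ φ

lemma frameFst_mul {ξ φ : ℂ × ℂ} (h : wedge ξ φ ≠ 0) (a : ℂ × ℂ) :
    wedge a φ = wedge ξ φ * frameFst ξ φ a := by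
  rw [frameFst, mul_div_cancel₀ _ h]

lemma frameSnd_mul {ξ φ : ℂ × ℂ} (h : wedge ξ φ ≠ 0) (a : ℂ × ℂ) :
    wedge a ξ = -(wedge ξ φ * frameSnd ξ φ a) := by
  rw [frameSnd, mul_div_cancel₀ _ h, wedge_comm]

/-- With `δ = h (ξ ∧ φ)`, `G = d(ξ ∧ φ)` and `γ` the differentials of the slopes, the left side is
`d(δ ω)` expanded by the product rule and the right side is `η ∧ δ ω`. The terms in `G` match, and
what remains is the hypothesis on `A c - B`. -/
lemma wedge_frame_eq {ξ φ G γr γs γt : ℂ × ℂ} {c h A B : ℂ} (hJ : wedge ξ φ ≠ 0) (hh : h ≠ 0)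
    (hAB : A * c - B = frameFst ξ φ γr +
      (c * (frameFst ξ φ γt - frameFst ξ φ γs) - (frameSnd ξ φ γt - frameSnd ξ φ γs)) / h) :
    wedge (h • G + wedge ξ φ • (γt - γs)) (ξ + c • φ) + h * wedge ξ φ * wedge γr φ =
      wedge (A • ξ + B • φ + (wedge ξ φ)⁻¹ • G) ((h * wedge ξ φ) • (ξ + c • φ)) := by
  have e (γ : ℂ × ℂ) : wedge γ (ξ + c • φ) =
      wedge ξ φ * (c * frameFst ξ φ γ - frameSnd ξ φ γ) := by
    rw [wedge_add_right, wedge_smul_right, frameFst_mul hJ, frameSnd_mul hJ]; ring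
  have e' : wedge (γt - γs) (ξ + c • φ) = wedge γt (ξ + c • φ) - wedge γs (ξ + c • φ) := by
    simp only [wedge, Prod.fst_sub, Prod.snd_sub]; ring
  have e₁ : wedge ξ (ξ + c • φ) = c * wedge ξ φ := by
    rw [wedge_add_right, wedge_smul_right, wedge_self, zero_add]
  have e₂ : wedge φ (ξ + c • φ) = -wedge ξ φ := by
    rw [wedge_add_right, wedge_smul_right, wedge_self, wedge_comm]; ring
  rw [wedge_smul_right, wedge_add_left, wedge_add_left, wedge_add_left]
  simp only [wedge_smul_left]
  rw [e', e γt, e γs, e₁, e₂, frameFst_mul hJ γr]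
  have hB : B = A * c - (frameFst ξ φ γr +
      (c * (frameFst ξ φ γt - frameFst ξ φ γs) - (frameSnd ξ φ γt - frameSnd ξ φ γs)) / h) := by
    rw [← hAB]; ring
  rw [hB]
  field_simp
  ring

lemma extDer_const_add_smul_grad {ξ : ℂ × ℂ} {f c : ℂ × ℂ → ℂ} {y : ℂ × ℂ}
    (hf : AnalyticAt ℂ f y) (hc : AnalyticAt ℂ c y) :
    extDer (fun t => ξ + c t • grad f t) y = wedge (grad c y) (grad f y) := by
  rw [extDer_add (α := fun _ => ξ) (β := fun t => c t • grad f t) (differentiableAt_const _)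
    (hc.differentiableAt.smul (analyticAt_grad hf).differentiableAt),
    extDer_smul hc.differentiableAt (analyticAt_grad hf).differentiableAt, extDer_grad hf]
  simp [extDer]

lemma wedge_normalized (ξ φ : ℂ × ℂ) (c c' : ℂ) :
    wedge (ξ + c • φ) (ξ + c' • φ) = (c' - c) * wedge ξ φ := by
  simp only [wedge, Prod.fst_add, Prod.snd_add, Prod.smul_fst, Prod.smul_snd, smul_eq_mul]; ring

lemma extDer_wedge_smul_normalized {ξ : ℂ × ℂ} {f c₁ c₂ c₃ : ℂ × ℂ → ℂ} {y : ℂ × ℂ}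
    (hf : AnalyticAt ℂ f y) (h₁ : AnalyticAt ℂ c₁ y) (h₂ : AnalyticAt ℂ c₂ y)
    (h₃ : AnalyticAt ℂ c₃ y) :
    extDer (fun t => wedge (ξ + c₂ t • grad f t) (ξ + c₃ t • grad f t) •
        (ξ + c₁ t • grad f t)) y =
      wedge ((c₃ y - c₂ y) • grad (fun t => wedge ξ (grad f t)) y +
        wedge ξ (grad f y) • (grad c₃ y - grad c₂ y)) (ξ + c₁ y • grad f y) +
      (c₃ y - c₂ y) * wedge ξ (grad f y) * wedge (grad c₁ y) (grad f y) := by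
  have hφ := analyticAt_grad hf
  have hJ : AnalyticAt ℂ (fun t => wedge ξ (grad f t)) y := analyticAt_wedge analyticAt_const hφ
  have hd : AnalyticAt ℂ (fun t => c₃ t - c₂ t) y := h₃.sub h₂
  simp only [wedge_normalized]
  rw [extDer_smul (h := fun t => (c₃ t - c₂ t) * wedge ξ (grad f t))
    (α := fun t => ξ + c₁ t • grad f t) (hd.mul hJ).differentiableAt
    ((differentiableAt_const _).add (h₁.differentiableAt.smul hφ.differentiableAt)),
    extDer_const_add_smul_grad hf h₁, grad_mul hd.differentiableAt hJ.differentiableAt,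
    grad_sub h₃.differentiableAt h₂.differentiableAt]

/-- The `1`-form attached to the `3`-web given by `ξ + c_i df`, in the frame `ξ, df`. -/
lemma etaForm_normalized {ι : Type*} {ξ : ℂ × ℂ} {f : ℂ × ℂ → ℂ} {c : ι → ℂ × ℂ → ℂ} {y : ℂ × ℂ}
    {r s t : ι} (hf : AnalyticAt ℂ f y) (hJ : wedge ξ (grad f y) ≠ 0)
    (hr : AnalyticAt ℂ (c r) y) (hs : AnalyticAt ℂ (c s) y) (ht : AnalyticAt ℂ (c t) y)
    (hrs : c r y ≠ c s y) (hst : c s y ≠ c t y) (hrt : c r y ≠ c t y) :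
    etaForm (fun z => ξ + c r z • grad f z) (fun z => ξ + c s z • grad f z)
        (fun z => ξ + c t z • grad f z) y =
      jetA (fun i => c i y) (fun i => frameFst ξ (grad f y) (grad (c i) y))
        (fun i => frameSnd ξ (grad f y) (grad (c i) y)) r s t • ξ +
      jetB (fun i => c i y) (fun i => frameFst ξ (grad f y) (grad (c i) y))
        (fun i => frameSnd ξ (grad f y) (grad (c i) y)) r s t • grad f y +
      (wedge ξ (grad f y))⁻¹ • grad (fun z => wedge ξ (grad f z)) y := by
  have hφ := analyticAt_grad hf
  have han (i : ι) (hi : AnalyticAt ℂ (c i) y) : AnalyticAt ℂ (fun z => ξ + c i z • grad f z) y :=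
    analyticAt_const.add (hi.smul hφ)
  have hw (i j : ι) (h : c i y ≠ c j y) :
      wedge (ξ + c i y • grad f y) (ξ + c j y • grad f y) ≠ 0 := by
    rw [wedge_normalized]
    exact mul_ne_zero (sub_ne_zero.mpr h.symm) hJ
  have hη := isEta_etaForm (han r hr) (han s hs) (han t ht) (hw r s hrs) (hw s t hst)
    (hw t r hrt.symm)
  have h₁ := hη.eq₁.self_of_nhds
  have h₂ := hη.eq₂.self_of_nhds
  -- The first two equations already determine `η`.
  refine eq_of_wedge_eq (wedge_wedge_smul_ne_zero (hw r s hrs) (hw s t hst) (hw t r hrt.symm))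
    (h₁.symm.trans ?_) (h₂.symm.trans ?_)
  · rw [extDer_wedge_smul_normalized hf hr hs ht, wedge_normalized]
    refine wedge_frame_eq hJ (sub_ne_zero.mpr hst.symm) ?_
    simp only [jetB, jetS]
    ring
  -- In the second equation `A c_s - B` has to equal `jetS s t r`; `jetA` is the solution of this
  -- together with `A c_r - B = jetS r s t`.
  · rw [extDer_wedge_smul_normalized hf hs ht hr, wedge_normalized]
    refine wedge_frame_eq hJ (sub_ne_zero.mpr hrt) ?_
    have := sub_ne_zero.mpr hrs
    simp only [jetB, jetA]
    have e : (jetS (fun i => c i y) (fun i => frameFst ξ (grad f y) (grad (c i) y))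
        (fun i => frameSnd ξ (grad f y) (grad (c i) y)) s t r) =
      frameFst ξ (grad f y) (grad (c s) y) + (c s y * (frameFst ξ (grad f y) (grad (c r) y) -
        frameFst ξ (grad f y) (grad (c t) y)) - (frameSnd ξ (grad f y) (grad (c r) y) -
        frameSnd ξ (grad f y) (grad (c t) y))) / (c r y - c t y) := rfl
    rw [← e]
    field_simp
    ring

section Normalized

variable {k : ℕ} {P : ℂ × ℂ → BinaryForm} {x : ℂ × ℂ} {α β : Fin k → ℂ × ℂ → ℂ × ℂ}

lemma IsDecomposition.eventually (hα : IsDecomposition P x α) :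
    ∀ᶠ y in 𝓝 x, IsDecomposition P y α := by
  obtain ⟨u, hu, hu0, he⟩ := hα.eq_prod
  have h1 : ∀ᶠ y in 𝓝 x, ∀ i, AnalyticAt ℂ (α i) y :=
    eventually_all.mpr fun i => (hα.analyticAt i).eventually_analyticAt
  have h2 : ∀ᶠ y in 𝓝 x, ∀ i j, i ≠ j → wedge (α i y) (α j y) ≠ 0 := by
    refine eventually_all.mpr fun i => eventually_all.mpr fun j => ?_
    by_cases hij : i = j
    · exact Eventually.of_forall fun y h => absurd hij h
    · exact (eventually_wedge_ne_zero (hα.analyticAt i) (hα.analyticAt j)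
        (hα.transverse i j hij)).mono fun y h _ => h
  filter_upwards [h1, h2, hu.eventually_analyticAt, hu.continuousAt.eventually_ne hu0,
    he.eventually_nhds] with y a b c d e
  exact ⟨a, b, u, c, d, e⟩

lemma etaForm_congr {ω₁ ω₂ ω₃ ω₁' ω₂' ω₃' : ℂ × ℂ → ℂ × ℂ}
    (h₁ : ω₁' =ᶠ[𝓝 x] ω₁) (h₂ : ω₂' =ᶠ[𝓝 x] ω₂) (h₃ : ω₃' =ᶠ[𝓝 x] ω₃) :
    etaForm ω₁' ω₂' ω₃' x = etaForm ω₁ ω₂ ω₃ x := by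
  have h (α β γ α' β' γ' : ℂ × ℂ → ℂ × ℂ) (hα : α' =ᶠ[𝓝 x] α) (hβ : β' =ᶠ[𝓝 x] β)
      (hγ : γ' =ᶠ[𝓝 x] γ) : extDer (fun t => wedge (α' t) (β' t) • γ' t) x =
        extDer (fun t => wedge (α t) (β t) • γ t) x := by
    refine (extDer_congr ?_).self_of_nhds
    filter_upwards [hα, hβ, hγ] with y a b c
    rw [a, b, c]
  unfold etaForm
  rw [h _ _ _ _ _ _ h₂ h₃ h₁, h _ _ _ _ _ _ h₃ h₁ h₂, h₁.self_of_nhds, h₂.self_of_nhds,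
    h₃.self_of_nhds]

/-- The sum of the forms `η_rst` computed from the decomposition `α`. -/
noncomputable def etaSum (α : Fin k → ℂ × ℂ → ℂ × ℂ) (y : ℂ × ℂ) : ℂ × ℂ :=
  ∑ r, ∑ s ∈ Finset.Ioi r, ∑ t ∈ Finset.Ioi s, etaForm (α r) (α s) (α t) y

lemma IsDecomposition.analyticAt_etaSum (hα : IsDecomposition P x α) :
    AnalyticAt ℂ (etaSum α) x := by
  refine Finset.analyticAt_fun_sum _ fun r _ => Finset.analyticAt_fun_sum _ fun s hs =>
    Finset.analyticAt_fun_sum _ fun t ht => ?_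
  have hrs : r < s := by simpa using hs
  have hst : s < t := by simpa using ht
  exact (hα.isEta_etaForm hrs.ne hst.ne (hrs.trans hst).ne).analyticAt

lemma IsDecomposition.extDer_etaSum (hα : IsDecomposition P x α) :
    HasCurvatureAt k P x (extDer (etaSum α) x) := by
  have h := hα.hasCurvatureAt
  rwa [← h.2 _ ⟨α, fun r s t => etaForm (α r) (α s) (α t), hα, fun r s t hrs hst =>
    hα.isEta_etaForm hrs.ne hst.ne (hrs.trans hst).ne, rfl⟩] at h

/-- Decompositions normalised by their wedge product with a given form lead to the same sum of
the forms `η_rst`. -/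
lemma IsDecomposition.etaSum_eq (hα : IsDecomposition P x α) (hβ : IsDecomposition P x β)
    {φ : ℂ × ℂ → ℂ × ℂ} {J : ℂ × ℂ → ℂ} (hαφ : ∀ i, ∀ᶠ y in 𝓝 x, wedge (α i y) (φ y) = J y)
    (hβφ : ∀ i, ∀ᶠ y in 𝓝 x, wedge (β i y) (φ y) = J y) (hJ : ∀ᶠ y in 𝓝 x, J y ≠ 0) :
    etaSum β x = etaSum α x := by
  obtain hk | hk := lt_or_ge k 2
  · refine Finset.sum_congr rfl fun r _ => Finset.sum_congr rfl fun s hs => ?_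
    have h : r < s := by simpa using hs
    have h' : (r : ℕ) < s := h
    omega
  obtain ⟨σ, g, hg⟩ := hα.exists_perm hβ hk
  -- Matching forms a priori agree up to a unit; equal wedges with `φ` make the unit `1`. Hence the
  -- sum of the `η` itself, and not only its differential, is independent of the decomposition.
  have hσ (i : Fin k) : β (σ i) =ᶠ[𝓝 x] α i := by
    filter_upwards [(hg i).2.2, hαφ i, hβφ (σ i), hJ] with y h1 h2 h3 h4
    rw [h1, wedge_smul_left, h2] at h3
    rw [h1, mul_right_cancel₀ h4 (h3.trans (one_mul _).symm), one_smul]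
  -- The permutation lemma concerns scalar functions, so it is applied to each coordinate.
  have key (p : ℂ × ℂ →ₗ[ℂ] ℂ) : p (etaSum β x) = p (etaSum α x) := by
    simp only [etaSum, map_sum]
    rw [← sum_lt_lt_perm (fun r s t => p (etaForm (β r) (β s) (β t) x))
      (fun r s t h₁ h₂ h₃ => by rw [(hβ.etaForm_swap h₁ h₂ h₃).self_of_nhds])
      (fun r s t h₁ h₂ h₃ => by rw [(hβ.etaForm_rotate h₁ h₂ h₃).self_of_nhds]) σ]
    refine Finset.sum_congr rfl fun r _ => Finset.sum_congr rfl fun s _ =>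
      Finset.sum_congr rfl fun t _ => ?_
    rw [etaForm_congr (hσ r) (hσ s) (hσ t)]
  exact Prod.ext (key (LinearMap.fst ℂ ℂ ℂ)) (key (LinearMap.snd ℂ ℂ ℂ))

end Normalized

end Webs

/-! ### Local inverses and removable singularities in two variables -/

namespace Webs

/-- The analytic inverse function theorem in finite dimension. -/
lemma exists_analytic_local_inverse {E : Type*} [NormedAddCommGroup E] [NormedSpace ℂ E]
    [FiniteDimensional ℂ E] {F : E → E} {x : E} (hF : AnalyticAt ℂ F x)
    (hinj : Function.Injective (fderiv ℂ F x)) :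
    ∃ Θ : E → E, AnalyticAt ℂ Θ (F x) ∧ Θ (F x) = x ∧ (∀ᶠ y in 𝓝 x, Θ (F y) = y) ∧
      ∀ᶠ z in 𝓝 (F x), F (Θ z) = z := by
  have : CompleteSpace E := FiniteDimensional.complete ℂ E
  let A : E ≃L[ℂ] E :=
    (LinearEquiv.ofInjectiveEndo (fderiv ℂ F x : E →ₗ[ℂ] E) hinj).toContinuousLinearEquiv
  have hA : fderiv ℂ F x = (A : E →L[ℂ] E) := by ext v; rfl
  have hs : HasStrictFDerivAt F (A : E →L[ℂ] E) x := hA ▸ hF.hasStrictFDerivAt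
  let R := hs.toOpenPartialHomeomorph F
  have hx : x ∈ R.source := hs.mem_toOpenPartialHomeomorph_source
  refine ⟨R.symm, R.analyticAt_symm' hx hF hA, R.left_inv hx, ?_, ?_⟩
  · exact R.eventually_left_inverse hx
  · exact R.eventually_right_inverse (R.map_source hx)

/-- The integral of continuous functions over a circle, as a continuous linear functional. -/
noncomputable def circleFunctional {ρ : ℝ} (hρ : 0 ≤ ρ) :
    C(Metric.sphere (0 : ℂ) ρ, ℂ) →L[ℂ] ℂ :=
  have hc (g : C(Metric.sphere (0 : ℂ) ρ, ℂ)) : Continuous fun θ : ℝ =>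
      deriv (circleMap 0 ρ) θ * g ⟨circleMap 0 ρ θ, circleMap_mem_sphere 0 hρ θ⟩ := by
    simp only [deriv_circleMap]
    exact ((continuous_circleMap 0 ρ).mul continuous_const).mul
      (g.continuous.comp ((continuous_circleMap 0 ρ).subtype_mk _))
  LinearMap.mkContinuous
    { toFun := fun g => ∫ θ in (0 : ℝ)..2 * Real.pi,
        deriv (circleMap 0 ρ) θ * g ⟨circleMap 0 ρ θ, circleMap_mem_sphere 0 hρ θ⟩
      map_add' := fun g h => by
        rw [← intervalIntegral.integral_add ((hc g).intervalIntegrable _ _)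
          ((hc h).intervalIntegrable _ _)]
        simp only [ContinuousMap.add_apply, mul_add]
      map_smul' := fun c g => by
        simp only [RingHom.id_apply, smul_eq_mul]
        rw [← intervalIntegral.integral_const_mul]
        refine intervalIntegral.integral_congr fun θ _ => ?_
        simp only [ContinuousMap.smul_apply, smul_eq_mul]
        ring } (ρ * (2 * Real.pi)) fun g => by
    have h := intervalIntegral.norm_integral_le_of_norm_le_const (a := 0) (b := 2 * Real.pi)
      (C := ρ * ‖g‖) (f := fun θ : ℝ =>
        deriv (circleMap 0 ρ) θ * g ⟨circleMap 0 ρ θ, circleMap_mem_sphere 0 hρ θ⟩) fun θ _ => by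
      rw [norm_mul]
      refine mul_le_mul ?_ (g.norm_coe_le_norm _) (norm_nonneg _) hρ
      simp [abs_of_nonneg hρ]
    refine h.trans (le_of_eq ?_)
    rw [sub_zero, abs_of_nonneg Real.two_pi_pos.le]
    ring

lemma circleFunctional_apply {ρ : ℝ} (hρ : 0 ≤ ρ) (g : C(Metric.sphere (0 : ℂ) ρ, ℂ)) {h : ℂ → ℂ}
    (H : ∀ z, g z = h z) : circleFunctional hρ g = ∮ z in C(0, ρ), h z := by
  change ∫ θ in (0 : ℝ)..2 * Real.pi, _ = _
  rw [circleIntegral]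
  refine intervalIntegral.integral_congr fun θ _ => ?_
  simp only [H, smul_eq_mul]

/-- The function `z ↦ (z - w)⁻¹` on a circle depends analytically on `w` inside the circle. -/
lemma analyticAt_inverse_sub {ρ : ℝ} (hρ : 0 < ρ) :
    AnalyticAt ℂ (fun w : ℂ => Ring.inverse
      ((ContinuousMap.mk fun z : Metric.sphere (0 : ℂ) ρ => (z : ℂ)) -
        algebraMap ℂ C(Metric.sphere (0 : ℂ) ρ, ℂ) w)) 0 := by
  set ι : C(Metric.sphere (0 : ℂ) ρ, ℂ) := ⟨fun z => (z : ℂ), continuous_subtype_val⟩ with hι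
  have hu : IsUnit (ι - algebraMap ℂ C(Metric.sphere (0 : ℂ) ρ, ℂ) 0) := by
    rw [ContinuousMap.isUnit_iff_forall_ne_zero]
    intro z h
    have hz := z.2
    simp [hι] at h
    rw [mem_sphere_zero_iff_norm, h, norm_zero] at hz
    exact hρ.ne hz
  have h1 : AnalyticAt ℂ Ring.inverse (ι - algebraMap ℂ C(Metric.sphere (0 : ℂ) ρ, ℂ) 0) :=
    analyticOnNhd_inverse (𝕜 := ℂ) _ hu
  have h2 : AnalyticAt ℂ (fun w => ι - algebraMap ℂ C(Metric.sphere (0 : ℂ) ρ, ℂ) w) 0 :=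
    analyticAt_const.sub ((Algebra.linearMap ℂ C(Metric.sphere (0 : ℂ) ρ, ℂ)).mkContinuous 1
      (fun w => by
        rw [one_mul, Algebra.linearMap_apply]
        exact (ContinuousMap.norm_le _ (norm_nonneg w)).mpr fun z => le_of_eq (by simp)) |>.analyticAt 0)
  exact AnalyticAt.fun_comp (g := Ring.inverse) (x := (0 : ℂ)) h1 h2

lemma inverse_sub_apply {ρ : ℝ} {w : ℂ} (hw : ‖w‖ < ρ) (z : Metric.sphere (0 : ℂ) ρ) :
    Ring.inverse ((ContinuousMap.mk fun z : Metric.sphere (0 : ℂ) ρ => (z : ℂ)) -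
        algebraMap ℂ C(Metric.sphere (0 : ℂ) ρ, ℂ) w) z = ((z : ℂ) - w)⁻¹ := by
  set u := (ContinuousMap.mk fun z : Metric.sphere (0 : ℂ) ρ => (z : ℂ)) -
        algebraMap ℂ C(Metric.sphere (0 : ℂ) ρ, ℂ) w with hu'
  have hu : IsUnit u := by
    rw [ContinuousMap.isUnit_iff_forall_ne_zero]
    intro z h
    have hz := z.2
    simp [hu', sub_eq_zero] at h
    rw [mem_sphere_zero_iff_norm, h] at hz
    exact hw.ne hz
  have h := congrArg (fun g : C(Metric.sphere (0 : ℂ) ρ, ℂ) => g z) (Ring.inverse_mul_cancel u hu)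
  simp only [ContinuousMap.mul_apply, ContinuousMap.one_apply] at h
  exact eq_inv_of_mul_eq_one_left h

/-- **Removable singularities** along a straight line. -/
lemma exists_analytic_extension_flat {G : ℂ × ℂ → ℂ} {a : ℂ}
    (hG : ∀ᶠ z in 𝓝 (a, (0 : ℂ)), z.2 ≠ 0 → AnalyticAt ℂ G z)
    (hlim : ∀ᶠ z in 𝓝 (a, (0 : ℂ)), z.2 = 0 →
      Tendsto (fun t => t.2 * G t) (𝓝[{t | t.2 ≠ 0}] z) (𝓝 0)) :
    ∃ H : ℂ × ℂ → ℂ, AnalyticAt ℂ H (a, 0) ∧ ∀ᶠ z in 𝓝 (a, (0 : ℂ)), z.2 ≠ 0 → H z = G z := by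
  obtain ⟨ε, hε, hball⟩ := Metric.eventually_nhds_iff_ball.mp (hG.and hlim)
  set ρ : ℝ := ε / 2 with hρ'
  have hρ : 0 < ρ := by positivity
  have hmem {s w : ℂ} (hs : s ∈ Metric.closedBall a ρ) (hw : w ∈ Metric.closedBall (0 : ℂ) ρ) :
      (s, w) ∈ Metric.ball (a, (0 : ℂ)) ε := by
    rw [Metric.mem_ball, Prod.dist_eq]
    rw [Metric.mem_closedBall] at hs hw
    exact (max_le hs hw).trans_lt (half_lt_self hε)
  have hsph {w : ℂ} (hw : w ∈ Metric.sphere (0 : ℂ) ρ) : w ≠ 0 := by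
    rintro rfl
    simp at hw
    exact hρ.ne hw
  have hcont : ContinuousOn (Function.uncurry fun s w => G (s, w))
      (Metric.sphere a ρ ×ˢ Metric.sphere (0 : ℂ) ρ) := by
    rintro ⟨s, w⟩ ⟨hs, hw⟩
    exact ((hball _ (hmem (Metric.sphere_subset_closedBall hs)
      (Metric.sphere_subset_closedBall hw))).1 (hsph hw)).continuousAt.continuousWithinAt
  -- The slice `w ↦ G (s, w)` is regarded as a point of the Banach algebra of continuous functions
  -- on the circle `|w| = ρ`, where `G` has no singularity.
  set Φ₀ : ℂ → C(Metric.sphere (0 : ℂ) ρ, ℂ) := fun s =>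
    ContinuousMap.mkD ((Metric.sphere (0 : ℂ) ρ).domRestrict fun w => G (s, w)) 0 with hΦ₀
  have hΦ₀c : ContinuousOn Φ₀ (Metric.sphere a ρ) :=
    ContinuousMap.continuousOn_mkD_restrict_of_uncurry _ _ hcont
  have hΦ₀a {s : ℂ} (hs : s ∈ Metric.sphere a ρ) (w : Metric.sphere (0 : ℂ) ρ) :
      Φ₀ s w = G (s, w) := by
    have : ContinuousOn (fun w => G (s, w)) (Metric.sphere (0 : ℂ) ρ) :=
      hcont.comp (Continuous.prodMk_right s).continuousOn fun _ hz => ⟨hs, hz⟩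
    rw [hΦ₀]
    simp only
    rw [ContinuousMap.mkD_of_continuousOn this]
    rfl
  -- Cauchy's integral in `s`, with values in this Banach algebra, reproduces the slices and shows
  -- that they depend analytically on `s`.
  set Φ : ℂ → C(Metric.sphere (0 : ℂ) ρ, ℂ) := fun w =>
    (2 * Real.pi * Complex.I : ℂ)⁻¹ • ∮ z in C(a, ρ), (z - w)⁻¹ • Φ₀ z with hΦ
  have hΦan : AnalyticAt ℂ Φ a := by
    have h1 : CircleIntegrable Φ₀ a (⟨ρ, hρ.le⟩ : NNReal) :=
      ContinuousOn.circleIntegrable hρ.le hΦ₀c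
    exact (hasFPowerSeriesOn_cauchy_integral h1 (by exact_mod_cast hρ)).analyticAt
  have hΦa {s : ℂ} (hs : s ∈ Metric.ball a ρ) (w : Metric.sphere (0 : ℂ) ρ) :
      Φ s w = G (s, w) := by
    have hd : DifferentiableOn ℂ (fun z => G (z, (w : ℂ))) (Metric.closedBall a ρ) := by
      intro z hz
      have := (hball _ (hmem hz (Metric.sphere_subset_closedBall w.2))).1 (hsph w.2)
      exact (this.differentiableAt.comp z
        (differentiableAt_id.prodMk (differentiableAt_const _))).differentiableWithinAt
    have hcauchy := hd.circleIntegral_sub_inv_smul hs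
    have hint : IntervalIntegrable (fun θ : ℝ => deriv (circleMap a ρ) θ •
        ((circleMap a ρ θ - s)⁻¹ • Φ₀ (circleMap a ρ θ))) MeasureTheory.volume 0
        (2 * Real.pi) := by
      refine CircleIntegrable.out (f := fun z => (z - s)⁻¹ • Φ₀ z)
        (ContinuousOn.circleIntegrable hρ.le (ContinuousOn.smul (ContinuousOn.inv₀
          (continuousOn_id.sub continuousOn_const) fun z hz => ?_) hΦ₀c))
      change z - s ≠ 0
      rw [sub_ne_zero]
      rintro rfl
      exact (Metric.mem_ball.mp hs).ne (Metric.mem_sphere.mp hz)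
    have e : (∮ z in C(a, ρ), (z - s)⁻¹ • Φ₀ z) w = ∮ z in C(a, ρ), (z - s)⁻¹ • G (z, w) := by
      have := (ContinuousMap.evalCLM ℂ w).intervalIntegral_comp_comm hint
      rw [circleIntegral, circleIntegral]
      refine this.symm.trans (intervalIntegral.integral_congr fun θ _ => ?_)
      simp only [map_smul]
      change _ • _ • Φ₀ (circleMap a ρ θ) w = _
      rw [hΦ₀a (circleMap_mem_sphere a hρ.le θ)]
    rw [hΦ, ContinuousMap.smul_apply, e, hcauchy, smul_smul,
      inv_mul_cancel₀ Complex.two_pi_I_ne_zero, one_smul]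
  -- The extension is Cauchy's integral of `G (s, ·)` over `|w| = ρ`. As a continuous linear
  -- functional applied to a product of analytic maps into the Banach algebra, it is jointly
  -- analytic; that it agrees with `G` off `w = 0` is the one-variable removable singularity theorem
  -- for each fixed `s`.
  refine ⟨fun z => (2 * Real.pi * Complex.I : ℂ)⁻¹ * circleFunctional hρ.le
    (Φ z.1 * Ring.inverse ((ContinuousMap.mk fun z : Metric.sphere (0 : ℂ) ρ => (z : ℂ)) -
        algebraMap ℂ C(Metric.sphere (0 : ℂ) ρ, ℂ) z.2)), ?_, ?_⟩
  · refine analyticAt_const.mul ((circleFunctional hρ.le).analyticAt _ |>.comp ?_)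
    exact (AnalyticAt.comp (g := Φ) (f := Prod.fst) hΦan analyticAt_fst).mul
      ((analyticAt_inverse_sub hρ).fun_comp (f := Prod.snd) (x := (a, (0 : ℂ))) analyticAt_snd)
  · filter_upwards [Metric.ball_mem_nhds (a, (0 : ℂ)) hρ] with ⟨s, w⟩ hz hw
    rw [Metric.mem_ball, Prod.dist_eq, max_lt_iff] at hz
    have hs : s ∈ Metric.ball a ρ := hz.1
    have hw' : w ∈ Metric.ball (0 : ℂ) ρ := hz.2
    rw [circleFunctional_apply hρ.le (h := fun z => (z - w)⁻¹ • G (s, z))]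
    · have hs' := Metric.ball_subset_closedBall hs
      have hd : DifferentiableOn ℂ (fun z => G (s, z)) (Metric.closedBall (0 : ℂ) ρ \ {0}) := by
        intro z hz
        have := (hball _ (hmem hs' hz.1)).1 hz.2
        exact (this.differentiableAt.comp z
          ((differentiableAt_const _).prodMk differentiableAt_id)).differentiableWithinAt
      have hl : Tendsto (fun t => t * G (s, t)) (𝓝[≠] (0 : ℂ)) (𝓝 0) := by
        have h1 := (hball _ (hmem hs' (Metric.mem_closedBall_self hρ.le))).2 rfl
        refine h1.comp (f := fun t => (s, t)) (tendsto_nhdsWithin_iff.mpr ⟨?_, ?_⟩)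
        · exact ((Continuous.prodMk_right s).tendsto 0).mono_left nhdsWithin_le_nhds
        · exact eventually_mem_nhdsWithin
      have ho : (fun z => G (s, z) - G (s, 0)) =o[𝓝[≠] (0 : ℂ)] fun z => (z - 0)⁻¹ := by
        rw [Asymptotics.isLittleO_iff_tendsto']
        · have h2 : Tendsto (fun t : ℂ => t * G (s, 0)) (𝓝[≠] (0 : ℂ)) (𝓝 0) := by
            have : Continuous fun t : ℂ => t * G (s, 0) := by fun_prop
            simpa using (this.tendsto 0).mono_left nhdsWithin_le_nhds
          have h3 := hl.sub h2
          rw [sub_zero] at h3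
          refine h3.congr fun t => ?_
          rw [sub_zero, div_inv_eq_mul]
          ring
        · filter_upwards [eventually_mem_nhdsWithin] with t ht h
          rw [sub_zero, inv_eq_zero] at h
          exact absurd h ht
      have hu := Complex.differentiableOn_update_limUnder_of_isLittleO
        (Metric.closedBall_mem_nhds (0 : ℂ) hρ) hd ho
      have hc := hu.circleIntegral_sub_inv_smul hw'
      rw [Function.update_of_ne hw] at hc
      have e : (∮ z in C(0, ρ), (z - w)⁻¹ • G (s, z)) = ∮ z in C(0, ρ), (z - w)⁻¹ •
          Function.update (fun z => G (s, z)) 0 (limUnder (𝓝[≠] 0) fun z => G (s, z)) z :=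
        circleIntegral.integral_congr hρ.le fun z hz => by
          rw [Function.update_of_ne (hsph hz)]
      rw [e, hc, smul_eq_mul, ← mul_assoc, inv_mul_cancel₀ Complex.two_pi_I_ne_zero, one_mul]
    · intro z
      rw [ContinuousMap.mul_apply, hΦa hs,
        inverse_sub_apply (mem_ball_zero_iff.mp hw'), mul_comm]
      rfl

/-- **Removable singularities** along a smooth curve `f = 0`. -/
lemma exists_analytic_extension {f G : ℂ × ℂ → ℂ} {x : ℂ × ℂ} (hf : AnalyticAt ℂ f x)
    (h0 : f x = 0) (hdf : grad f x ≠ 0) (hG : ∀ᶠ y in 𝓝 x, f y ≠ 0 → AnalyticAt ℂ G y)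
    (hlim : ∀ᶠ y in 𝓝 x, f y = 0 → Tendsto (fun t => f t * G t) (𝓝[{t | f t ≠ 0}] y) (𝓝 0)) :
    ∃ H : ℂ × ℂ → ℂ, AnalyticAt ℂ H x ∧ ∀ᶠ y in 𝓝 x, f y ≠ 0 → H y = G y := by
  -- A linear function `l` completes `f` to local coordinates `(l, f)`, in which the curve becomes
  -- the line `{z.2 = 0}`.
  obtain ⟨l, hl⟩ : ∃ l : ℂ × ℂ →L[ℂ] ℂ, wedge (l (1, 0), l (0, 1)) (grad f x) ≠ 0 := by
    by_cases h1 : (grad f x).2 = 0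
    · have h2 : (grad f x).1 ≠ 0 := fun h2 => hdf (Prod.ext h2 h1)
      exact ⟨ContinuousLinearMap.snd ℂ ℂ ℂ, by simpa [wedge] using h2⟩
    · exact ⟨ContinuousLinearMap.fst ℂ ℂ ℂ, by simpa [wedge] using h1⟩
  set Ψ : ℂ × ℂ → ℂ × ℂ := fun y => (l y, f y) with hΨ
  have hΨa {y : ℂ × ℂ} (hy : AnalyticAt ℂ f y) : AnalyticAt ℂ Ψ y := (l.analyticAt y).prod hy
  have hinj : Function.Injective (fderiv ℂ Ψ x) := by
    have hd : fderiv ℂ Ψ x = l.prod (fderiv ℂ f x) := by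
      rw [hΨ, (l.differentiableAt).fderiv_prodMk hf.differentiableAt, l.fderiv]
    rw [hd, injective_iff_map_eq_zero]
    intro v hv
    have e (L : ℂ × ℂ →L[ℂ] ℂ) : L v = v.1 * L (1, 0) + v.2 * L (0, 1) := by
      have hv : v = v.1 • ((1 : ℂ), (0 : ℂ)) + v.2 • ((0 : ℂ), (1 : ℂ)) := by ext <;> simp
      conv_lhs => rw [hv, map_add, map_smul, map_smul, smul_eq_mul, smul_eq_mul]
    have h1 : l v = 0 := congrArg Prod.fst hv
    have h2 : fderiv ℂ f x v = 0 := congrArg Prod.snd hv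
    rw [e] at h1 h2
    simp only [wedge, grad] at hl
    refine Prod.ext ?_ ?_
    · refine (mul_eq_zero.mp ?_).resolve_right hl
      linear_combination (fderiv ℂ f x (0, 1)) * h1 - l (0, 1) * h2
    · refine (mul_eq_zero.mp ?_).resolve_right hl
      linear_combination l (1, 0) * h2 - (fderiv ℂ f x (1, 0)) * h1
  obtain ⟨Θ, hΘ, hΘx, hleft, hright⟩ := exists_analytic_local_inverse (hΨa hf) hinj
  have hΨx : Ψ x = (l x, 0) := by rw [hΨ]; simp [h0]
  rw [hΨx] at hΘ hΘx hright
  have hΘt : Tendsto Θ (𝓝 (l x, 0)) (𝓝 x) := by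
    simpa only [ContinuousAt, hΘx] using hΘ.continuousAt
  obtain ⟨H, hH, hHe⟩ := exists_analytic_extension_flat (G := fun z => G (Θ z)) (a := l x) (by
      filter_upwards [hΘt.eventually hG, hright, hΘ.eventually_analyticAt] with z h1 h2 h3 hz
      refine (h1 ?_).comp h3
      rw [← h2] at hz
      exact hz) (by
      filter_upwards [hΘt.eventually hlim, hright.eventually_nhds, hΘ.eventually_analyticAt]
        with z h1 h2 h3 hz
      have hz' : f (Θ z) = 0 := (congrArg Prod.snd h2.self_of_nhds).trans hz
      have h4 : Tendsto Θ (𝓝[{t | t.2 ≠ 0}] z) (𝓝[{t | f t ≠ 0}] (Θ z)) := by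
        refine tendsto_nhdsWithin_iff.mpr ⟨h3.continuousAt.mono_left nhdsWithin_le_nhds, ?_⟩
        filter_upwards [h2.filter_mono nhdsWithin_le_nhds, eventually_mem_nhdsWithin] with t ht ht0
        have : f (Θ t) = t.2 := congrArg Prod.snd ht
        change f (Θ t) ≠ 0
        rwa [this]
      refine ((h1 hz').comp h4).congr' ?_
      filter_upwards [h2.filter_mono nhdsWithin_le_nhds] with t ht
      have : f (Θ t) = t.2 := congrArg Prod.snd ht
      simp only [Function.comp, this])
  have hΨt : Tendsto Ψ (𝓝 x) (𝓝 (l x, 0)) := by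
    simpa only [ContinuousAt, hΨx] using (hΨa hf).continuousAt
  refine ⟨fun y => H (Ψ y), (by rw [hΨx]; exact hH : AnalyticAt ℂ H (Ψ x)).comp (hΨa hf), ?_⟩
  filter_upwards [hΨt.eventually hHe, hleft] with y h1 h2 hy
  rw [h1 hy, h2]

end Webs

namespace Webs

open Polynomial

/-! ### Families of polynomials with analytic coefficients -/

/-- The coefficients of the polynomials `p y` are analytic functions of `y` at `x`. -/
def CoeffAnalyticAt (p : ℂ × ℂ → ℂ[X]) (x : ℂ × ℂ) : Prop :=
  ∀ n, AnalyticAt ℂ (fun y => (p y).coeff n) x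

section CoeffAnalytic

variable {p q : ℂ × ℂ → ℂ[X]} {x : ℂ × ℂ}

lemma CoeffAnalyticAt.add (hp : CoeffAnalyticAt p x) (hq : CoeffAnalyticAt q x) :
    CoeffAnalyticAt (fun y => p y + q y) x := fun n => by
  simp only [coeff_add]
  exact (hp n).add (hq n)

lemma CoeffAnalyticAt.mul (hp : CoeffAnalyticAt p x) (hq : CoeffAnalyticAt q x) :
    CoeffAnalyticAt (fun y => p y * q y) x := fun n => by
  simp only [coeff_mul]
  exact Finset.analyticAt_fun_sum _ fun i _ => (hp i.1).mul (hq i.2)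

lemma CoeffAnalyticAt.const (r : ℂ[X]) : CoeffAnalyticAt (fun _ => r) x :=
  fun _ => analyticAt_const

lemma CoeffAnalyticAt.pow (hp : CoeffAnalyticAt p x) (n : ℕ) :
    CoeffAnalyticAt (fun y => p y ^ n) x := by
  induction n with
  | zero => simpa only [pow_zero] using CoeffAnalyticAt.const 1
  | succ n ih => simpa only [pow_succ] using ih.mul hp

lemma CoeffAnalyticAt.sum {ι : Type*} (s : Finset ι) {p : ι → ℂ × ℂ → ℂ[X]}
    (hp : ∀ i ∈ s, CoeffAnalyticAt (p i) x) : CoeffAnalyticAt (fun y => ∑ i ∈ s, p i y) x :=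
  fun n => by
    simp only [finsetSum_coeff]
    exact Finset.analyticAt_fun_sum _ fun i hi => hp i hi n

lemma CoeffAnalyticAt.polyC {c : ℂ × ℂ → ℂ} (hc : AnalyticAt ℂ c x) :
    CoeffAnalyticAt (fun y => C (c y)) x := fun n => by
  simp only [coeff_C]
  split_ifs
  · exact hc
  · exact analyticAt_const

lemma CoeffAnalyticAt.congr (hp : CoeffAnalyticAt p x) (h : ∀ᶠ y in 𝓝 x, p y = q y) :
    CoeffAnalyticAt q x := fun n =>
  (hp n).congr (h.mono fun y hy => by simp only [hy])

lemma CoeffAnalyticAt.eventually_le (hp : CoeffAnalyticAt p x) (k : ℕ) :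
    ∀ᶠ y in 𝓝 x, ∀ n ≤ k, AnalyticAt ℂ (fun y => (p y).coeff n) y := by
  have : ∀ᶠ y in 𝓝 x, ∀ n : Fin (k + 1), AnalyticAt ℂ (fun y => (p y).coeff n) y :=
    eventually_all.mpr fun n => (hp n).eventually_analyticAt
  exact this.mono fun y hy n hn => hy ⟨n, by omega⟩

/-- The bound on the degree leaves finitely many coefficients to control, so one neighbourhood
serves them all. -/
lemma CoeffAnalyticAt.eventually (hp : CoeffAnalyticAt p x) {k : ℕ}
    (hdeg : ∀ᶠ y in 𝓝 x, (p y).natDegree ≤ k) : ∀ᶠ y in 𝓝 x, CoeffAnalyticAt p y := by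
  filter_upwards [hp.eventually_le k, hdeg.eventually_nhds] with y hy hd n
  obtain hn | hn := le_or_gt n k
  · exact hy n hn
  · refine analyticAt_const.congr (f := fun _ => (0 : ℂ)) ?_
    filter_upwards [hd] with z hz
    exact (coeff_eq_zero_of_natDegree_lt (hz.trans_lt hn)).symm

end CoeffAnalytic

/-- A homogeneous form restricted to a line, as a sum over the monomials of its degree. -/
lemma restrictLine_eq_sum {k : ℕ} {P : BinaryForm} (hP : P.IsHomogeneous k) (a b : ℂ × ℂ) :
    restrictLine P a b = ∑ j ∈ Finset.range (k + 1),
      C (P.coeff (Finsupp.single 0 j + Finsupp.single 1 (k - j))) *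
        ((C a.1 * X + C b.1) ^ j * (C a.2 * X + C b.2) ^ (k - j)) := by
  set m : ℕ → (Fin 2 →₀ ℕ) := fun j => Finsupp.single 0 j + Finsupp.single 1 (k - j) with hm
  have hm0 (j : ℕ) : m j 0 = j := by simp [hm]
  have hm1 (j : ℕ) : m j 1 = k - j := by simp [hm]
  have hinj : Function.Injective m := fun i j h => by rw [← hm0 i, h, hm0]
  have hsub : P.support ⊆ (Finset.range (k + 1)).image m := by
    intro d hd
    have hdeg := hP (MvPolynomial.mem_support_iff.mp hd)
    have : d 0 + d 1 = k := by
      rw [← hdeg, Finsupp.weight_apply, Finsupp.sum_fintype] <;> simp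
    refine Finset.mem_image.mpr ⟨d 0, Finset.mem_range.mpr (by omega), ?_⟩
    ext i
    fin_cases i
    · exact hm0 _
    · exact (hm1 _).trans (by simp only [Fin.mk_one]; omega)
  unfold restrictLine
  rw [MvPolynomial.aeval_def, MvPolynomial.eval₂_eq', Finset.sum_subset hsub fun d _ hd => by
    rw [MvPolynomial.notMem_support_iff.mp hd, map_zero, zero_mul],
    Finset.sum_image fun i _ j _ h => hinj h]
  refine Finset.sum_congr rfl fun j _ => ?_
  rw [Fin.prod_univ_two, hm0, hm1]
  rfl

lemma coeffAnalyticAt_restrictLine {k : ℕ} {P : ℂ × ℂ → BinaryForm} {x : ℂ × ℂ}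
    {a b : ℂ × ℂ → ℂ × ℂ} (hP : ∀ᶠ y in 𝓝 x, (P y).IsHomogeneous k)
    (hc : ∀ m, AnalyticAt ℂ (fun y => (P y).coeff m) x) (ha : AnalyticAt ℂ a x)
    (hb : AnalyticAt ℂ b x) : CoeffAnalyticAt (fun y => restrictLine (P y) (a y) (b y)) x := by
  refine CoeffAnalyticAt.congr ?_ (hP.mono fun y hy => (restrictLine_eq_sum hy _ _).symm)
  have h {g h : ℂ × ℂ → ℂ} (hg : AnalyticAt ℂ g x) (hh : AnalyticAt ℂ h x) :
      CoeffAnalyticAt (fun y => C (g y) * X + C (h y)) x :=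
    ((CoeffAnalyticAt.polyC hg).mul (.const X)).add (.polyC hh)
  exact CoeffAnalyticAt.sum _ fun j _ => (CoeffAnalyticAt.polyC (hc _)).mul
    (((h (analyticAt_fst_comp ha) (analyticAt_fst_comp hb)).pow _).mul
      ((h (analyticAt_snd_comp ha) (analyticAt_snd_comp hb)).pow _))

/-! ### Analytic dependence of simple roots -/

section Roots

variable {p : ℂ × ℂ → ℂ[X]} {x : ℂ × ℂ} {k : ℕ}

lemma CoeffAnalyticAt.analyticAt_eval (hp : CoeffAnalyticAt p x)
    (hdeg : ∀ᶠ y in 𝓝 x, (p y).natDegree ≤ k) (r : ℂ) :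
    AnalyticAt ℂ (fun z : (ℂ × ℂ) × ℂ => (p z.1).eval z.2) (x, r) := by
  have hfst : Tendsto Prod.fst (𝓝 (x, r)) (𝓝 x) := continuous_fst.tendsto _
  have h : AnalyticAt ℂ (fun z : (ℂ × ℂ) × ℂ =>
      ∑ j ∈ Finset.range (k + 1), (p z.1).coeff j * z.2 ^ j) (x, r) :=
    Finset.analyticAt_fun_sum _ fun j _ => ((hp j).fun_comp (f := Prod.fst) (x := (x, r))
      analyticAt_fst).mul (analyticAt_snd.pow j)
  refine h.congr ?_
  filter_upwards [hfst.eventually hdeg] with z hz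
  rw [eval_eq_sum_range' (Nat.lt_succ_of_le hz)]

/-- Simple roots depend analytically on the coefficients. -/
lemma CoeffAnalyticAt.exists_root (hp : CoeffAnalyticAt p x)
    (hdeg : ∀ᶠ y in 𝓝 x, (p y).natDegree ≤ k) {r : ℂ} (hr : (p x).eval r = 0)
    (hr' : (derivative (p x)).eval r ≠ 0) :
    ∃ c : ℂ × ℂ → ℂ, AnalyticAt ℂ c x ∧ c x = r ∧ ∀ᶠ y in 𝓝 x, (p y).eval (c y) = 0 := by
  set E : (ℂ × ℂ) × ℂ → ℂ := fun z => (p z.1).eval z.2 with hE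
  have hEa : AnalyticAt ℂ E (x, r) := hp.analyticAt_eval hdeg r
  -- The implicit function theorem, by inverting `(y, w) ↦ (y, p_y(w))`: its differential is
  -- injective because the root is simple.
  set F : (ℂ × ℂ) × ℂ → (ℂ × ℂ) × ℂ := fun z => (z.1, E z) with hF
  have hFa : AnalyticAt ℂ F (x, r) := analyticAt_fst.prod hEa
  have hd : fderiv ℂ F (x, r) = (ContinuousLinearMap.fst ℂ (ℂ × ℂ) ℂ).prod (fderiv ℂ E (x, r)) := by
    rw [hF, differentiableAt_fst.fderiv_prodMk hEa.differentiableAt, fderiv_fst]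
  have hE' (w : ℂ) : fderiv ℂ E (x, r) (0, w) = (derivative (p x)).eval r * w := by
    have h1 : HasFDerivAt (fun w : ℂ => (x, w)) (ContinuousLinearMap.inr ℂ (ℂ × ℂ) ℂ) r :=
      hasFDerivAt_prodMk_right x r
    have h2 := hEa.differentiableAt.hasFDerivAt.comp r h1
    have h3 := ((p x).hasDerivAt r).hasFDerivAt
    have h4 := congrArg (fun L => L w) (h2.unique h3)
    simpa [mul_comm] using h4
  have hinj : Function.Injective (fderiv ℂ F (x, r)) := by
    rw [hd, injective_iff_map_eq_zero]
    rintro ⟨v, w⟩ hv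
    have h1 : v = 0 := congrArg Prod.fst hv
    have h2 : fderiv ℂ E (x, r) (v, w) = 0 := congrArg Prod.snd hv
    rw [h1, hE'] at h2
    rw [h1, (mul_eq_zero.mp h2).resolve_left hr']
    rfl
  obtain ⟨Θ, hΘ, hΘx, -, hright⟩ := exists_analytic_local_inverse hFa hinj
  have hFx : F (x, r) = (x, 0) := by simp only [hF, hE, hr]
  rw [hFx] at hΘ hΘx hright
  have hι : AnalyticAt ℂ (fun y : ℂ × ℂ => (y, (0 : ℂ))) x := analyticAt_id.prod analyticAt_const
  refine ⟨fun y => (Θ (y, 0)).2, ?_, congrArg Prod.snd hΘx, ?_⟩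
  · exact analyticAt_snd.comp (AnalyticAt.fun_comp (g := Θ) (x := x) hΘ hι)
  · have ht : Tendsto (fun y : ℂ × ℂ => (y, (0 : ℂ))) (𝓝 x) (𝓝 (x, 0)) := hι.continuousAt
    filter_upwards [ht.eventually hright] with y hy
    have h1 : (Θ (y, 0)).1 = y := congrArg Prod.fst hy
    have h2 : E (Θ (y, 0)) = 0 := congrArg Prod.snd hy
    have h3 : E (Θ (y, 0)) = (p y).eval (Θ (y, 0)).2 := by simp only [hE, h1]
    rw [← h3, h2]

/-- For `k > 0` the difference of the two sides has degree less than `k` and `k` distinct zeros. -/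
lemma eq_C_mul_prod_of_roots {q : ℂ[X]} (hq : q.natDegree ≤ k) {c : Fin k → ℂ}
    (hc : Function.Injective c) (h : ∀ i, q.eval (c i) = 0) :
    q = C (q.coeff k) * ∏ i, (X - C (c i)) := by
  have hmonic : (∏ i, (X - C (c i))).Monic := monic_prod_X_sub_C _ _
  have hdeg : (∏ i, (X - C (c i))).natDegree = k := by simp
  rw [← sub_eq_zero]
  set D := q - C (q.coeff k) * ∏ i, (X - C (c i)) with hD
  obtain hk | hk := Nat.eq_zero_or_pos k
  · subst hk
    rw [hD, eq_C_of_natDegree_le_zero hq]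
    simp
  have hDd : D.natDegree < k := by
    have h1 : D.natDegree ≤ k := by
      exact (natDegree_sub_le_of_le hq ((natDegree_C_mul_le _ _).trans hdeg.le)).trans
        (max_self k).le
    refine lt_of_le_of_ne h1 fun h2 => ?_
    have h3 : D.coeff k = 0 := by
      have h4 : (∏ i, (X - C (c i))).coeff k = 1 := by
        have := hmonic.coeff_natDegree
        rwa [hdeg] at this
      rw [hD, coeff_sub, coeff_C_mul, h4, mul_one, sub_self]
    have h4 : D.leadingCoeff = 0 := by rw [leadingCoeff, h2, h3]
    rw [leadingCoeff_eq_zero.mp h4, natDegree_zero] at h2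
    omega
  refine eq_zero_of_natDegree_lt_card_of_eval_eq_zero D hc (fun i => ?_) (by simpa using hDd)
  rw [hD, eval_sub, h, eval_mul, eval_prod, Finset.prod_eq_zero (Finset.mem_univ i) (by simp)]
  simp

lemma eval_derivative_C_mul_prod (b : ℂ) (c : Fin k → ℂ) (i : Fin k) :
    (derivative (C b * ∏ i, (X - C (c i)))).eval (c i) =
      b * ∏ j ∈ Finset.univ.erase i, (c i - c j) := by
  rw [derivative_C_mul, eval_mul, eval_C, derivative_prod_finset, eval_finsetSum,
    Finset.sum_eq_single i]
  · simp [eval_prod]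
  · intro b _ hb
    rw [eval_mul, eval_prod,
      Finset.prod_eq_zero (Finset.mem_erase.mpr ⟨hb.symm, Finset.mem_univ i⟩) (by simp), zero_mul]
  · simp

lemma eval_derivative_eq_sum {k : ℕ} {q : ℂ[X]} (hq : q.natDegree ≤ k) (z : ℂ) :
    (derivative q).eval z = ∑ j ∈ Finset.range (k + 1), q.coeff j * (j * z ^ (j - 1)) := by
  rw [derivative_eval, sum_over_range' _ (by simp) (k + 1) (Nat.lt_succ_of_le hq)]
  exact Finset.sum_congr rfl fun j _ => by ring

/-- A family of polynomials with distinct roots at `x` splits analytically near `x`. -/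
lemma CoeffAnalyticAt.exists_roots (hp : CoeffAnalyticAt p x)
    (hdeg : ∀ᶠ y in 𝓝 x, (p y).natDegree ≤ k) (hk : (p x).coeff k ≠ 0) {r : Fin k → ℂ}
    (hr : Function.Injective r) (h : p x = C ((p x).coeff k) * ∏ i, (X - C (r i))) :
    ∃ c : Fin k → ℂ × ℂ → ℂ, (∀ i, AnalyticAt ℂ (c i) x) ∧ (∀ i, c i x = r i) ∧
      ∀ᶠ y in 𝓝 x, p y = C ((p y).coeff k) * ∏ i, (X - C (c i y)) := by
  have hex (i : Fin k) := hp.exists_root hdeg (r := r i) (by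
    rw [h, eval_mul, eval_prod, Finset.prod_eq_zero (Finset.mem_univ i) (by simp), mul_zero]) (by
    rw [h, eval_derivative_C_mul_prod]
    refine mul_ne_zero hk (Finset.prod_ne_zero_iff.mpr fun j hj => ?_)
    exact sub_ne_zero.mpr (hr.ne (Finset.ne_of_mem_erase hj).symm))
  choose c hca hcx hc using hex
  refine ⟨c, hca, hcx, ?_⟩
  have hinj : ∀ᶠ y in 𝓝 x, ∀ i j, i ≠ j → c i y ≠ c j y := by
    refine eventually_all.mpr fun i => eventually_all.mpr fun j => ?_
    by_cases hij : i = j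
    · exact Eventually.of_forall fun y h => absurd hij h
    · have : (c i x) - (c j x) ≠ 0 := by
        rw [hcx, hcx, sub_ne_zero]; exact hr.ne hij
      exact (((hca i).sub (hca j)).continuousAt.eventually_ne this).mono
        fun y hy _ => sub_ne_zero.mp hy
  filter_upwards [hinj, hdeg, eventually_all.mpr hc] with y h1 h2 h3
  exact eq_C_mul_prod_of_roots h2 (fun i j hij => by_contra fun h => h1 i j h hij) h3

lemma grad_pow_mul {b c : ℂ × ℂ → ℂ} (hb : DifferentiableAt ℂ b x) (hc : DifferentiableAt ℂ c x)
    (j : ℕ) : grad (fun y => b y * c y ^ j) x =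
      c x ^ j • grad b x + (b x * (j * c x ^ (j - 1))) • grad c x := by
  rw [grad_mul (h := fun y => c y ^ j) hb (hc.pow j)]
  have : fderiv ℂ (fun y => c y ^ j) x = (j * c x ^ (j - 1)) • fderiv ℂ c x := by
    rw [fderiv_fun_pow j hc]; simp
  have e : grad (fun y => c y ^ j) x = (j * c x ^ (j - 1)) • grad c x := by
    simp only [grad, this]; ext <;> simp
  rw [e, smul_smul, add_comm]

/-- The derivative of a root. -/
lemma CoeffAnalyticAt.grad_root (hp : CoeffAnalyticAt p x)
    (hdeg : ∀ᶠ y in 𝓝 x, (p y).natDegree ≤ k) {c : ℂ × ℂ → ℂ} (hc : AnalyticAt ℂ c x)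
    (h : ∀ᶠ y in 𝓝 x, (p y).eval (c y) = 0) :
    (derivative (p x)).eval (c x) • grad c x =
      -∑ j ∈ Finset.range (k + 1), c x ^ j • grad (fun y => (p y).coeff j) x := by
  have h0 : grad (fun y => ∑ j ∈ Finset.range (k + 1), (p y).coeff j * c y ^ j) x = 0 := by
    have : (fun y => ∑ j ∈ Finset.range (k + 1), (p y).coeff j * c y ^ j) =ᶠ[𝓝 x] fun _ => 0 := by
      filter_upwards [h, hdeg] with y h1 h2
      rw [← eval_eq_sum_range' (Nat.lt_succ_of_le h2), h1]
    rw [(grad_congr this).self_of_nhds]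
    simp [grad]
  have hsum : grad (fun y => ∑ j ∈ Finset.range (k + 1), (p y).coeff j * c y ^ j) x =
      ∑ j ∈ Finset.range (k + 1), grad (fun y => (p y).coeff j * c y ^ j) x := by
    simp only [grad]
    have hd (j : ℕ) : DifferentiableAt ℂ (fun y => (p y).coeff j * c y ^ j) x :=
      ((hp j).mul (hc.pow j)).differentiableAt
    rw [fderiv_fun_sum (A := fun j y => (p y).coeff j * c y ^ j) fun j _ => hd j]
    ext <;> simp [Prod.fst_sum, Prod.snd_sum]
  have hev := eval_derivative_eq_sum hdeg.self_of_nhds (c x)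
  rw [hsum, Finset.sum_congr rfl fun j _ => grad_pow_mul (hp j).differentiableAt
    hc.differentiableAt j, Finset.sum_add_distrib, ← Finset.sum_smul, ← hev] at h0
  exact eq_neg_of_add_eq_zero_right h0

end Roots

end Webs

namespace Webs

open Asymptotics

/-! ### Asymptotics of the roots of a totally ramified family of polynomials -/

section RootAsymptotics

variable {Y : Type*} {l : Filter Y} {ν : ℕ} {f : Y → ℂ} {τ : Y → ℝ}

/-- When every factor is `O(τ)` and the product attains the full order `τ ^ card`, no factor can be
smaller: divide by the upper bounds of the others. -/
lemma isBigO_of_isBigO_prod {ι : Type*} (s : Finset ι) {g : ι → Y → ℂ}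
    (hτ : ∀ᶠ y in l, 0 < τ y) (hg : ∀ i ∈ s, g i =O[l] τ)
    (h : (fun y => τ y ^ s.card) =O[l] fun y => ∏ i ∈ s, g i y) {i : ι} (hi : i ∈ s) :
    τ =O[l] g i := by
  classical
  have h1 : (fun y => ∏ j ∈ s.erase i, g j y) =O[l] fun y => τ y ^ (s.card - 1) := by
    have := IsBigO.finsetProd (s := s.erase i) (g := fun _ => τ)
      fun j hj => hg j (Finset.mem_of_mem_erase hj)
    simpa [Finset.card_erase_of_mem hi] using this
  have h2 : (fun y => τ y ^ s.card) =O[l] fun y => ‖g i y‖ * τ y ^ (s.card - 1) := by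
    refine h.trans ?_
    simp only [← Finset.mul_prod_erase s _ hi]
    exact (isBigO_norm_right.mpr (isBigO_refl _ l)).mul h1
  have h3 := h2.mul (isBigO_refl (fun y => (τ y ^ (s.card - 1))⁻¹) l)
  refine isBigO_norm_right.mp (h3.congr' ?_ ?_)
  · filter_upwards [hτ] with y hy
    have hc : s.card = s.card - 1 + 1 := by
      have := Finset.card_pos.mpr ⟨i, hi⟩
      omega
    conv_lhs => lhs; rw [hc, pow_succ]
    field_simp
  · filter_upwards [hτ] with y hy
    field_simp

lemma scale_pos (hν : ν ≠ 0) (hτ0 : ∀ y, 0 ≤ τ y) (hτf : ∀ y, τ y ^ ν = ‖f y‖) {y : Y}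
    (hy : f y ≠ 0) : 0 < τ y := by
  refine (hτ0 y).lt_of_ne fun h0 => hy ?_
  have := hτf y
  rw [← h0, zero_pow hν] at this
  exact norm_eq_zero.mp this.symm

lemma tendsto_scale_zero (hν : ν ≠ 0) (hτf : ∀ y, τ y ^ ν = ‖f y‖) (hf : Tendsto f l (𝓝 0)) :
    Tendsto τ l (𝓝 0) := by
  have : (τ ^ ν) =o[l] ((fun _ => (1 : ℝ)) ^ ν) := by
    have e : τ ^ ν = fun y => ‖f y‖ := funext hτf
    have e' : ((fun _ : Y => (1 : ℝ)) ^ ν) = fun _ => (1 : ℝ) := by ext; simp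
    rw [e, e']
    exact (isLittleO_one_iff ℝ).mpr (by simpa using hf.norm)
  exact (isLittleO_one_iff ℝ).mp (this.of_pow hν)

lemma isBigO_of_isBigO_pow {g : Y → ℂ} (hν : ν ≠ 0) (hτf : ∀ y, τ y ^ ν = ‖f y‖)
    (h : (fun y => g y ^ ν) =O[l] f) : g =O[l] τ := by
  refine IsBigO.of_pow hν ?_
  have : (τ ^ ν) = fun y => ‖f y‖ := funext hτf
  rw [this]
  exact isBigO_norm_right.mpr h

/-- The roots of a polynomial `b λ ^ ν + f (a_{ν-1} λ ^ (ν-1) + ⋯ + a_0)`, for small `f`. -/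
lemma isBigO_root_pow (hf : Tendsto f l (𝓝 0)) {b r : Y → ℂ} {a : ℕ → Y → ℂ}
    (hb : (fun _ => (1 : ℂ)) =O[l] b) (ha : ∀ j < ν, a j =O[l] fun _ => (1 : ℂ))
    (hr : ∀ᶠ y in l, b y * r y ^ ν + ∑ j ∈ Finset.range ν, f y * a j y * r y ^ j = 0) :
    (fun y => r y ^ ν) =O[l] f := by
  obtain ⟨m, hm, hbm⟩ := hb.exists_pos
  have hS : (fun y => ∑ j ∈ Finset.range ν, ‖a j y‖) =O[l] fun _ => (1 : ℂ) :=
    IsBigO.fun_sum fun j hj => isBigO_norm_left.mpr (ha j (Finset.mem_range.mp hj))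
  obtain ⟨K, hK, hSK⟩ := hS.exists_pos
  have hsmall : ∀ᶠ y in l, m * (K * ‖f y‖) < 1 := by
    have h0 : Tendsto (fun y => m * (K * ‖f y‖)) l (𝓝 (m * (K * 0))) :=
      (by simpa using hf.norm : Tendsto (fun y => ‖f y‖) l (𝓝 0)).const_mul K |>.const_mul m
    simp only [mul_zero] at h0
    exact h0.eventually (gt_mem_nhds one_pos)
  refine IsBigO.of_bound (m * K) ?_
  filter_upwards [hbm.bound, hSK.bound, hsmall, hr] with y h1 h2 h3 h4
  simp only [norm_one, mul_one] at h1 h2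
  rw [Real.norm_of_nonneg (Finset.sum_nonneg fun _ _ => norm_nonneg _)] at h2
  have key (M : ℝ) (hM0 : 0 ≤ M) (hM : ∀ j < ν, ‖r y‖ ^ j ≤ M) :
      ‖r y‖ ^ ν ≤ m * (K * ‖f y‖) * M := by
    have h5 : ‖b y‖ * ‖r y‖ ^ ν ≤ ‖f y‖ * K * M := by
      rw [← norm_pow, ← norm_mul, eq_neg_of_add_eq_zero_left h4, norm_neg]
      calc ‖∑ j ∈ Finset.range ν, f y * a j y * r y ^ j‖
          ≤ ∑ j ∈ Finset.range ν, ‖f y‖ * ‖a j y‖ * M := by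
            refine (norm_sum_le _ _).trans (Finset.sum_le_sum fun j hj => ?_)
            rw [norm_mul, norm_mul, norm_pow]
            exact mul_le_mul_of_nonneg_left (hM j (Finset.mem_range.mp hj)) (by positivity)
        _ = ‖f y‖ * (∑ j ∈ Finset.range ν, ‖a j y‖) * M := by
            rw [Finset.mul_sum, Finset.sum_mul]
        _ ≤ ‖f y‖ * K * M := by gcongr
    calc ‖r y‖ ^ ν ≤ m * ‖b y‖ * ‖r y‖ ^ ν := le_mul_of_one_le_left (by positivity) h1
      _ = m * (‖b y‖ * ‖r y‖ ^ ν) := by ring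
      _ ≤ m * (‖f y‖ * K * M) := by gcongr
      _ = _ := by ring
  -- If `‖r y‖ > 1`, then `key` with `M = ‖r y‖ ^ ν` contradicts `m K ‖f y‖ < 1`. Once `‖r y‖ ≤ 1`,
  -- `M = 1` gives the bound.
  have hle : ‖r y‖ ≤ 1 := by
    by_contra! hlt
    have h5 := key (‖r y‖ ^ ν) (by positivity) fun j hj =>
      pow_le_pow_right₀ hlt.le hj.le
    have h6 : 0 < ‖r y‖ ^ ν := by positivity
    nlinarith
  have h5 := key 1 zero_le_one fun j _ => pow_le_one₀ (norm_nonneg _) hle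
  rw [norm_pow]
  linarith

/-- The terms with `j > 0` carry `f` together with a positive power of the small root, so `b r ^ ν`
balances `f a_0` alone. -/
lemma isLittleO_root {b r : Y → ℂ} {a : ℕ → Y → ℂ} (hν : 0 < ν)
    (ha : ∀ j < ν, a j =O[l] fun _ => (1 : ℂ)) (hr0 : Tendsto r l (𝓝 0))
    (hr : ∀ᶠ y in l, b y * r y ^ ν + ∑ j ∈ Finset.range ν, f y * a j y * r y ^ j = 0) :
    (fun y => b y * r y ^ ν + f y * a 0 y) =o[l] f := by
  have h : (fun y => ∑ j ∈ (Finset.range ν).erase 0, f y * a j y * r y ^ j) =o[l] f := by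
    refine IsLittleO.fun_sum fun j hj => ?_
    obtain ⟨hj0, hj⟩ := Finset.mem_erase.mp hj
    have h1 : (fun y => r y ^ j) =o[l] fun _ => (1 : ℂ) := by
      have := hr0.pow j
      rw [zero_pow hj0] at this
      exact (isLittleO_one_iff ℂ).mpr this
    have h2 := ((isBigO_refl f l).mul (ha j (Finset.mem_range.mp hj))).mul_isLittleO h1
    simpa using h2
  refine h.neg_left.congr' ?_ .rfl
  filter_upwards [hr] with y hy
  rw [← Finset.add_sum_erase _ _ (Finset.mem_range.mpr hν)] at hy
  simp only [pow_zero, mul_one] at hy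
  linear_combination -hy

lemma isBigO_wedge {g h : Y → ℂ × ℂ} {u v : Y → ℝ} (hg : g =O[l] u) (hh : h =O[l] v) :
    (fun y => wedge (g y) (h y)) =O[l] fun y => u y * v y :=
  ((isBigO_fst_prod'.trans hg).mul (isBigO_snd_prod'.trans hh)).sub
    ((isBigO_snd_prod'.trans hg).mul (isBigO_fst_prod'.trans hh))

/-- A totally ramified family of polynomials `b λ ^ ν + f (a_{ν-1} λ ^ (ν-1) + ⋯ + a_0)` whose
discriminant has the minimal order in `f`, with its roots `r`. -/
structure IsRamified (l : Filter Y) (f : Y → ℂ) (ν : ℕ) (b : Y → ℂ) (a : ℕ → Y → ℂ)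
    (r : Fin ν → Y → ℂ) : Prop where
  two_le : 2 ≤ ν
  neBot : l.NeBot
  ne_zero : ∀ᶠ y in l, f y ≠ 0
  tendsto : Tendsto f l (𝓝 0)
  isBigO_b : (fun _ => (1 : ℂ)) =O[l] b
  isBigO_a : ∀ j < ν, a j =O[l] fun _ => (1 : ℂ)
  exists_tendsto : ∃ a₀, Tendsto (a 0) l (𝓝 a₀)
  root : ∀ i, ∀ᶠ y in l, b y * r i y ^ ν + ∑ j ∈ Finset.range ν, f y * a j y * r i y ^ j = 0
  isBigO_discr : (fun y => f y ^ (ν - 1)) =O[l]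
    fun y => ∏ i, ∏ j ∈ Finset.univ.erase i, (r i y - r j y)

namespace IsRamified

variable {b : Y → ℂ} {a : ℕ → Y → ℂ} {r : Fin ν → Y → ℂ}

lemma eventually_pos (h : IsRamified l f ν b a r) (hτ0 : ∀ y, 0 ≤ τ y)
    (hτf : ∀ y, τ y ^ ν = ‖f y‖) : ∀ᶠ y in l, 0 < τ y :=
  h.ne_zero.mono fun _ => scale_pos (by have := h.two_le; omega) hτ0 hτf

lemma tendsto_scale (h : IsRamified l f ν b a r) (hτf : ∀ y, τ y ^ ν = ‖f y‖) :
    Tendsto τ l (𝓝 0) :=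
  tendsto_scale_zero (by have := h.two_le; omega) hτf h.tendsto

lemma isBigO_root (h : IsRamified l f ν b a r) (hτf : ∀ y, τ y ^ ν = ‖f y‖) (i : Fin ν) :
    r i =O[l] τ :=
  isBigO_of_isBigO_pow (by have := h.two_le; omega) hτf
    (isBigO_root_pow h.tendsto h.isBigO_b h.isBigO_a (h.root i))

/-- The `ν (ν - 1)` differences are all `O(τ)`, while their product is at least of order `f ^ (ν -
1)`, of modulus `τ ^ (ν (ν - 1))`. This is where the minimal multiplicity of the discriminant acts.
-/
lemma isBigO_sub (h : IsRamified l f ν b a r) (hτ0 : ∀ y, 0 ≤ τ y)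
    (hτf : ∀ y, τ y ^ ν = ‖f y‖) {i j : Fin ν} (hij : i ≠ j) :
    τ =O[l] fun y => r i y - r j y := by
  set s : Finset (Σ _ : Fin ν, Fin ν) := Finset.univ.sigma fun i => Finset.univ.erase i with hs
  have hcard : s.card = ν * (ν - 1) := by simp [hs, Finset.card_sigma]
  refine isBigO_of_isBigO_prod s (g := fun z y => r z.1 y - r z.2 y) (h.eventually_pos hτ0 hτf)
    (fun z _ => (h.isBigO_root hτf _).sub (h.isBigO_root hτf _)) ?_ (i := ⟨i, j⟩)
    (by simp [hs, hij.symm])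
  simp only [hs, Finset.prod_sigma]
  rw [← hs, hcard]
  refine (isBigO_norm_left.mpr h.isBigO_discr).congr_left fun y => ?_
  rw [norm_pow, ← hτf, pow_mul]

lemma tendsto_root (h : IsRamified l f ν b a r)
    (hτf : ∀ y, τ y ^ ν = ‖f y‖) (i : Fin ν) : Tendsto (r i) l (𝓝 0) :=
  (h.isBigO_root hτf i).trans_tendsto (h.tendsto_scale hτf)

/-- If `a 0` tended to `0`, every root would be `o(τ)`, hence so would the difference of two of
them, against `isBigO_sub`; two roots exist because `2 ≤ ν`. -/
lemma isBigO_coeff_zero (h : IsRamified l f ν b a r) (hτ0 : ∀ y, 0 ≤ τ y)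
    (hτf : ∀ y, τ y ^ ν = ‖f y‖) : (fun _ => (1 : ℂ)) =O[l] a 0 := by
  have hν : 0 < ν := by have := h.two_le; omega
  have hν0 : ν ≠ 0 := hν.ne'
  obtain ⟨a₀, ha₀⟩ := h.exists_tendsto
  by_cases h0 : a₀ = 0
  · exfalso
    have hsmall (i : Fin ν) : r i =o[l] τ := by
      have h1 := isLittleO_root hν h.isBigO_a (h.tendsto_root hτf i) (h.root i)
      have h2 : (fun y => f y * a 0 y) =o[l] f := by
        have := (isBigO_refl f l).mul_isLittleO ((isLittleO_one_iff ℂ).mpr (h0 ▸ ha₀))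
        simpa using this
      have h3 : (fun y => b y * r i y ^ ν) =o[l] f := by
        simpa using h1.sub h2
      have h4 : (fun y => r i y ^ ν) =o[l] f := by
        have := (h.isBigO_b.mul (isBigO_refl (fun y => r i y ^ ν) l)).trans_isLittleO h3
        simpa using this
      refine IsLittleO.of_pow (n := ν) ?_ hν0
      have e : (τ ^ ν) = fun y => ‖f y‖ := funext hτf
      rw [e]
      exact isLittleO_norm_right.mpr h4
    have h1 := h.isBigO_sub hτ0 hτf (i := ⟨0, hν⟩) (j := ⟨1, h.two_le⟩) (by simp)
    have h2 := h1.trans_isLittleO ((hsmall _).sub (hsmall _))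
    have := h.neBot
    exact isLittleO_irrefl ((h.eventually_pos hτ0 hτf).frequently.mono fun y hy => hy.ne') h2
  · have h1 : Tendsto (fun y => (a 0 y)⁻¹) l (𝓝 a₀⁻¹) := ha₀.inv₀ h0
    have h2 := (h1.isBigO_one ℂ).mul (isBigO_refl (a 0) l)
    refine h2.congr' ?_ (.of_forall fun y => by simp)
    filter_upwards [ha₀.eventually_ne h0] with y hy
    exact inv_mul_cancel₀ hy

/-- `b r ^ ν = -f a_0 + o(f)`, with `a_0` bounded away from `0` and `b` bounded. -/
lemma isBigO_scale (h : IsRamified l f ν b a r) (hτ0 : ∀ y, 0 ≤ τ y)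
    (hτf : ∀ y, τ y ^ ν = ‖f y‖) (hb : b =O[l] fun _ => (1 : ℂ)) (i : Fin ν) : τ =O[l] r i := by
  have hν : 0 < ν := by have := h.two_le; omega
  have h1 := isLittleO_root hν h.isBigO_a (h.tendsto_root hτf i) (h.root i)
  have h2 : f =O[l] fun y => f y * a 0 y := by
    simpa using (isBigO_refl f l).mul (h.isBigO_coeff_zero hτ0 hτf)
  have h3 : (fun y => f y * a 0 y) =O[l] fun y => b y * r i y ^ ν := by
    have := (h1.trans_isBigO h2).right_isBigO_sub
    exact isBigO_neg_right.mp (this.congr_right fun y => by ring)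
  have h4 : f =O[l] fun y => r i y ^ ν := by
    refine (h2.trans h3).trans ?_
    simpa using hb.mul (isBigO_refl (fun y => r i y ^ ν) l)
  refine IsBigO.of_pow (n := ν) hν.ne' ?_
  have e : (τ ^ ν) = fun y => ‖f y‖ := funext hτf
  rw [e]
  exact isBigO_norm_left.mpr h4

/-- The right side is the derivative of the polynomial at the root `r i`, the denominator in
implicit differentiation. -/
lemma isBigO_derivative (h : IsRamified l f ν b a r) (hτ0 : ∀ y, 0 ≤ τ y)
    (hτf : ∀ y, τ y ^ ν = ‖f y‖) (i : Fin ν) :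
    (fun y => τ y ^ (ν - 1)) =O[l] fun y => b y * ∏ j ∈ Finset.univ.erase i, (r i y - r j y) := by
  have h1 := IsBigO.finsetProd (s := Finset.univ.erase i) (f := fun _ => τ)
    fun j hj => h.isBigO_sub hτ0 hτf (Finset.ne_of_mem_erase hj).symm
  simpa [Finset.card_erase_of_mem (Finset.mem_univ i)] using h.isBigO_b.norm_left.mul h1

/-- The differential of the roots `r`, up to lower order terms. -/
lemma isBigO_grad_root (h : IsRamified l f ν b a r) (hτ0 : ∀ y, 0 ≤ τ y)
    (hτf : ∀ y, τ y ^ ν = ‖f y‖) {i : Fin ν} {D g φ : Y → ℂ × ℂ} {γ : ℕ → Y → ℂ × ℂ}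
    (hg : g =O[l] fun _ => (1 : ℝ)) (hφ : φ =O[l] fun _ => (1 : ℝ))
    (hγ : ∀ j < ν, γ j =O[l] fun _ => (1 : ℝ))
    (hdr : ∀ᶠ y in l, (b y * ∏ j ∈ Finset.univ.erase i, (r i y - r j y)) * r i y =
      ν * b y * r i y ^ ν + ∑ j ∈ Finset.range ν, j * (f y * a j y) * r i y ^ j)
    (hD : ∀ᶠ y in l, (b y * ∏ j ∈ Finset.univ.erase i, (r i y - r j y)) • D y =
      -(r i y ^ ν • g y + ∑ j ∈ Finset.range ν, r i y ^ j • (f y • γ j y + a j y • φ y))) :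
    (fun y => D y - (r i y / (ν * f y)) • φ y) =O[l] (fun y => τ y ^ 2 / ‖f y‖) ∧
      (fun y => wedge (D y - (r i y / (ν * f y)) • φ y) (φ y)) =O[l] τ := by
  have hν : ν ≠ 0 := by have := h.two_le; omega
  have hν' : (ν : ℂ) ≠ 0 := Nat.cast_ne_zero.mpr hν
  set dp : Y → ℂ := fun y => b y * ∏ j ∈ Finset.univ.erase i, (r i y - r j y) with hdp
  set R : Y → ℂ × ℂ := fun y => r i y ^ ν • g y + f y • ∑ j ∈ Finset.range ν, r i y ^ j • γ j y
    with hR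
  set e : Y → ℂ := fun y => ∑ j ∈ Finset.range ν, (j / ν * a j y) * r i y ^ j with he
  -- Implicit differentiation gives `dp D = -R - (∑ a_j r ^ j) φ`. Eliminating `b r ^ ν` from the
  -- formula for `dp r` by the equation of the root gives `dp r / (ν f) = e - ∑ a_j r ^ j`. The
  -- large sums cancel, and what is left has `R = O(|f|)` and `e = O(τ)`.
  have hid : ∀ᶠ y in l, dp y • (D y - (r i y / (ν * f y)) • φ y) = -R y - e y • φ y := by
    filter_upwards [h.ne_zero, hdr, hD, h.root i] with y h1 h2 h3 h4
    have h5 : dp y * (r i y / (ν * f y)) = e y - ∑ j ∈ Finset.range ν, a j y * r i y ^ j := by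
      have e1 : e y * (ν * f y) = ∑ j ∈ Finset.range ν, j * (f y * a j y) * r i y ^ j := by
        rw [he, Finset.sum_mul]
        exact Finset.sum_congr rfl fun j _ => by field_simp
      have e2 : (∑ j ∈ Finset.range ν, a j y * r i y ^ j) * f y = - (b y * r i y ^ ν) := by
        rw [eq_neg_of_add_eq_zero_left h4, neg_neg, Finset.sum_mul]
        exact Finset.sum_congr rfl fun j _ => by ring
      rw [← mul_div_assoc, div_eq_iff (mul_ne_zero hν' h1), sub_mul, e1]
      simp only [hdp]
      rw [h2]
      linear_combination (ν : ℂ) * e2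
    rw [smul_sub, smul_smul, h5, h3, sub_smul, hR]
    simp only [smul_add, Finset.sum_add_distrib, Finset.smul_sum, Finset.sum_smul, smul_smul,
      mul_comm, neg_add]
    abel
  have hτpos := h.eventually_pos hτ0 hτf
  have hτ1 : τ =O[l] fun _ => (1 : ℝ) := (h.tendsto_scale hτf).isBigO_one ℝ
  have hr1 (j : ℕ) : (fun y => r i y ^ j) =O[l] fun _ => (1 : ℝ) := by
    simpa using ((h.isBigO_root hτf i).trans hτ1).pow j
  have hrν : (fun y => r i y ^ ν) =O[l] fun y => ‖f y‖ := by
    simpa only [hτf] using (h.isBigO_root hτf i).pow ν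
  have hff : f =O[l] fun y => ‖f y‖ := isBigO_norm_right.mpr (isBigO_refl f l)
  have hRO : R =O[l] fun y => ‖f y‖ := by
    have h1 : (fun y => r i y ^ ν • g y) =O[l] fun y => ‖f y‖ := by simpa using hrν.smul hg
    have h2 : (fun y => ∑ j ∈ Finset.range ν, r i y ^ j • γ j y) =O[l] fun _ => (1 : ℝ) :=
      IsBigO.fun_sum fun j hj => by
        simpa using (hr1 j).smul (hγ j (Finset.mem_range.mp hj))
    exact h1.add (by simpa using hff.smul h2)
  have heO : e =O[l] τ := by
    refine IsBigO.fun_sum fun j hj => ?_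
    obtain rfl | hj0 := Nat.eq_zero_or_pos j
    · simpa using isBigO_zero τ l
    · obtain ⟨j, rfl⟩ : ∃ k, j = k + 1 := ⟨j - 1, by omega⟩
      have ha1 := (h.isBigO_a _ (Finset.mem_range.mp hj)).trans
        (isBigO_const_const (1 : ℂ) (one_ne_zero' ℝ) l)
      have h1 := ((ha1.const_mul_left
        (((j + 1 : ℕ) : ℂ) / ν)).mul (hr1 j)).mul (h.isBigO_root hτf i)
      simpa [pow_succ, mul_assoc] using h1
  have hfτ : (fun y => ‖f y‖) =O[l] τ := by
    obtain ⟨k, hk⟩ : ∃ k, ν = k + 1 := ⟨ν - 1, by omega⟩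
    simp only [← hτf, hk, pow_succ]
    simpa using (hτ1.pow k).mul (isBigO_refl τ l)
  have hdpi : (fun y => (dp y)⁻¹) =O[l] fun y => (τ y ^ (ν - 1))⁻¹ :=
    (h.isBigO_derivative hτ0 hτf i).inv_rev (hτpos.mono fun y hy h0 => by
      exact absurd h0 (pow_pos hy _).ne')
  have hne : ∀ᶠ y in l, dp y ≠ 0 := by
    filter_upwards [(h.isBigO_derivative hτ0 hτf i).eq_zero_imp, hτpos] with y h1 h2 h3
    exact (pow_pos h2 _).ne' (h1 h3)
  have hτid : ∀ᶠ y in l, (τ y ^ (ν - 1))⁻¹ = τ y / ‖f y‖ := by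
    filter_upwards [hτpos] with y hy
    obtain ⟨k, hk⟩ : ∃ k, ν = k + 1 := ⟨ν - 1, by omega⟩
    rw [← hτf, hk, pow_succ, Nat.add_sub_cancel]
    field_simp
  have hθ : ∀ᶠ y in l, D y - (r i y / (ν * f y)) • φ y = (dp y)⁻¹ • (-R y - e y • φ y) := by
    filter_upwards [hid, hne] with y h1 h2
    rw [← h1, smul_smul, inv_mul_cancel₀ h2, one_smul]
  constructor
  · have h1 : (fun y => -R y - e y • φ y) =O[l] τ :=
      ((hRO.trans hfτ).neg_left).sub (by simpa using heO.smul hφ)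
    refine (hdpi.smul h1).congr' (hθ.mono fun y hy => hy.symm) ?_
    filter_upwards [hτid] with y hy
    rw [hy, smul_eq_mul]
    ring
  · have h1 : (fun y => wedge (R y) (φ y)) =O[l] fun y => ‖f y‖ := by
      simpa using isBigO_wedge hRO hφ
    refine ((hdpi.mul h1.neg_left)).congr' ?_ ?_
    · filter_upwards [hθ] with y hy
      rw [hy, wedge_smul_left]
      simp only [wedge, Prod.fst_sub, Prod.snd_sub, Prod.fst_neg, Prod.snd_neg, Prod.smul_fst,
        Prod.smul_snd, smul_eq_mul]
      ring
    · filter_upwards [hτid, h.ne_zero] with y hy h0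
      rw [hy]
      exact div_mul_cancel₀ _ (norm_ne_zero_iff.mpr h0)

end IsRamified

end RootAsymptotics

end Webs

namespace Webs

open Asymptotics

/-! ### Asymptotics of the form `η` of a `3`-web near a totally ramified invariant curve -/

section JetAsymptotics

variable {Y ι : Type*} {l : Filter Y}

/-- Asymptotics of the slopes `c` and of their differentials `x ξ + y φ`, when `f → 0` with
`‖f‖ = τ ^ ν`; the indices in `I` are those of the ramified foliations. -/
structure IsSlopeFamily (l : Filter Y) (ν : ℕ) (f : Y → ℂ) (τ : Y → ℝ) (I : ι → Prop)
    (c x y : ι → Y → ℂ) : Prop where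
  two_le : 2 ≤ ν
  pos : ∀ᶠ z in l, 0 < τ z
  tendsto : Tendsto τ l (𝓝 0)
  pow_eq : ∀ z, τ z ^ ν = ‖f z‖
  c₁ : ∀ i, I i → c i =O[l] fun z => (τ z)⁻¹
  x₁ : ∀ i, I i → x i =O[l] fun z => (τ z)⁻¹
  y₁ : ∀ i, I i → (fun z => y i z + c i z / (ν * f z)) =O[l] fun z => ‖f z‖⁻¹
  c₂ : ∀ i, ¬ I i → c i =O[l] fun _ => (1 : ℝ)
  x₂ : ∀ i, ¬ I i → x i =O[l] fun _ => (1 : ℝ)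
  y₂ : ∀ i, ¬ I i → y i =O[l] fun _ => (1 : ℝ)
  ne : ∀ i j, i ≠ j → ∀ᶠ z in l, c i z ≠ c j z
  inv₁ : ∀ i j, i ≠ j → I i ∨ I j → (fun z => (c i z - c j z)⁻¹) =O[l] τ
  inv₂ : ∀ i j, i ≠ j → ¬ I i → ¬ I j → (fun z => (c i z - c j z)⁻¹) =O[l] fun _ => (1 : ℝ)

namespace IsSlopeFamily

variable {ν : ℕ} {f : Y → ℂ} {τ : Y → ℝ} {I : ι → Prop} {c x y : ι → Y → ℂ}

lemma scale_isBigO_one (h : IsSlopeFamily l ν f τ I c x y) : τ =O[l] fun _ => (1 : ℝ) :=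
  h.tendsto.isBigO_one ℝ

lemma ratio_eq (h : IsSlopeFamily l ν f τ I c x y) :
    ∀ᶠ z in l, (τ z)⁻¹ ^ (ν - 1) = τ z / ‖f z‖ := by
  filter_upwards [h.pos] with z hz
  obtain ⟨k, hk⟩ : ∃ k, ν = k + 1 := ⟨ν - 1, by have := h.two_le; omega⟩
  rw [← h.pow_eq, hk, pow_succ, Nat.add_sub_cancel, inv_pow]
  field_simp

lemma one_isBigO_inv (h : IsSlopeFamily l ν f τ I c x y) :
    (fun _ => (1 : ℝ)) =O[l] fun z => (τ z)⁻¹ := by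
  simpa using h.scale_isBigO_one.inv_rev (h.pos.mono fun z hz h0 => absurd h0 hz.ne')

/-- Since `ν ≥ 2`, `1 / τ` is bounded by `τ ^ (1 - ν) = τ / |f|`, the error allowed in all the
estimates of `η`. -/
lemma inv_isBigO (h : IsSlopeFamily l ν f τ I c x y) :
    (fun z => (τ z)⁻¹) =O[l] fun z => τ z / ‖f z‖ := by
  obtain ⟨k, hk⟩ : ∃ k, ν = k + 2 := ⟨ν - 2, by have := h.two_le; omega⟩
  refine IsBigO.congr' ((h.one_isBigO_inv.pow k).mul (isBigO_refl (fun z => (τ z)⁻¹) l))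
    (.of_forall fun z => by simp) ?_
  filter_upwards [h.ratio_eq] with z hz
  rw [← hz, hk, ← pow_succ]
  rfl

lemma one_isBigO (h : IsSlopeFamily l ν f τ I c x y) :
    (fun _ => (1 : ℝ)) =O[l] fun z => τ z / ‖f z‖ := h.one_isBigO_inv.trans h.inv_isBigO

lemma inv_isBigO_norm_inv (h : IsSlopeFamily l ν f τ I c x y) :
    (fun z => (τ z)⁻¹) =O[l] fun z => ‖f z‖⁻¹ := by
  refine h.inv_isBigO.trans ?_
  simpa [div_eq_mul_inv] using h.scale_isBigO_one.mul (isBigO_refl (fun z => ‖f z‖⁻¹) l)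

lemma isBigO_c (h : IsSlopeFamily l ν f τ I c x y) (i : ι) : c i =O[l] fun z => (τ z)⁻¹ := by
  by_cases hi : I i
  · exact h.c₁ i hi
  · exact (h.c₂ i hi).trans h.one_isBigO_inv

lemma isBigO_x (h : IsSlopeFamily l ν f τ I c x y) (i : ι) : x i =O[l] fun z => (τ z)⁻¹ := by
  by_cases hi : I i
  · exact h.x₁ i hi
  · exact (h.x₂ i hi).trans h.one_isBigO_inv

lemma isBigO_div (e : ℂ) {g : Y → ℂ} {u : Y → ℝ}
    (hg : g =O[l] u) : (fun z => g z * (e / (ν * f z))) =O[l] fun z => u z / ‖f z‖ := by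
  have h1 : (fun z => (f z)⁻¹) =O[l] fun z => ‖f z‖⁻¹ := by
    simpa using isBigO_norm_right.mpr (isBigO_refl (fun z => (f z)⁻¹) l)
  refine ((hg.mul h1).const_mul_left (e / ν)).congr (fun z => ?_) fun z => rfl
  rw [← div_div, div_eq_mul_inv (e / (ν : ℂ))]
  ring

/-- For bounded slopes this is weaker than `y₂`, but it has the shape of `y₁`, so that pairs with
only one ramified foliation need no separate treatment. -/
lemma isBigO_y (h : IsSlopeFamily l ν f τ I c x y) (i : ι) :
    (fun z => y i z + c i z / (ν * f z)) =O[l] fun z => ‖f z‖⁻¹ := by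
  by_cases hi : I i
  · exact h.y₁ i hi
  · refine ((h.y₂ i hi).trans (h.one_isBigO_inv.trans h.inv_isBigO_norm_inv)).add ?_
    simpa [div_eq_mul_inv] using isBigO_div 1 (h.c₂ i hi)

open Classical in
-- If one of the two foliations is ramified, `y = -c / (ν f) + O(1 / |f|)` for both, and division by
-- the large difference of slopes leaves `-1 / (ν f)` with an error `O(τ / |f|)`. For two unramified
-- ones the quotient is bounded.
lemma isBigO_slope (h : IsSlopeFamily l ν f τ I c x y) {s t : ι} (hst : s ≠ t) :
    (fun z => (y t z - y s z) / (c t z - c s z) + (if I s ∨ I t then 1 else 0) / (ν * f z)) =O[l]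
      fun z => τ z / ‖f z‖ := by
  split_ifs with hI
  · have h1 := ((h.isBigO_y t).sub (h.isBigO_y s)).mul (h.inv₁ t s hst.symm hI.symm)
    refine h1.congr' ?_ (.of_forall fun z => by ring)
    filter_upwards [h.ne t s hst.symm] with z hz
    have := sub_ne_zero.mpr hz
    field_simp
    ring
  · push Not at hI
    have h1 := ((h.y₂ t hI.2).sub (h.y₂ s hI.1)).mul (h.inv₂ t s hst.symm hI.2 hI.1)
    refine IsBigO.trans ?_ h.one_isBigO
    simpa [div_eq_mul_inv] using h1

open Classical in
-- The pole comes from the quotient of the `y` only: the terms in `x` are `O(1 / τ)`, which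
-- `inv_isBigO` absorbs.
lemma isBigO_jetS (h : IsSlopeFamily l ν f τ I c x y) {r s t : ι} (hst : s ≠ t) :
    (fun z => jetS (c · z) (x · z) (y · z) r s t - (if I s ∨ I t then 1 else 0) / (ν * f z)) =O[l]
      fun z => τ z / ‖f z‖ := by
  have h2 : (fun z => c r z * ((x t z - x s z) * (c t z - c s z)⁻¹)) =O[l] fun z => (τ z)⁻¹ := by
    by_cases hI : I s ∨ I t
    · have h3 := ((h.isBigO_x t).sub (h.isBigO_x s)).mul (h.inv₁ t s hst.symm hI.symm)
      refine ((h.isBigO_c r).mul h3).congr' .rfl ?_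
      filter_upwards [h.pos] with z hz
      field_simp
    · push Not at hI
      have h3 := ((h.x₂ t hI.2).sub (h.x₂ s hI.1)).mul (h.inv₂ t s hst.symm hI.2 hI.1)
      simpa using (h.isBigO_c r).mul h3
  refine ((((h.isBigO_x r).add h2).trans h.inv_isBigO).sub (h.isBigO_slope hst)).congr_left
    fun z => ?_
  simp only [jetS]
  ring

lemma isBigO_inv (h : IsSlopeFamily l ν f τ I c x y) {r s : ι} (hrs : r ≠ s) :
    (fun z => (c r z - c s z)⁻¹) =O[l] fun _ => (1 : ℝ) := by
  by_cases hI : I r ∨ I s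
  · exact (h.inv₁ r s hrs hI).trans h.scale_isBigO_one
  · push Not at hI
    exact h.inv₂ r s hrs hI.1 hI.2

/-- If `r` or `s` is ramified, dividing the poles `1 / (ν f)` by `c r - c s` gains a factor `τ`. If
neither is, the two `jetS` have the same pole, decided by `t`, and it cancels. -/
lemma isBigO_jetA (h : IsSlopeFamily l ν f τ I c x y) {r s t : ι} (hrs : r ≠ s) (hst : s ≠ t)
    (hrt : r ≠ t) : (fun z => jetA (c · z) (x · z) (y · z) r s t) =O[l] fun z => τ z / ‖f z‖ := by
  classical
  have h1 := ((h.isBigO_jetS (r := r) hst).sub (h.isBigO_jetS (r := s) hrt.symm)).mul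
    (h.isBigO_inv hrs)
  simp only [mul_one] at h1
  have h2 : (fun z => ((c r z - c s z)⁻¹) * (((if I s ∨ I t then 1 else 0) -
      (if I t ∨ I r then 1 else 0)) / (ν * f z))) =O[l] fun z => τ z / ‖f z‖ := by
    by_cases hI : I r ∨ I s
    · exact isBigO_div _ (h.inv₁ r s hrs hI)
    · push Not at hI
      simpa [hI.1, hI.2] using isBigO_zero (fun z => τ z / ‖f z‖) l
  refine (h1.add h2).congr_left fun z => ?_
  simp only [jetA]
  ring

open Classical in
-- `B` equals both `A c_r - jetS r s t` and `A c_s - jetS s t r`. If `r` or `s` has a bounded slope,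
-- the corresponding expression is used: its product with `A` is negligible and its `jetS` carries
-- the pole. If both are ramified, the poles of the two `jetS` cancel in `A`, and the factor `1 /
-- (c_r - c_s)` compensates the growth of `c_r`.
lemma isBigO_jetB (h : IsSlopeFamily l ν f τ I c x y) {r s t : ι} (hrs : r ≠ s) (hst : s ≠ t)
    (hrt : r ≠ t) : (fun z => jetB (c · z) (x · z) (y · z) r s t +
      (if I r ∨ I s ∨ I t then 1 else 0) / (ν * f z)) =O[l] fun z => τ z / ‖f z‖ := by
  have hA := h.isBigO_jetA hrs hst hrt
  by_cases hr : I r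
  · by_cases hs : I s
    · have h1 : (fun z => jetA (c · z) (x · z) (y · z) r s t * c r z) =O[l]
          fun z => τ z / ‖f z‖ := by
        have h2 := ((h.isBigO_jetS (r := r) hst).sub (h.isBigO_jetS (r := s) hrt.symm)).mul
          (h.inv₁ r s hrs (.inl hr))
        refine (h2.mul (h.isBigO_c r)).congr' (.of_forall fun z => ?_) ?_
        · simp only [hr, hs, or_true, true_or, if_true, jetA]
          ring
        · filter_upwards [h.pos] with z hz
          field_simp
      refine (h1.sub (h.isBigO_jetS (r := r) hst)).congr_left fun z => ?_
      simp only [hr, hs, true_or, if_true, jetB]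
      ring
    · have h1 : (fun z => jetA (c · z) (x · z) (y · z) r s t * c s z) =O[l]
          fun z => τ z / ‖f z‖ := by simpa using hA.mul (h.c₂ s hs)
      refine (h1.sub (h.isBigO_jetS (r := s) hrt.symm)).congr' ?_ .rfl
      filter_upwards [h.ne r s hrs] with z hz
      have := sub_ne_zero.mpr hz
      simp only [hr, or_true, true_or, if_true, jetB, jetA]
      field_simp
      ring
  · have h1 : (fun z => jetA (c · z) (x · z) (y · z) r s t * c r z) =O[l]
        fun z => τ z / ‖f z‖ := by simpa using hA.mul (h.c₂ r hr)
    refine (h1.sub (h.isBigO_jetS (r := r) hst)).congr_left fun z => ?_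
    simp only [hr, false_or, jetB]
    ring

end IsSlopeFamily

end JetAsymptotics

/-! ### Vanishing of a form at a point and the order of its discriminant -/

lemma isBigO_resultant {Y : Type*} {l : Filter Y} {p q : Y → Polynomial ℂ} {g : Y → ℝ}
    (hp : ∀ n, (fun y => (p y).coeff n) =O[l] g) (hq : ∀ n, (fun y => (q y).coeff n) =O[l] g)
    (m n : ℕ) : (fun y => Polynomial.resultant (p y) (q y) m n) =O[l] fun y => g y ^ (m + n) := by
  unfold Polynomial.resultant
  simp only [Matrix.det_apply]
  refine IsBigO.fun_sum fun σ _ => ?_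
  have h : (fun y => ∏ i, Polynomial.sylvester (p y) (q y) m n (σ i) i) =O[l]
      fun y => ∏ _i : Fin (m + n), g y := by
    refine IsBigO.finsetProd fun j _ => ?_
    simp only [Polynomial.sylvester, Matrix.of_apply]
    induction j using Fin.addCases with
    | left j =>
      simp only [Fin.addCases_left]
      split_ifs
      · exact hq _
      · exact isBigO_zero _ _
    | right j =>
      simp only [Fin.addCases_right]
      split_ifs
      · exact hp _
      · exact isBigO_zero _ _
  simp only [Finset.prod_const, Finset.card_univ, Fintype.card_fin] at h
  simp only [Units.smul_def]
  exact h.const_smul_left _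

/-- The Sylvester matrix has size `2 (k - 1)` and entries linear in the coefficients of the form. -/
lemma isBigO_formDiscr {Y : Type*} {l : Filter Y} {k : ℕ} {P : Y → BinaryForm} {g : Y → ℝ}
    (hP : ∀ᶠ y in l, (P y).IsHomogeneous k) (hc : ∀ m, (fun y => (P y).coeff m) =O[l] g) :
    (fun y => formDiscr k (P y)) =O[l] fun y => g y ^ (2 * (k - 1)) := by
  set q : Y → Polynomial ℂ := fun y => ∑ j ∈ Finset.range (k + 1),
    Polynomial.C ((P y).coeff (Finsupp.single 0 j + Finsupp.single 1 (k - j))) * Polynomial.X ^ j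
    with hq
  have hq' {Q : BinaryForm} (hQ : Q.IsHomogeneous k) :
      MvPolynomial.aeval ![(Polynomial.X : Polynomial ℂ), 1] Q = ∑ j ∈ Finset.range (k + 1),
        Polynomial.C (Q.coeff (Finsupp.single 0 j + Finsupp.single 1 (k - j))) *
          Polynomial.X ^ j := by
    simpa [restrictLine] using restrictLine_eq_sum hQ (1, 0) (0, 1)
  have hqO (n : ℕ) : (fun y => (q y).coeff n) =O[l] g := by
    simp only [hq, Polynomial.finsetSum_coeff, Polynomial.coeff_C_mul]
    exact IsBigO.fun_sum fun j _ => by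
      simpa [mul_comm] using (hc _).const_mul_left (((Polynomial.X : Polynomial ℂ) ^ j).coeff n)
  have hdO (n : ℕ) : (fun y => (Polynomial.derivative (q y)).coeff n) =O[l] g := by
    simp only [Polynomial.coeff_derivative]
    simpa [mul_comm] using (hqO (n + 1)).const_mul_left ((n : ℂ) + 1)
  have heO (n : ℕ) : (fun y => (Polynomial.C (k : ℂ) * q y -
      Polynomial.X * Polynomial.derivative (q y)).coeff n) =O[l] g := by
    simp only [Polynomial.coeff_sub, Polynomial.coeff_C_mul]
    refine ((hqO n).const_mul_left _).sub ?_
    cases n with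
    | zero => simpa using isBigO_zero g l
    | succ n => simpa only [Polynomial.coeff_X_mul] using hdO n
  rw [two_mul]
  refine (isBigO_resultant hdO heO (k - 1) (k - 1)).congr' ?_ .rfl
  filter_upwards [hP] with y hy
  rw [formDiscr, aeval_pderiv_zero, aeval_pderiv_one hy, hq' hy]

/-- A form whose discriminant is a unit times the power `k - 1` of a reduced equation does not
vanish. -/
lemma ne_zero_of_formDiscr_eq {k : ℕ} (hk : 2 ≤ k) {P : ℂ × ℂ → BinaryForm} {f u : ℂ × ℂ → ℂ}
    {x : ℂ × ℂ} (hP : ∀ᶠ y in 𝓝 x, (P y).IsHomogeneous k)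
    (hc : ∀ m, AnalyticAt ℂ (fun y => (P y).coeff m) x) (hdf : fderiv ℂ f x ≠ 0)
    (hu : ContinuousAt u x) (hu0 : u x ≠ 0)
    (h : ∀ᶠ y in 𝓝 x, formDiscr k (P y) = f y ^ (k - 1) * u y) : P x ≠ 0 := by
  intro h0
  have hO (m) : (fun y => (P y).coeff m) =O[𝓝 x] fun y => ‖y - x‖ := by
    have := (hc m).differentiableAt.isBigO_sub
    simpa [h0] using this.norm_right
  have h1 := isBigO_formDiscr hP hO
  -- If the form vanished at `x`, its coefficients would be `O(|y - x|)`, so `f ^ (k - 1) = O(|y -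
  -- x| ^ (2 (k - 1)))`. Then `f = O(|y - x| ^ 2)`, and its differential would vanish.
  have h2 : (fun y => f y ^ (k - 1)) =O[𝓝 x] fun y => ‖y - x‖ ^ (2 * (k - 1)) := by
    have h3 : (fun y => (u y)⁻¹) =O[𝓝 x] fun _ => (1 : ℝ) := (hu.inv₀ hu0).tendsto.isBigO_one ℝ
    refine (h1.mul h3).congr' ?_ (.of_forall fun y => by simp)
    filter_upwards [h, hu.eventually_ne hu0] with y hy hy0
    rw [hy, mul_inv_cancel_right₀ hy0]
  have h3 : f =O[𝓝 x] fun y => ‖y - x‖ ^ 2 := by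
    refine IsBigO.of_pow (n := k - 1) (by omega) (h2.congr (fun y => rfl) fun y => ?_)
    rw [pow_mul]
    rfl
  exact hdf (h3.hasFDerivAt one_lt_two).fderiv

end Webs

namespace Webs

open Polynomial

/-! ### Local factorization of families of binary forms -/

/-- A vector spanning the kernel of a covector. -/
def kernelVec (a : ℂ × ℂ) : ℂ × ℂ := (a.2, -a.1)

lemma evalForm_linearForm_kernelVec (a b : ℂ × ℂ) :
    evalForm (linearForm a) (kernelVec b) = wedge a b := eval_linearForm_kernel a b

lemma analyticAt_kernelVec {a : ℂ × ℂ → ℂ × ℂ} {x : ℂ × ℂ} (ha : AnalyticAt ℂ a x) :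
    AnalyticAt ℂ (fun y => kernelVec (a y)) x :=
  (analyticAt_snd_comp ha).prod (analyticAt_fst_comp ha).neg

lemma wedge_kernelVec (a b : ℂ × ℂ) : wedge (kernelVec a) (kernelVec b) = wedge a b := by
  simp only [wedge, kernelVec]; ring

lemma coeff_restrictLine {k : ℕ} {P : BinaryForm} (hP : P.IsHomogeneous k) (a b : ℂ × ℂ) :
    (restrictLine P a b).coeff k = evalForm P a := by
  have h1 (j : ℕ) (hj : j ≤ k) :
      ((C a.1 * X + C b.1) ^ j * (C a.2 * X + C b.2) ^ (k - j)).coeff k =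
        a.1 ^ j * a.2 ^ (k - j) := by
    have hd (c d : ℂ) : (C c * X + C d).natDegree ≤ 1 := natDegree_linear_le
    have hc (c d : ℂ) (n : ℕ) : ((C c * X + C d) ^ n).coeff n = c ^ n := by
      have := coeff_pow_of_natDegree_le (m := n) (hd c d)
      simpa using this
    have := coeff_mul_add_eq_of_natDegree_le (df := j) (dg := k - j)
      ((natDegree_pow_le_of_le j (hd a.1 b.1)).trans (mul_one j).le)
      ((natDegree_pow_le_of_le (k - j) (hd a.2 b.2)).trans (mul_one (k - j)).le)
    rw [show j + (k - j) = k by omega] at this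
    rw [this, hc, hc]
  have h2 := eval_restrictLine P 0 a 0
  rw [zero_smul, zero_add] at h2
  rw [← h2, restrictLine_eq_sum hP, restrictLine_eq_sum hP, finsetSum_coeff, eval_finsetSum]
  refine Finset.sum_congr rfl fun j hj => ?_
  rw [coeff_C_mul, h1 j (by simpa [Nat.lt_succ_iff] using hj)]
  simp

lemma exists_eq_C_mul_prod {k : ℕ} {q : ℂ[X]} (hq : q.natDegree ≤ k) (h : q.coeff k ≠ 0) :
    ∃ r : Fin k → ℂ, q = C (q.coeff k) * ∏ i, (X - C (r i)) := by
  have hd : q.natDegree = k := le_antisymm hq (le_natDegree_of_ne_zero h)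
  have hs : q.Splits := IsAlgClosed.splits q
  have hcard : q.roots.card = k := by rw [← hd]; exact hs.natDegree_eq_card_roots.symm
  obtain ⟨r, hr⟩ := exists_fin_map_eq q.roots hcard
  refine ⟨r, ?_⟩
  have h1 := hs.eq_prod_roots
  rw [← hr, Multiset.map_map, leadingCoeff, hd] at h1
  exact h1

lemma coeff_eq_zero_of_forall_root {k : ℕ} {q : ℂ[X]} (hq : q.natDegree ≤ k) (h : q.coeff k ≠ 0)
    (h0 : ∀ t, q.eval t = 0 → t = 0) {j : ℕ} (hj : j < k) : q.coeff j = 0 := by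
  obtain ⟨r, hr⟩ := exists_eq_C_mul_prod hq h
  have hr0 (i : Fin k) : r i = 0 := h0 _ (by
    rw [hr, eval_mul, eval_prod, Finset.prod_eq_zero (Finset.mem_univ i) (by simp), mul_zero])
  rw [hr]
  simp [hr0, coeff_X_pow, hj.ne]

/-- On this line `χ + r ψ` takes the value `-(ψ ∧ χ) (t - r)`, so the roots of the restriction are
the slopes of the linear factors in the frame `ψ, χ`. -/
lemma eq_C_mul_prod_linearForm {k : ℕ} {P : BinaryForm} (hP : P.IsHomogeneous k) {ψ χ : ℂ × ℂ}
    (hJ : wedge ψ χ ≠ 0) {b : ℂ} {r : Fin k → ℂ}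
    (h : restrictLine P (kernelVec ψ) (kernelVec χ) = C b * ∏ i, (X - C (r i))) :
    P = MvPolynomial.C (b * ((-wedge ψ χ) ^ k)⁻¹) * ∏ i, linearForm (χ + r i • ψ) := by
  refine eq_of_eval_line_eq hP (isHomogeneous_C_mul_prod _ _)
    ((wedge_kernelVec ψ χ).trans_ne hJ) fun t => ?_
  rw [← eval_restrictLine, h, evalForm_mul, evalForm_C, evalForm_prod]
  have h1 (i : Fin k) : evalForm (linearForm (χ + r i • ψ)) (t • kernelVec ψ + kernelVec χ) =
      -wedge ψ χ * (t - r i) := by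
    simp only [evalForm_linearForm, kernelVec, wedge, Prod.fst_add, Prod.snd_add, Prod.smul_fst,
      Prod.smul_snd, smul_eq_mul]
    ring
  simp only [h1, Finset.prod_mul_distrib, Finset.prod_const, Finset.card_univ, Fintype.card_fin,
    eval_mul, eval_C, eval_prod, eval_sub, eval_X]
  have : (-wedge ψ χ) ^ k ≠ 0 := pow_ne_zero _ (neg_ne_zero.mpr hJ)
  field_simp

lemma formDiscr_of_restrictLine_eq {k : ℕ} {P : BinaryForm} (hP : P.IsHomogeneous k) {ψ χ : ℂ × ℂ}
    (hJ : wedge ψ χ ≠ 0) {b : ℂ} {r : Fin k → ℂ}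
    (h : restrictLine P (kernelVec ψ) (kernelVec χ) = C b * ∏ i, (X - C (r i))) :
    formDiscr k P = (b * ((-wedge ψ χ) ^ k)⁻¹) ^ (2 * (k - 1)) * (discrConst k *
      (wedge ψ χ ^ (k * (k - 1)) * ∏ i, ∏ j ∈ Finset.univ.erase i, (r i - r j))) := by
  rw [eq_C_mul_prod_linearForm hP hJ h, formDiscr_prod]
  have h1 (i j : Fin k) : wedge (χ + r i • ψ) (χ + r j • ψ) = wedge ψ χ * (r i - r j) := by
    simp only [wedge, Prod.fst_add, Prod.snd_add, Prod.smul_fst, Prod.smul_snd, smul_eq_mul]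
    ring
  simp only [h1, Finset.prod_mul_distrib, Finset.prod_const, Finset.card_univ, Fintype.card_fin,
    Finset.card_erase_of_mem (Finset.mem_univ _), ← pow_mul, mul_comm k]

/-- The families of binary forms which split with distinct roots at `x` split near `x`. -/
lemma exists_local_factorization {k : ℕ} {P : ℂ × ℂ → BinaryForm} {x : ℂ × ℂ}
    (hP : ∀ᶠ y in 𝓝 x, (P y).IsHomogeneous k)
    (hc : ∀ m, AnalyticAt ℂ (fun y => (P y).coeff m) x) {ψ χ : ℂ × ℂ → ℂ × ℂ}
    (hψ : AnalyticAt ℂ ψ x) (hχ : AnalyticAt ℂ χ x) (hJ : wedge (ψ x) (χ x) ≠ 0)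
    (hlead : evalForm (P x) (kernelVec (ψ x)) ≠ 0) {r : Fin k → ℂ} (hr : Function.Injective r)
    (h : restrictLine (P x) (kernelVec (ψ x)) (kernelVec (χ x)) =
      C (evalForm (P x) (kernelVec (ψ x))) * ∏ i, (X - C (r i))) :
    ∃ (c : Fin k → ℂ × ℂ → ℂ) (u : ℂ × ℂ → ℂ), (∀ i, AnalyticAt ℂ (c i) x) ∧ (∀ i, c i x = r i) ∧
      AnalyticAt ℂ u x ∧ u x ≠ 0 ∧
      (∀ᶠ y in 𝓝 x, restrictLine (P y) (kernelVec (ψ y)) (kernelVec (χ y)) =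
        C (evalForm (P y) (kernelVec (ψ y))) * ∏ i, (X - C (c i y))) ∧
      ∀ᶠ y in 𝓝 x, P y = MvPolynomial.C (u y) * ∏ i, linearForm (χ y + c i y • ψ y) := by
  set p : ℂ × ℂ → ℂ[X] := fun y => restrictLine (P y) (kernelVec (ψ y)) (kernelVec (χ y)) with hp
  have hpa : CoeffAnalyticAt p x :=
    coeffAnalyticAt_restrictLine hP hc (analyticAt_kernelVec hψ) (analyticAt_kernelVec hχ)
  have hdeg : ∀ᶠ y in 𝓝 x, (p y).natDegree ≤ k := hP.mono fun y hy =>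
    natDegree_restrictLine_le hy _ _
  have hco : ∀ᶠ y in 𝓝 x, (p y).coeff k = evalForm (P y) (kernelVec (ψ y)) := hP.mono fun y hy =>
    coeff_restrictLine hy _ _
  obtain ⟨c, hca, hcx, hcp⟩ := hpa.exists_roots hdeg (hco.self_of_nhds.trans_ne hlead) hr
    (by rw [hco.self_of_nhds]; exact h)
  have hJa := analyticAt_wedge hψ hχ
  have hJn : ∀ᶠ y in 𝓝 x, wedge (ψ y) (χ y) ≠ 0 := hJa.continuousAt.eventually_ne hJ
  refine ⟨c, fun y => (p y).coeff k * ((-wedge (ψ y) (χ y)) ^ k)⁻¹, hca, hcx, ?_, ?_, ?_, ?_⟩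
  · exact (hpa k).mul ((hJa.neg.pow k).inv (pow_ne_zero _ (neg_ne_zero.mpr hJ)))
  · exact mul_ne_zero (hco.self_of_nhds.trans_ne hlead)
      (inv_ne_zero (pow_ne_zero _ (neg_ne_zero.mpr hJ)))
  · filter_upwards [hcp, hco] with y h1 h2
    rw [← h2]
    exact h1
  · filter_upwards [hcp, hJn, hP] with y h1 h2 h3
    exact eq_C_mul_prod_linearForm h3 h2 h1

/-- A smooth web, transverse at `x` to the level of `f`, is given by `1`-forms `ξ + c_i df`. -/
lemma exists_slopes {k : ℕ} {P : ℂ × ℂ → BinaryForm} {x ξ : ℂ × ℂ} {f : ℂ × ℂ → ℂ}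
    (hP : ∀ᶠ y in 𝓝 x, (P y).IsHomogeneous k)
    (hc : ∀ m, AnalyticAt ℂ (fun y => (P y).coeff m) x) (hf : AnalyticAt ℂ f x)
    (hJ : wedge ξ (grad f x) ≠ 0) (hlead : evalForm (P x) (kernelVec (grad f x)) ≠ 0)
    (hd : formDiscr k (P x) ≠ 0) :
    ∃ (c : Fin k → ℂ × ℂ → ℂ) (u : ℂ × ℂ → ℂ), (∀ i, AnalyticAt ℂ (c i) x) ∧
      (∀ i j, i ≠ j → c i x ≠ c j x) ∧ AnalyticAt ℂ u x ∧ u x ≠ 0 ∧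
      ∀ᶠ y in 𝓝 x, P y = MvPolynomial.C (u y) * ∏ i, linearForm (ξ + c i y • grad f y) := by
  have hJ' : wedge (grad f x) ξ ≠ 0 := by rw [wedge_comm]; exact neg_ne_zero.mpr hJ
  have hPx := hP.self_of_nhds
  obtain ⟨r, hr⟩ := exists_eq_C_mul_prod
    (natDegree_restrictLine_le hPx (kernelVec (grad f x)) (kernelVec ξ))
    (by rwa [coeff_restrictLine hPx])
  rw [coeff_restrictLine hPx] at hr
  have hinj : ∀ i j, i ≠ j → r i ≠ r j := by
    rw [formDiscr_of_restrictLine_eq hPx hJ' hr] at hd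
    have h1 := right_ne_zero_of_mul (right_ne_zero_of_mul (right_ne_zero_of_mul hd))
    intro i j hij
    have h2 := Finset.prod_ne_zero_iff.mp (Finset.prod_ne_zero_iff.mp h1 i (Finset.mem_univ i)) j
      (Finset.mem_erase.mpr ⟨hij.symm, Finset.mem_univ j⟩)
    exact sub_ne_zero.mp h2
  obtain ⟨c, u, hca, hcx, hu, hu0, -, hPu⟩ := exists_local_factorization hP hc (analyticAt_grad hf)
    analyticAt_const hJ' hlead (fun i j h => by_contra fun h' => hinj i j h' h) hr
  exact ⟨c, u, hca, fun i j hij => by rw [hcx, hcx]; exact hinj i j hij, hu, hu0, hPu⟩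

end Webs

namespace Webs

open Polynomial Asymptotics

/-! ### The slopes of a web along a totally invariant component of minimal multiplicity -/

lemma neBot_nhdsWithin_ne_zero {f : ℂ × ℂ → ℂ} {x : ℂ × ℂ} (hdf : grad f x ≠ 0) : (𝓝[{y | f y ≠ 0}] x).NeBot := by
  rw [← mem_closure_iff_nhdsWithin_neBot, mem_closure_iff_frequently]
  intro h
  have h1 : f =ᶠ[𝓝 x] fun _ => 0 := h.mono fun y hy => not_not.mp hy
  apply hdf
  rw [(grad_congr h1).self_of_nhds]
  simp [grad]

/-- The local data of a `ν`-web near a smooth point `x` of a totally invariant curve `f = 0`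
of minimal multiplicity in the discriminant. -/
structure IsInvariantGerm (ν : ℕ) (P : ℂ × ℂ → BinaryForm) (f : ℂ × ℂ → ℂ) (x : ℂ × ℂ) : Prop where
  two_le : 2 ≤ ν
  isHomogeneous : ∀ᶠ y in 𝓝 x, (P y).IsHomogeneous ν
  analyticAt_coeff : ∀ m, AnalyticAt ℂ (fun y => (P y).coeff m) x
  analyticAt : AnalyticAt ℂ f x
  eq_zero : f x = 0
  grad_ne_zero : grad f x ≠ 0
  formDiscr_eq : ∃ u : ℂ × ℂ → ℂ, ContinuousAt u x ∧ u x ≠ 0 ∧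
    ∀ᶠ y in 𝓝 x, formDiscr ν (P y) = f y ^ (ν - 1) * u y
  invariant : ∀ᶠ y in 𝓝 x, f y = 0 → P y ≠ 0 →
    ∀ v, evalForm (P y) v = 0 ↔ evalForm (linearForm (grad f y)) v = 0

namespace IsInvariantGerm

variable {ν : ℕ} {P : ℂ × ℂ → BinaryForm} {f : ℂ × ℂ → ℂ} {x ξ : ℂ × ℂ}

lemma ne_zero (h : IsInvariantGerm ν P f x) : P x ≠ 0 := by
  obtain ⟨u, hu, hu0, hd⟩ := h.formDiscr_eq
  refine ne_zero_of_formDiscr_eq h.two_le h.isHomogeneous h.analyticAt_coeff ?_ hu hu0 hd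
  intro h0
  apply h.grad_ne_zero
  simp [grad, h0]

lemma eventually_ne_zero (h : IsInvariantGerm ν P f x) : ∀ᶠ y in 𝓝 x, P y ≠ 0 := by
  obtain ⟨m, hm⟩ := MvPolynomial.ne_zero_iff.mp h.ne_zero
  filter_upwards [(h.analyticAt_coeff m).continuousAt.eventually_ne hm] with y hy
  exact MvPolynomial.ne_zero_iff.mpr ⟨m, hy⟩

lemma eval_kernelVec_ne_zero (h : IsInvariantGerm ν P f x) (hJ : wedge ξ (grad f x) ≠ 0) :
    evalForm (P x) (kernelVec ξ) ≠ 0 := by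
  rw [Ne, h.invariant.self_of_nhds h.eq_zero h.ne_zero, evalForm_linearForm_kernelVec, wedge_comm]
  exact neg_ne_zero.mpr hJ

lemma eventually_wedge_ne_zero (h : IsInvariantGerm ν P f x) (hJ : wedge ξ (grad f x) ≠ 0) :
    ∀ᶠ y in 𝓝 x, wedge ξ (grad f y) ≠ 0 :=
  Webs.eventually_wedge_ne_zero analyticAt_const (analyticAt_grad h.analyticAt) hJ

/-- The restriction of the web to an affine line, as a family of polynomials. -/
lemma coeffAnalyticAt (h : IsInvariantGerm ν P f x) : CoeffAnalyticAt
    (fun y => restrictLine (P y) (kernelVec ξ) (kernelVec (grad f y))) x :=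
  coeffAnalyticAt_restrictLine h.isHomogeneous h.analyticAt_coeff analyticAt_const
    (analyticAt_kernelVec (analyticAt_grad h.analyticAt))

lemma natDegree_le (h : IsInvariantGerm ν P f x) : ∀ᶠ y in 𝓝 x,
    (restrictLine (P y) (kernelVec ξ) (kernelVec (grad f y))).natDegree ≤ ν :=
  h.isHomogeneous.mono fun _ hy => natDegree_restrictLine_le hy _ _

lemma coeff_ne_zero (h : IsInvariantGerm ν P f x) (hJ : wedge ξ (grad f x) ≠ 0) :
    ∀ᶠ y in 𝓝 x, (restrictLine (P y) (kernelVec ξ) (kernelVec (grad f y))).coeff ν ≠ 0 :=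
  (h.coeffAnalyticAt ν).continuousAt.eventually_ne
    ((coeff_restrictLine h.isHomogeneous.self_of_nhds _ _).trans_ne (h.eval_kernelVec_ne_zero hJ))

/-- A root `t` corresponds to a factor `df + t ξ`. On the curve, invariance allows only the
direction of `ker df`, hence only the root `0`, and the polynomial is a monomial of degree `ν`. -/
lemma coeff_eq_zero (h : IsInvariantGerm ν P f x) (hJ : wedge ξ (grad f x) ≠ 0) :
    ∀ᶠ y in 𝓝 x, f y = 0 → ∀ j < ν,
      (restrictLine (P y) (kernelVec ξ) (kernelVec (grad f y))).coeff j = 0 := by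
  filter_upwards [h.invariant, h.eventually_ne_zero, h.natDegree_le (ξ := ξ), h.coeff_ne_zero hJ,
    h.eventually_wedge_ne_zero hJ] with y h1 h2 h3 h4 h5 h0 j hj
  refine coeff_eq_zero_of_forall_root h3 h4 (fun t ht => ?_) hj
  rw [eval_restrictLine, h1 h0 h2] at ht
  have e : evalForm (linearForm (grad f y)) (t • kernelVec ξ + kernelVec (grad f y)) =
      -wedge ξ (grad f y) * t := by
    simp only [evalForm_linearForm, kernelVec, wedge, Prod.fst_add, Prod.snd_add, Prod.smul_fst,
      Prod.smul_snd, smul_eq_mul]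
    ring
  rw [e] at ht
  exact (mul_eq_zero.mp ht).resolve_left (neg_ne_zero.mpr h5)

/-- The coefficients vanish on the smooth curve `f = 0`, so their quotients by `f` have removable
singularities. -/
lemma exists_quotients (h : IsInvariantGerm ν P f x) (hJ : wedge ξ (grad f x) ≠ 0) :
    ∃ a : ℕ → ℂ × ℂ → ℂ, (∀ j, AnalyticAt ℂ (a j) x) ∧ ∀ᶠ y in 𝓝 x, ∀ j < ν,
      (restrictLine (P y) (kernelVec ξ) (kernelVec (grad f y))).coeff j = f y * a j y := by
  set p : ℂ × ℂ → ℂ[X] := fun y => restrictLine (P y) (kernelVec ξ) (kernelVec (grad f y)) with hp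
  have hpa : CoeffAnalyticAt p x := h.coeffAnalyticAt
  have hex (j : ℕ) : ∃ a : ℂ × ℂ → ℂ, AnalyticAt ℂ a x ∧
      (j < ν → ∀ᶠ y in 𝓝 x, (p y).coeff j = f y * a y) := by
    by_cases hj : j < ν
    · obtain ⟨a, ha, haf⟩ := exists_analytic_extension (G := fun y => (p y).coeff j / f y)
        h.analyticAt h.eq_zero h.grad_ne_zero
        (by
          filter_upwards [(hpa j).eventually_analyticAt, h.analyticAt.eventually_analyticAt]
            with y h1 h2 h3 using h1.div h2 h3)
        (by
          filter_upwards [(hpa j).eventually_analyticAt, h.coeff_eq_zero hJ] with y h1 h2 h3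
          have h4 : Tendsto (fun t => (p t).coeff j) (𝓝[{t | f t ≠ 0}] y) (𝓝 0) := by
            rw [← h2 h3 j hj]
            exact h1.continuousAt.tendsto.mono_left nhdsWithin_le_nhds
          refine h4.congr' ?_
          filter_upwards [self_mem_nhdsWithin] with t ht
          exact (mul_div_cancel₀ _ ht).symm)
      refine ⟨a, ha, fun _ => ?_⟩
      filter_upwards [haf, h.coeff_eq_zero hJ] with y h1 h2
      by_cases h3 : f y = 0
      · rw [h3, zero_mul]; exact h2 h3 j hj
      · rw [h1 h3, mul_div_cancel₀ _ h3]
    · exact ⟨fun _ => 0, analyticAt_const, fun h => absurd h hj⟩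
  choose a ha haf using hex
  refine ⟨a, ha, ?_⟩
  have : ∀ᶠ y in 𝓝 x, ∀ j : Fin ν, (p y).coeff j = f y * a j y :=
    eventually_all.mpr fun j => haf j j.2
  exact this.mono fun y hy j hj => hy ⟨j, hj⟩

/-- The roots are chosen point by point, without continuity; this suffices for estimating their
sizes and differences. -/
lemma eventually_exists_roots (h : IsInvariantGerm ν P f x) (hJ : wedge ξ (grad f x) ≠ 0) :
    ∃ r : Fin ν → ℂ × ℂ → ℂ, ∀ᶠ y in 𝓝 x,
      restrictLine (P y) (kernelVec ξ) (kernelVec (grad f y)) =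
        C ((restrictLine (P y) (kernelVec ξ) (kernelVec (grad f y))).coeff ν) *
          ∏ i, (X - C (r i y)) := by
  have hex (y) : ∃ r : Fin ν → ℂ,
      (restrictLine (P y) (kernelVec ξ) (kernelVec (grad f y))).natDegree ≤ ν →
      (restrictLine (P y) (kernelVec ξ) (kernelVec (grad f y))).coeff ν ≠ 0 →
      restrictLine (P y) (kernelVec ξ) (kernelVec (grad f y)) =
        C ((restrictLine (P y) (kernelVec ξ) (kernelVec (grad f y))).coeff ν) *
          ∏ i, (X - C (r i)) := by
    by_cases h1 : (restrictLine (P y) (kernelVec ξ) (kernelVec (grad f y))).natDegree ≤ ν ∧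
      (restrictLine (P y) (kernelVec ξ) (kernelVec (grad f y))).coeff ν ≠ 0
    · obtain ⟨r, hr⟩ := exists_eq_C_mul_prod h1.1 h1.2
      exact ⟨r, fun _ _ => hr⟩
    · exact ⟨0, fun h2 h3 => absurd ⟨h2, h3⟩ h1⟩
  choose r hr using hex
  refine ⟨fun i y => r y i, ?_⟩
  filter_upwards [h.natDegree_le (ξ := ξ), h.coeff_ne_zero hJ] with y h1 h2 using hr y h1 h2

lemma isRamified (h : IsInvariantGerm ν P f x) (hJ : wedge ξ (grad f x) ≠ 0)
    {a : ℕ → ℂ × ℂ → ℂ} (ha : ∀ j, AnalyticAt ℂ (a j) x) (hab : ∀ᶠ y in 𝓝 x, ∀ j < ν,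
      (restrictLine (P y) (kernelVec ξ) (kernelVec (grad f y))).coeff j = f y * a j y)
    {r : Fin ν → ℂ × ℂ → ℂ} (hr : ∀ᶠ y in 𝓝 x,
      restrictLine (P y) (kernelVec ξ) (kernelVec (grad f y)) =
        C ((restrictLine (P y) (kernelVec ξ) (kernelVec (grad f y))).coeff ν) *
          ∏ i, (X - C (r i y))) :
    IsRamified (𝓝[{y | f y ≠ 0}] x) f ν
      (fun y => (restrictLine (P y) (kernelVec ξ) (kernelVec (grad f y))).coeff ν) a r := by
  set p : ℂ × ℂ → ℂ[X] := fun y => restrictLine (P y) (kernelVec ξ) (kernelVec (grad f y)) with hp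
  have hpa : CoeffAnalyticAt p x := h.coeffAnalyticAt
  have hl : 𝓝[{y | f y ≠ 0}] x ≤ 𝓝 x := nhdsWithin_le_nhds
  have ha1 (j : ℕ) : a j =O[𝓝[{y | f y ≠ 0}] x] fun _ => (1 : ℂ) :=
    ((ha j).continuousAt.tendsto.mono_left hl).isBigO_one ℂ
  have hbinv : (fun y => ((p y).coeff ν)⁻¹) =O[𝓝[{y | f y ≠ 0}] x] fun _ => (1 : ℂ) :=
    (((hpa ν).continuousAt.inv₀ (h.coeff_ne_zero hJ).self_of_nhds).tendsto.mono_left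
      hl).isBigO_one ℂ
  refine ⟨h.two_le, neBot_nhdsWithin_ne_zero h.grad_ne_zero, self_mem_nhdsWithin,
    ?_, ?_, fun j _ => ha1 j, ⟨a 0 x, (ha 0).continuousAt.tendsto.mono_left hl⟩, ?_, ?_⟩
  · have := h.analyticAt.continuousAt.tendsto.mono_left hl
    rwa [h.eq_zero] at this
  · refine (hbinv.mul (isBigO_refl (fun y => (p y).coeff ν) _)).congr' ?_
      (.of_forall fun y => one_mul _)
    filter_upwards [hl (h.coeff_ne_zero hJ)] with y hy
    exact inv_mul_cancel₀ hy
  · intro i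
    filter_upwards [hl hr, hl hab, hl (h.natDegree_le (ξ := ξ))] with y h1 h2 h3
    have h4 : (p y).eval (r i y) = 0 := by
      simp only [hp]
      rw [h1, eval_mul, eval_prod, Finset.prod_eq_zero (Finset.mem_univ i) (by simp), mul_zero]
    rw [eval_eq_sum_range' (Nat.lt_succ_of_le h3), Finset.sum_range_succ, add_comm] at h4
    rw [← h4]
    congr 1
    exact Finset.sum_congr rfl fun j hj => by rw [← h2 j (Finset.mem_range.mp hj)]
  · obtain ⟨u, hu, hu0, hd⟩ := h.formDiscr_eq
    have hcont : ContinuousAt (fun y => wedge ξ (grad f y)) x :=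
      (analyticAt_wedge analyticAt_const (analyticAt_grad h.analyticAt)).continuousAt
    -- By `formDiscr_of_restrictLine_eq`, this function times the product of the differences of the
    -- roots is `f ^ (ν - 1)`; being continuous at `x`, it is bounded near `x`.
    have hJ1 : ContinuousAt (fun y => (((p y).coeff ν) * ((-wedge ξ (grad f y)) ^ ν)⁻¹) ^
        (2 * (ν - 1)) * (discrConst ν * wedge ξ (grad f y) ^ (ν * (ν - 1))) * (u y)⁻¹) x :=
      ((((hpa ν).continuousAt.mul ((hcont.neg.pow ν).inv₀
        (pow_ne_zero _ (neg_ne_zero.mpr hJ)))).pow _).mul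
        (continuousAt_const.mul (hcont.pow _))).mul (hu.inv₀ hu0)
    have h1 := (hJ1.tendsto.mono_left hl).isBigO_one ℂ
    refine (h1.mul (isBigO_refl
      (fun y => ∏ i, ∏ j ∈ Finset.univ.erase i, (r i y - r j y)) _)).congr' ?_
      (.of_forall fun y => by simp)
    filter_upwards [hl hr, hl hd, hl (hu.eventually_ne hu0), hl (h.eventually_wedge_ne_zero hJ),
      hl h.isHomogeneous] with y h1 h2 h3 h4 h5
    have h6 := formDiscr_of_restrictLine_eq h5 h4 h1
    rw [← mul_inv_cancel_right₀ h3 (f y ^ (ν - 1)), ← h2, h6]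
    ring

end IsInvariantGerm

end Webs

namespace Webs

open Polynomial Asymptotics

/-! ### Differentials of the slopes -/

lemma eventually_analyticAt_coeff {k : ℕ} {P : ℂ × ℂ → BinaryForm} {x : ℂ × ℂ}
    (hP : ∀ᶠ y in 𝓝 x, (P y).IsHomogeneous k)
    (hc : ∀ m, AnalyticAt ℂ (fun y => (P y).coeff m) x) :
    ∀ᶠ q in 𝓝 x, ∀ m, AnalyticAt ℂ (fun y => (P y).coeff m) q := by
  have h : ∀ᶠ q in 𝓝 x, ∀ j : Fin (k + 1), AnalyticAt ℂ
      (fun y => (P y).coeff (Finsupp.single 0 (j : ℕ) + Finsupp.single 1 (k - j))) q :=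
    eventually_all.mpr fun j => (hc _).eventually_analyticAt
  filter_upwards [h, hP.eventually_nhds] with q h1 h2 m
  by_cases hm : m 0 + m 1 = k
  · have e : m = Finsupp.single 0 (m 0) + Finsupp.single 1 (k - m 0) := by
      ext i
      fin_cases i
      · simp
      · simp only [Fin.mk_one, Finsupp.add_apply]; simp; omega
    rw [e]
    exact h1 ⟨m 0, by omega⟩
  · refine analyticAt_const.congr (f := fun _ => (0 : ℂ)) ?_
    filter_upwards [h2] with y hy
    refine (hy.coeff_eq_zero fun hd => hm ?_).symm
    rw [← hd, Finsupp.degree_eq_sum]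
    simp

/-- The slopes `c i q`, defined near `q`, of the `1`-forms `ξ + c df` giving a web, at the points
`q` off the curve `f = 0` and near `x`. -/
def IsSlopeSystem (k : ℕ) (P : ℂ × ℂ → BinaryForm) (f : ℂ × ℂ → ℂ) (ξ x : ℂ × ℂ)
    (c : Fin k → ℂ × ℂ → ℂ × ℂ → ℂ) : Prop :=
  ∀ᶠ q in 𝓝[{y | f y ≠ 0}] x, (∀ i, AnalyticAt ℂ (c i q) q) ∧
    ∃ u : ℂ × ℂ → ℂ, AnalyticAt ℂ u q ∧ u q ≠ 0 ∧
      ∀ᶠ y in 𝓝 q, P y = MvPolynomial.C (u y) * ∏ i, linearForm (ξ + c i q y • grad f y)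

namespace IsInvariantGerm

variable {ν : ℕ} {P : ℂ × ℂ → BinaryForm} {f : ℂ × ℂ → ℂ} {x ξ : ℂ × ℂ}

lemma grad_root_eq (h : IsInvariantGerm ν P f x) {a : ℕ → ℂ × ℂ → ℂ}
    (ha : ∀ j, AnalyticAt ℂ (a j) x) (hab : ∀ᶠ y in 𝓝 x, ∀ j < ν,
      (restrictLine (P y) (kernelVec ξ) (kernelVec (grad f y))).coeff j = f y * a j y) :
    ∀ᶠ q in 𝓝 x, ∀ j < ν,
      grad (fun y => (restrictLine (P y) (kernelVec ξ) (kernelVec (grad f y))).coeff j) q =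
        f q • grad (a j) q + a j q • grad f q := by
  have h1 : ∀ᶠ q in 𝓝 x, ∀ j : Fin ν, AnalyticAt ℂ (a j) q :=
    eventually_all.mpr fun j => (ha j).eventually_analyticAt
  filter_upwards [hab.eventually_nhds, h1, h.analyticAt.eventually_analyticAt] with q h2 h3 h4 j hj
  rw [(grad_congr (h2.mono fun y hy => hy j hj)).self_of_nhds,
    grad_mul h4.differentiableAt (h3 ⟨j, hj⟩).differentiableAt]

lemma isBigO_one_grad {g : ℂ × ℂ → ℂ} (hg : AnalyticAt ℂ g x) {l : Filter (ℂ × ℂ)}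
    (hl : l ≤ 𝓝 x) : grad g =O[l] fun _ => (1 : ℝ) :=
  ((analyticAt_grad hg).continuousAt.tendsto.mono_left hl).isBigO_one ℝ

/-- The roots, as local analytic functions, and their differentials. -/
lemma exists_roots (h : IsInvariantGerm ν P f x) (hJ : wedge ξ (grad f x) ≠ 0)
    {τ : ℂ × ℂ → ℝ} (hτ0 : ∀ y, 0 ≤ τ y) (hτf : ∀ y, τ y ^ ν = ‖f y‖) :
    ∃ c : Fin ν → ℂ × ℂ → ℂ × ℂ → ℂ,
      (∀ᶠ q in 𝓝[{y | f y ≠ 0}] x, (∀ i, AnalyticAt ℂ (c i q) q) ∧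
        ∃ u : ℂ × ℂ → ℂ, AnalyticAt ℂ u q ∧ u q ≠ 0 ∧
          ∀ᶠ y in 𝓝 q, P y = MvPolynomial.C (u y) * ∏ i, linearForm (grad f y + c i q y • ξ)) ∧
      ∀ i, (fun q => c i q q) =O[𝓝[{y | f y ≠ 0}] x] τ ∧
        τ =O[𝓝[{y | f y ≠ 0}] x] (fun q => c i q q) ∧
        (∀ j, i ≠ j → τ =O[𝓝[{y | f y ≠ 0}] x] fun q => c i q q - c j q q) ∧
        (fun q => grad (c i q) q - (c i q q / (ν * f q)) • grad f q) =O[𝓝[{y | f y ≠ 0}] x]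
          (fun q => τ q ^ 2 / ‖f q‖) ∧
        (fun q => wedge (grad (c i q) q - (c i q q / (ν * f q)) • grad f q) (grad f q))
          =O[𝓝[{y | f y ≠ 0}] x] τ := by
  have hl : 𝓝[{y | f y ≠ 0}] x ≤ 𝓝 x := nhdsWithin_le_nhds
  obtain ⟨a, ha, hab⟩ := h.exists_quotients hJ
  obtain ⟨r, hr⟩ := h.eventually_exists_roots hJ
  have hR := h.isRamified hJ ha hab hr
  set p : ℂ × ℂ → ℂ[X] := fun y => restrictLine (P y) (kernelVec ξ) (kernelVec (grad f y)) with hp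
  have hpa : CoeffAnalyticAt p x := h.coeffAnalyticAt
  -- Off the curve the roots are distinct, since their differences are at least of order `τ > 0`;
  -- this permits the local analytic factorization.
  have hdist : ∀ᶠ q in 𝓝[{y | f y ≠ 0}] x, ∀ i j, i ≠ j → r i q ≠ r j q := by
    refine eventually_all.mpr fun i => eventually_all.mpr fun j => ?_
    by_cases hij : i = j
    · exact .of_forall fun q h' => absurd hij h'
    · filter_upwards [(hR.isBigO_sub hτ0 hτf hij).eq_zero_imp, hR.eventually_pos hτ0 hτf]
        with q h1 h2 _ h3
      exact h2.ne' (h1 (sub_eq_zero.mpr h3))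
  have hPa : ∀ᶠ q in 𝓝 x, ∀ m, AnalyticAt ℂ (fun y => (P y).coeff m) q :=
    eventually_analyticAt_coeff h.isHomogeneous h.analyticAt_coeff
  have hex : ∀ᶠ q in 𝓝[{y | f y ≠ 0}] x, ∃ c : Fin ν → ℂ × ℂ → ℂ,
      (∀ i, AnalyticAt ℂ (c i) q) ∧ (∀ i, c i q = r i q) ∧
      (∀ᶠ y in 𝓝 q, ∀ i, (p y).eval (c i y) = 0) ∧
      ∃ u : ℂ × ℂ → ℂ, AnalyticAt ℂ u q ∧ u q ≠ 0 ∧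
        ∀ᶠ y in 𝓝 q, P y = MvPolynomial.C (u y) * ∏ i, linearForm (grad f y + c i y • ξ) := by
    filter_upwards [hdist, hl hr, hl h.isHomogeneous.eventually_nhds, hl hPa,
      hl h.analyticAt.eventually_analyticAt, hl (h.eventually_wedge_ne_zero hJ),
      hl (h.coeff_ne_zero hJ)] with q h1 h2 h3 h4 h5 h6 h7
    have h8 := coeff_restrictLine h3.self_of_nhds (kernelVec ξ) (kernelVec (grad f q))
    rw [h8] at h2 h7
    obtain ⟨c, u, hca, hcq, hu, hu0, hroot, hPu⟩ := exists_local_factorization h3 h4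
      (ψ := fun _ => ξ) analyticAt_const (analyticAt_grad h5) h6 h7
      (fun i j hij => by_contra fun hne => h1 i j hne hij) h2
    refine ⟨c, hca, hcq, ?_, u, hu, hu0, hPu⟩
    filter_upwards [hroot] with y hy i
    simp only [hp]
    rw [hy, eval_mul, eval_prod, Finset.prod_eq_zero (Finset.mem_univ i) (by simp), mul_zero]
  have := hR.neBot
  -- Each base point `q` gets its own analytic germs with values `r i q` at `q`. Germs at different
  -- base points need not be compatible, as monodromy around the curve may permute the roots.
  obtain ⟨c, hc'⟩ := hex.choice
  refine ⟨fun i q => c q i, hc'.mono fun q hq => ⟨hq.1, hq.2.2.2⟩, fun i => ?_⟩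
  have hcr (i : Fin ν) : (fun q => c q i q) =ᶠ[𝓝[{y | f y ≠ 0}] x] r i :=
    hc'.mono fun q hq => hq.2.1 i
  have hb1 : (fun y => (p y).coeff ν) =O[𝓝[{y | f y ≠ 0}] x] fun _ => (1 : ℂ) :=
    ((hpa ν).continuousAt.tendsto.mono_left hl).isBigO_one ℂ
  have hpa' : ∀ᶠ q in 𝓝 x, CoeffAnalyticAt p q := hpa.eventually h.natDegree_le
  have hpow (j : ℕ) (z : ℂ) : j * z ^ (j - 1) * z = j * z ^ j := by
    cases j with
    | zero => simp
    | succ j => rw [Nat.add_sub_cancel, pow_succ]; ring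
  have hG := hR.isBigO_grad_root hτ0 hτf (i := i) (D := fun q => grad (c q i) q)
    (g := grad fun y => (p y).coeff ν) (φ := grad f) (γ := fun j => grad (a j))
    (isBigO_one_grad (hpa ν) hl) (isBigO_one_grad h.analyticAt hl)
    (fun j _ => isBigO_one_grad (ha j) hl) (by
      filter_upwards [hl hr, hl hab, hl (h.natDegree_le (ξ := ξ))] with q h1 h2 h3
      have h4 := eval_derivative_C_mul_prod ((p q).coeff ν) (r · q) i
      rw [← h1] at h4
      rw [← h4, eval_derivative_eq_sum h3, Finset.sum_mul, Finset.sum_range_succ, add_comm]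
      congr 1
      · rw [mul_assoc, hpow, ← mul_assoc, mul_comm (ν : ℂ)]
      · refine Finset.sum_congr rfl fun j hj => ?_
        rw [h2 j (Finset.mem_range.mp hj), mul_assoc, hpow]
        ring) (by
      filter_upwards [hl hr, hl (h.natDegree_le (ξ := ξ)).eventually_nhds, hc',
        hl (h.grad_root_eq ha hab), hl hpa'] with q h1 h2 h3 h5 h6
      have h7 := eval_derivative_C_mul_prod ((p q).coeff ν) (r · q) i
      rw [← h1] at h7
      have h8 := h6.grad_root h2 (h3.1 i) (h3.2.2.1.mono fun y hy => hy i)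
      rw [h3.2.1 i] at h8
      rw [← h7, h8, Finset.sum_range_succ, add_comm]
      congr 2
      exact Finset.sum_congr rfl fun j hj => by rw [h5 j (Finset.mem_range.mp hj)])
  refine ⟨(hR.isBigO_root hτf i).congr' (hcr i).symm .rfl,
    (hR.isBigO_scale hτ0 hτf hb1 i).congr' .rfl (hcr i).symm,
    fun j hij => (hR.isBigO_sub hτ0 hτf hij).congr' .rfl ((hcr i).symm.sub (hcr j).symm),
    hG.1.congr' ?_ .rfl, hG.2.congr' ?_ .rfl⟩
  · filter_upwards [hcr i] with q hq
    rw [hq]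
  · filter_upwards [hcr i] with q hq
    rw [hq]

end IsInvariantGerm

end Webs

namespace Webs

open Asymptotics

namespace IsInvariantGerm

variable {ν : ℕ} {P : ℂ × ℂ → BinaryForm} {f : ℂ × ℂ → ℂ} {x ξ : ℂ × ℂ}

lemma eventually_pos (h : IsInvariantGerm ν P f x) {τ : ℂ × ℂ → ℝ} (hτ0 : ∀ y, 0 ≤ τ y)
    (hτf : ∀ y, τ y ^ ν = ‖f y‖) : ∀ᶠ y in 𝓝[{y | f y ≠ 0}] x, 0 < τ y :=
  eventually_mem_nhdsWithin.mono fun _ => scale_pos (by have := h.two_le; omega) hτ0 hτf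

lemma tendsto_scale (h : IsInvariantGerm ν P f x) {τ : ℂ × ℂ → ℝ}
    (hτf : ∀ y, τ y ^ ν = ‖f y‖) : Tendsto τ (𝓝[{y | f y ≠ 0}] x) (𝓝 0) := by
  have hf := h.analyticAt.continuousAt.tendsto.mono_left
    (nhdsWithin_le_nhds (s := {y | f y ≠ 0}))
  rw [h.eq_zero] at hf
  exact tendsto_scale_zero (by have := h.two_le; omega) hτf hf

/-- The slopes of the web and their differentials. -/
lemma exists_slopes (h : IsInvariantGerm ν P f x) (hJ : wedge ξ (grad f x) ≠ 0)
    {τ : ℂ × ℂ → ℝ} (hτ0 : ∀ y, 0 ≤ τ y) (hτf : ∀ y, τ y ^ ν = ‖f y‖) :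
    ∃ c : Fin ν → ℂ × ℂ → ℂ × ℂ → ℂ, IsSlopeSystem ν P f ξ x c ∧
      ∀ i, (fun q => c i q q) =O[𝓝[{y | f y ≠ 0}] x] (fun q => (τ q)⁻¹) ∧
        (fun q => (τ q)⁻¹) =O[𝓝[{y | f y ≠ 0}] x] (fun q => c i q q) ∧
        (∀ j, i ≠ j → (fun q => (c i q q - c j q q)⁻¹) =O[𝓝[{y | f y ≠ 0}] x] τ ∧
          ∀ᶠ q in 𝓝[{y | f y ≠ 0}] x, c i q q ≠ c j q q) ∧
        (fun q => frameFst ξ (grad f q) (grad (c i q) q)) =O[𝓝[{y | f y ≠ 0}] x]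
          (fun q => (τ q)⁻¹) ∧
        (fun q => frameSnd ξ (grad f q) (grad (c i q) q) + c i q q / (ν * f q))
          =O[𝓝[{y | f y ≠ 0}] x] (fun q => ‖f q‖⁻¹) := by
  obtain ⟨r, hsys, hr⟩ := h.exists_roots hJ hτ0 hτf
  have hl : 𝓝[{y | f y ≠ 0}] x ≤ 𝓝 x := nhdsWithin_le_nhds
  have hpos := h.eventually_pos hτ0 hτf
  have hr0 (i) : ∀ᶠ q in 𝓝[{y | f y ≠ 0}] x, r i q q ≠ 0 := by
    filter_upwards [(hr i).2.1.eq_zero_imp, hpos] with q h1 h2 h3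
    exact h2.ne' (h1 h3)
  have hinv (i) : (fun q => (r i q q)⁻¹) =O[𝓝[{y | f y ≠ 0}] x] (fun q => (τ q)⁻¹) :=
    (hr i).2.1.inv_rev (hpos.mono fun q hq h0 => absurd h0 hq.ne')
  have hgrad (i) : ∀ᶠ q in 𝓝[{y | f y ≠ 0}] x,
      grad (fun y => (r i q y)⁻¹) q = (-(r i q q ^ 2)⁻¹) • grad (r i q) q := by
    filter_upwards [hsys, hr0 i] with q h1 h2
    exact grad_inv (h1.1 i).differentiableAt h2
  have hJinv : (fun q => (wedge ξ (grad f q))⁻¹) =O[𝓝[{y | f y ≠ 0}] x] fun _ => (1 : ℝ) :=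
    (((analyticAt_wedge analyticAt_const (analyticAt_grad h.analyticAt)).continuousAt.inv₀
      hJ).tendsto.mono_left hl).isBigO_one ℝ
  have hJn := hl (h.eventually_wedge_ne_zero hJ)
  -- Off the curve `df + r ξ = r (ξ + r⁻¹ df)` with `r ≠ 0`: the slopes are the inverses of the
  -- roots, and the product of the roots goes into the unit.
  refine ⟨fun i q y => (r i q y)⁻¹, ?_, fun i => ⟨hinv i, ?_, fun j hij => ⟨?_, ?_⟩, ?_, ?_⟩⟩
  · filter_upwards [hsys, eventually_all.mpr hr0] with q h1 h2
    obtain ⟨hra, u, hu, hu0, hPu⟩ := h1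
    refine ⟨fun i => (hra i).inv (h2 i), fun y => u y * ∏ i, r i q y, ?_, ?_, ?_⟩
    · exact hu.mul (Finset.analyticAt_fun_prod _ fun i _ => hra i)
    · exact mul_ne_zero hu0 (Finset.prod_ne_zero_iff.mpr fun i _ => h2 i)
    · filter_upwards [hPu, eventually_all.mpr fun i => (hra i).continuousAt.eventually_ne (h2 i)]
        with y h3 h4
      rw [h3, map_mul, map_prod, mul_assoc, ← Finset.prod_mul_distrib]
      congr 1
      refine Finset.prod_congr rfl fun i _ => ?_
      have e : grad f y + r i q y • ξ = r i q y • (ξ + (r i q y)⁻¹ • grad f y) := by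
        rw [smul_add, smul_smul, mul_inv_cancel₀ (h4 i), one_smul, add_comm]
      rw [e]
      simp only [linearForm, Prod.smul_fst, Prod.smul_snd, smul_eq_mul, map_mul]
      ring
  · exact (hr i).1.inv_rev ((hr0 i).mono fun q hq h0 => absurd h0 hq)
  · have h1 := ((hr i).1.mul (hr j).1).norm_left
    have h2 := ((hr i).2.2.1 j hij).inv_rev (hpos.mono fun q hq h0 => absurd h0 hq.ne')
    refine ((hr i).1.mul ((hr j).1.mul h2.neg_left)).congr' ?_ ?_
    · filter_upwards [hr0 i, hr0 j, ((hr i).2.2.1 j hij).eq_zero_imp, hpos] with q h3 h4 h5 h6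
      have h7 : r i q q - r j q q ≠ 0 := fun h0 => h6.ne' (h5 h0)
      have h8 : r j q q - r i q q ≠ 0 := by rwa [← neg_sub, neg_ne_zero]
      have h9 : (r i q q)⁻¹ - (r j q q)⁻¹ = (r j q q - r i q q) / (r i q q * r j q q) := by
        field_simp
      rw [h9, inv_div]
      field_simp
      ring
    · filter_upwards [hpos] with q hq
      field_simp
  · filter_upwards [((hr i).2.2.1 j hij).eq_zero_imp, hpos] with q h5 h6 h7
    exact h6.ne' (h5 (sub_eq_zero.mpr (inv_injective h7)))
  -- `dc = -r⁻² dr`, and the main part of `dr` is proportional to `df`, so the component along `ξ`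
  -- sees only the remainder: `τ⁻² τ = τ⁻¹`.
  · have h1 := ((hinv i).mul (hinv i)).mul ((hr i).2.2.2.2.mul hJinv).neg_left
    refine h1.congr' ?_ ?_
    · filter_upwards [hgrad i] with q hq
      rw [hq, frameFst]
      simp only [wedge, Prod.fst_sub, Prod.snd_sub, Prod.smul_fst, Prod.smul_snd, smul_eq_mul]
      ring
    · filter_upwards [hpos] with q hq
      field_simp
  -- The main part of `dr` contributes `-r⁻² r / (ν f) = -c / (ν f)`, and the remainder `τ⁻² τ ² /
  -- |f| = 1 / |f|`.
  · have h1 := ((hinv i).mul (hinv i)).mul ((isBigO_wedge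
      (isBigO_const_const ξ (one_ne_zero' ℝ) _) (hr i).2.2.2.1).mul hJinv).neg_left
    refine h1.congr' ?_ ?_
    · filter_upwards [hgrad i, hr0 i, hJn, self_mem_nhdsWithin] with q hq h2 h3 h4
      rw [hq, frameSnd]
      have h5 : wedge ξ (grad (r i q) q - (r i q q / (ν * f q)) • grad f q) =
          wedge ξ (grad (r i q) q) - (r i q q / (ν * f q)) * wedge ξ (grad f q) := by
        simp only [wedge, Prod.fst_sub, Prod.snd_sub, Prod.smul_fst, Prod.smul_snd, smul_eq_mul]
        ring
      have hν : (ν : ℂ) ≠ 0 := Nat.cast_ne_zero.mpr (by have := h.two_le; omega)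
      have h4' : f q ≠ 0 := h4
      rw [h5, wedge_smul_right]
      field_simp
      ring
    · filter_upwards [hpos] with q hq
      field_simp

end IsInvariantGerm

/-- The slopes of the superposition of a web with a totally invariant curve of minimal
multiplicity and of a smooth web transverse to this curve. -/
lemma exists_slopeFamily {ν l : ℕ} {P P' : ℂ × ℂ → BinaryForm} {f : ℂ × ℂ → ℂ} {x ξ : ℂ × ℂ}
    (h : IsInvariantGerm ν P f x) (hJ : wedge ξ (grad f x) ≠ 0)
    (hP' : ∀ᶠ y in 𝓝 x, (P' y).IsHomogeneous l)
    (hc' : ∀ m, AnalyticAt ℂ (fun y => (P' y).coeff m) x)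
    (hlead : evalForm (P' x) (kernelVec (grad f x)) ≠ 0) (hd : formDiscr l (P' x) ≠ 0)
    {τ : ℂ × ℂ → ℝ} (hτ0 : ∀ y, 0 ≤ τ y) (hτf : ∀ y, τ y ^ ν = ‖f y‖) :
    ∃ c : Fin (ν + l) → ℂ × ℂ → ℂ × ℂ → ℂ,
      IsSlopeSystem (ν + l) (fun y => P y * P' y) f ξ x c ∧
      IsSlopeFamily (𝓝[{y | f y ≠ 0}] x) ν f τ (fun i : Fin (ν + l) => (i : ℕ) < ν)
        (fun i q => c i q q) (fun i q => frameFst ξ (grad f q) (grad (c i q) q))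
        (fun i q => frameSnd ξ (grad f q) (grad (c i q) q)) := by
  have hl : 𝓝[{y | f y ≠ 0}] x ≤ 𝓝 x := nhdsWithin_le_nhds
  obtain ⟨c₁, hs₁, h₁⟩ := h.exists_slopes hJ hτ0 hτf
  obtain ⟨c₂, u₂, ha₂, hne₂, hu₂, hu₂0, hP₂⟩ := exists_slopes hP' hc' h.analyticAt hJ hlead hd
  have hpos := h.eventually_pos hτ0 hτf
  have hτ := h.tendsto_scale hτf
  have hone {g : ℂ × ℂ → ℂ} (hg : ContinuousAt g x) :
      g =O[𝓝[{y | f y ≠ 0}] x] fun _ => (1 : ℝ) := (hg.tendsto.mono_left hl).isBigO_one ℝ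
  have hJc : AnalyticAt ℂ (fun q => wedge ξ (grad f q)) x :=
    analyticAt_wedge analyticAt_const (analyticAt_grad h.analyticAt)
  -- A ramified slope has order `1 / τ` and tends to infinity, while the slope of a transverse
  -- foliation stays bounded, so their difference has order at least `1 / τ`.
  have hlarge (i j) : (fun q => (τ q)⁻¹) =O[𝓝[{y | f y ≠ 0}] x] fun q => c₁ i q q - c₂ j q := by
    refine (h₁ i).2.1.trans ?_
    refine IsLittleO.right_isBigO_sub ?_
    refine ((hone (ha₂ j).continuousAt).trans_isLittleO ?_).trans_isBigO (h₁ i).2.1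
    refine (isLittleO_one_left_iff ℝ).mpr ?_
    have : Tendsto τ (𝓝[{y | f y ≠ 0}] x) (𝓝[>] 0) :=
      tendsto_nhdsWithin_iff.mpr ⟨hτ, hpos⟩
    exact tendsto_norm_atTop_atTop.comp this.inv_tendsto_nhdsGT_zero
  have hinv (i j) : (fun q => (c₁ i q q - c₂ j q)⁻¹) =O[𝓝[{y | f y ≠ 0}] x] τ := by
    simpa using (hlarge i j).inv_rev (hpos.mono fun q hq h0 => absurd h0 (inv_pos.mpr hq).ne')
  have hne (i j) : ∀ᶠ q in 𝓝[{y | f y ≠ 0}] x, c₁ i q q ≠ c₂ j q := by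
    filter_upwards [(hlarge i j).eq_zero_imp, hpos] with q h1 h2 h3
    exact (inv_pos.mpr h2).ne' (h1 (sub_eq_zero.mpr h3))
  refine ⟨Fin.addCases c₁ fun j _ => c₂ j, ?_, ?_⟩
  · filter_upwards [hs₁, hl (eventually_all.mpr fun j => (ha₂ j).eventually_analyticAt),
      hl hu₂.eventually_analyticAt, hl (hu₂.continuousAt.eventually_ne hu₂0),
      hl hP₂.eventually_nhds] with q h1 h2 h3 h4 h5
    obtain ⟨ha₁, u₁, hu₁, hu₁0, hP₁⟩ := h1
    refine ⟨?_, fun y => u₁ y * u₂ y, hu₁.mul h3, mul_ne_zero hu₁0 h4, ?_⟩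
    · refine Fin.addCases (fun i => ?_) fun j => ?_
      · simpa only [Fin.addCases_left] using ha₁ i
      · simpa only [Fin.addCases_right] using h2 j
    · filter_upwards [hP₁, h5] with y h6 h7
      rw [h6, h7, Fin.prod_univ_add, map_mul]
      simp only [Fin.addCases_left, Fin.addCases_right]
      ring
  · have hI₂ (j : Fin l) : ¬ ((Fin.natAdd ν j : Fin (ν + l)) : ℕ) < ν := by simp
    refine ⟨h.two_le, hpos, hτ, hτf, ?_, ?_, ?_, ?_, ?_, ?_, ?_, ?_, ?_⟩
    all_goals refine Fin.addCases (fun i => ?_) fun j => ?_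
    all_goals simp only [Fin.addCases_left, Fin.addCases_right, hI₂, Fin.val_castAdd, Fin.is_lt,
      false_imp_iff, true_imp_iff, not_true, not_false_iff, true_or, implies_true]
    · exact (h₁ i).1
    · exact (h₁ i).2.2.2.1
    · exact (h₁ i).2.2.2.2
    · exact hone (ha₂ j).continuousAt
    · exact hone (((analyticAt_wedge (analyticAt_grad (ha₂ j))
        (analyticAt_grad h.analyticAt)).div hJc hJ).continuousAt)
    · exact hone (((analyticAt_wedge analyticAt_const
        (analyticAt_grad (ha₂ j))).div hJc hJ).continuousAt)
    · refine Fin.addCases (fun i' hij => ?_) fun j _ => ?_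
      · simp only [Fin.addCases_left]
        exact ((h₁ i).2.2.1 i' (fun e => hij (by rw [e]))).2
      · simp only [Fin.addCases_right]
        exact hne i j
    · refine Fin.addCases (fun i _ => ?_) fun j' hij => ?_
      · simp only [Fin.addCases_left]
        exact (hne i j).mono fun q hq => hq.symm
      · simp only [Fin.addCases_right]
        have h2 := sub_ne_zero.mpr (hne₂ j j' fun e => hij (by rw [e]))
        exact hl ((((ha₂ j).sub (ha₂ j')).continuousAt.eventually_ne h2).mono
          fun q hq => sub_ne_zero.mp hq)
    · refine Fin.addCases (fun i' hij => ?_) fun j _ => ?_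
      · simp only [Fin.addCases_left]
        exact ((h₁ i).2.2.1 i' (fun e => hij (by rw [e]))).1
      · simp only [Fin.addCases_right]
        exact hinv i j
    · refine Fin.addCases (fun i _ _ => ?_) fun j' hij hI => ?_
      · simp only [Fin.addCases_left]
        refine (hinv i j).neg_left.congr_left fun q => ?_
        rw [← inv_neg, neg_sub]
      · exact absurd hI (by simp)
    · refine Fin.addCases (fun i _ hI => ?_) fun j' hij _ => ?_
      · exact absurd hI (by simp)
      · simp only [Fin.addCases_right]
        have h2 := sub_ne_zero.mpr (hne₂ j j' fun e => hij (by rw [e]))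
        exact hone (((ha₂ j).sub (ha₂ j')).continuousAt.inv₀ h2)

end Webs

namespace Webs

open Asymptotics

/-! ### The curvature along a totally invariant curve of minimal multiplicity -/

lemma exists_wedge_ne_zero {a : ℂ × ℂ} (ha : a ≠ 0) : ∃ ξ, wedge ξ a ≠ 0 := by
  by_contra! h
  apply ha
  have h1 := h (1, 0)
  have h2 := h (0, 1)
  simp only [wedge] at h1 h2
  ext
  · simpa using h2
  · simpa using h1

lemma IsDecomposition.formDiscr_ne_zero {k : ℕ} {P : ℂ × ℂ → BinaryForm} {x : ℂ × ℂ}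
    {α : Fin k → ℂ × ℂ → ℂ × ℂ} (h : IsDecomposition P x α) : formDiscr k (P x) ≠ 0 := by
  obtain ⟨u, -, hu, hP⟩ := h.eq_prod
  rw [hP.self_of_nhds, formDiscr_prod]
  refine mul_ne_zero (pow_ne_zero _ hu) (mul_ne_zero (discrConst_ne_zero k) ?_)
  exact Finset.prod_ne_zero_iff.mpr fun i _ => Finset.prod_ne_zero_iff.mpr fun j hj =>
    h.transverse i j (Finset.ne_of_mem_erase hj).symm

lemma extDer_const_smul {α : ℂ × ℂ → ℂ × ℂ} {x : ℂ × ℂ} (c : ℂ) (hα : DifferentiableAt ℂ α x) :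
    extDer (fun y => c • α y) x = c * extDer α x := by
  rw [extDer_smul (h := fun _ => c) (differentiableAt_const c) hα]
  simp [grad, wedge]

lemma extDer_sub {α β : ℂ × ℂ → ℂ × ℂ} {x : ℂ × ℂ} (hα : DifferentiableAt ℂ α x)
    (hβ : DifferentiableAt ℂ β x) :
    extDer (fun y => α y - β y) x = extDer α x - extDer β x := by
  simp only [sub_eq_add_neg]
  rw [extDer_add (β := fun y => -β y) hα hβ.neg, extDer_neg]

lemma eventually_nhds_of_nhdsWithin_ne_zero {f : ℂ × ℂ → ℂ} {x : ℂ × ℂ} (hf : AnalyticAt ℂ f x)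
    {p : ℂ × ℂ → Prop} (h : ∀ᶠ y in 𝓝[{y | f y ≠ 0}] x, p y) :
    ∀ᶠ q in 𝓝[{y | f y ≠ 0}] x, ∀ᶠ y in 𝓝 q, p y := by
  filter_upwards [eventually_eventually_nhdsWithin.mpr h, self_mem_nhdsWithin,
    nhdsWithin_le_nhds hf.eventually_analyticAt] with q h1 h2 h3
  rwa [nhdsWithin_eq_nhds.mpr (h3.continuousAt.eventually_ne h2)] at h1

/-- A family of local `1`-forms given by slopes, at the points off the curve `f = 0`. -/
noncomputable def slopeForm {k : ℕ} (f : ℂ × ℂ → ℂ) (ξ : ℂ × ℂ)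
    (c : Fin k → ℂ × ℂ → ℂ × ℂ → ℂ) (q : ℂ × ℂ) (i : Fin k) (y : ℂ × ℂ) : ℂ × ℂ :=
  ξ + c i q y • grad f y

section

variable {k : ℕ} {P : ℂ × ℂ → BinaryForm} {f : ℂ × ℂ → ℂ} {ξ x : ℂ × ℂ}
  {c : Fin k → ℂ × ℂ → ℂ × ℂ → ℂ}

lemma IsSlopeSystem.isDecomposition (h : IsSlopeSystem k P f ξ x c) (hf : AnalyticAt ℂ f x)
    (hJ : wedge ξ (grad f x) ≠ 0)
    (hne : ∀ i j, i ≠ j → ∀ᶠ q in 𝓝[{y | f y ≠ 0}] x, c i q q ≠ c j q q) :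
    ∀ᶠ q in 𝓝[{y | f y ≠ 0}] x, IsDecomposition P q (slopeForm f ξ c q) := by
  have hne' : ∀ᶠ q in 𝓝[{y | f y ≠ 0}] x, ∀ i j, i ≠ j → c i q q ≠ c j q q := by
    refine eventually_all.mpr fun i => eventually_all.mpr fun j => ?_
    by_cases hij : i = j
    · exact .of_forall fun q h' => absurd hij h'
    · exact (hne i j hij).mono fun q hq _ => hq
  filter_upwards [h, hne', nhdsWithin_le_nhds hf.eventually_analyticAt,
    nhdsWithin_le_nhds (eventually_wedge_ne_zero analyticAt_const (analyticAt_grad hf) hJ)]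
    with q h1 h2 h3 h4
  refine ⟨fun i => analyticAt_const.add ((h1.1 i).smul (analyticAt_grad h3)), fun i j hij => ?_,
    h1.2⟩
  rw [slopeForm, slopeForm, wedge_normalized]
  exact mul_ne_zero (sub_ne_zero.mpr (h2 i j hij).symm) h4

lemma wedge_slopeForm (q : ℂ × ℂ) (i : Fin k) (y : ℂ × ℂ) :
    wedge (slopeForm f ξ c q i y) (grad f y) = wedge ξ (grad f y) := by
  rw [slopeForm, wedge_add_left, wedge_smul_left, wedge_self, mul_zero, add_zero]

/-- The sum of the forms `η` does not depend on the local choice of the slopes. -/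
lemma eventually_etaSum_slopeForm_eq (hf : AnalyticAt ℂ f x) (hJ : wedge ξ (grad f x) ≠ 0)
    (h : ∀ᶠ q in 𝓝[{y | f y ≠ 0}] x, IsDecomposition P q (slopeForm f ξ c q)) :
    ∀ᶠ q in 𝓝[{y | f y ≠ 0}] x,
      (fun y => etaSum (slopeForm f ξ c y) y) =ᶠ[𝓝 q] etaSum (slopeForm f ξ c q) := by
  filter_upwards [h, eventually_nhds_of_nhdsWithin_ne_zero hf h,
    nhdsWithin_le_nhds (eventually_wedge_ne_zero analyticAt_const (analyticAt_grad hf)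
      hJ).eventually_nhds] with q h1 h2 h3
  filter_upwards [h1.eventually, h2, h3.eventually_nhds] with y h4 h5 h6
  exact h4.etaSum_eq h5 (φ := grad f) (J := fun y => wedge ξ (grad f y))
    (fun i => .of_forall fun z => wedge_slopeForm q i z)
    (fun i => .of_forall fun z => wedge_slopeForm y i z) h6

/-- The polar part of the sum of the forms `η`. -/
noncomputable def polarPart (k : ℕ) (f : ℂ × ℂ → ℂ) (ξ : ℂ × ℂ) (e : Fin k → Fin k → Fin k → ℂ)
    (y : ℂ × ℂ) : ℂ × ℂ :=
  ∑ r : Fin k, ∑ s ∈ Finset.Ioi r, ∑ t ∈ Finset.Ioi s,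
    ((wedge ξ (grad f y))⁻¹ • grad (fun z => wedge ξ (grad f z)) y -
      e r s t • ((f y)⁻¹ • grad f y))

lemma polarPart_eq (e : Fin k → Fin k → Fin k → ℂ) : polarPart k f ξ e = fun y =>
    (∑ r : Fin k, ∑ s ∈ Finset.Ioi r, ∑ _t ∈ Finset.Ioi s, (1 : ℂ)) •
      ((wedge ξ (grad f y))⁻¹ • grad (fun z => wedge ξ (grad f z)) y) -
    (∑ r : Fin k, ∑ s ∈ Finset.Ioi r, ∑ t ∈ Finset.Ioi s, e r s t) •
      ((f y)⁻¹ • grad f y) := by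
  funext y
  simp only [polarPart, Finset.sum_smul, Finset.sum_sub_distrib, one_smul]

lemma analyticAt_polarPart (hf : AnalyticAt ℂ f x) (h0 : f x ≠ 0) (hJ : wedge ξ (grad f x) ≠ 0)
    (e : Fin k → Fin k → Fin k → ℂ) : AnalyticAt ℂ (polarPart k f ξ e) x := by
  rw [polarPart_eq]
  have h1 := analyticAt_logDeriv (analyticAt_wedge (analyticAt_const (v := ξ)) (analyticAt_grad hf))
    hJ
  exact (h1.const_smul (R := ℂ)).sub ((analyticAt_logDeriv hf h0).const_smul (R := ℂ))

/-- The polar part is a combination, with constant coefficients, of two logarithmic differentials.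
-/
lemma extDer_polarPart (hf : AnalyticAt ℂ f x) (h0 : f x ≠ 0) (hJ : wedge ξ (grad f x) ≠ 0)
    (e : Fin k → Fin k → Fin k → ℂ) : extDer (polarPart k f ξ e) x = 0 := by
  have hJa := analyticAt_wedge (analyticAt_const (v := ξ)) (analyticAt_grad hf)
  have h1 := (analyticAt_logDeriv hJa hJ).differentiableAt
  have h2 := (analyticAt_logDeriv hf h0).differentiableAt
  rw [polarPart_eq, extDer_sub (h1.fun_const_smul _) (h2.fun_const_smul _), extDer_const_smul _ h1,
    extDer_const_smul _ h2, extDer_logDeriv hJa hJ, extDer_logDeriv hf h0]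
  simp

open Classical in
-- For each triple the difference is `A ξ + (B + e / f) df`, with both coefficients `O(τ / |f|)`.
lemma IsSlopeFamily.isBigO_etaSum_sub {ν : ℕ} {τ : ℂ × ℂ → ℝ} {I : Fin k → Prop}
    (h : IsSlopeFamily (𝓝[{y | f y ≠ 0}] x) ν f τ I (fun i q => c i q q)
      (fun i q => frameFst ξ (grad f q) (grad (c i q) q))
      (fun i q => frameSnd ξ (grad f q) (grad (c i q) q)))
    (hs : IsSlopeSystem k P f ξ x c) (hf : AnalyticAt ℂ f x) (hJ : wedge ξ (grad f x) ≠ 0) :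
    (fun q => etaSum (slopeForm f ξ c q) q - polarPart k f ξ
      (fun r s t => (if I r ∨ I s ∨ I t then 1 else 0) / ν) q) =O[𝓝[{y | f y ≠ 0}] x]
      fun q => τ q / ‖f q‖ := by
  have hl : 𝓝[{y | f y ≠ 0}] x ≤ 𝓝 x := nhdsWithin_le_nhds
  simp only [etaSum, polarPart, ← Finset.sum_sub_distrib]
  refine IsBigO.fun_sum fun r _ => IsBigO.fun_sum fun s hrs => IsBigO.fun_sum fun t hst => ?_
  have hrs' : r ≠ s := (Finset.mem_Ioi.mp hrs).ne
  have hst' : s ≠ t := (Finset.mem_Ioi.mp hst).ne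
  have hrt' : r ≠ t := ((Finset.mem_Ioi.mp hrs).trans (Finset.mem_Ioi.mp hst)).ne
  have hφ : grad f =O[𝓝[{y | f y ≠ 0}] x] fun _ => (1 : ℝ) :=
    ((analyticAt_grad hf).continuousAt.tendsto.mono_left hl).isBigO_one ℝ
  have h1 := ((h.isBigO_jetA hrs' hst' hrt').smul
    (isBigO_const_const ξ (one_ne_zero' ℝ) (𝓝[{y | f y ≠ 0}] x))).add
    ((h.isBigO_jetB hrs' hst' hrt').smul hφ)
  refine h1.congr' ?_ (.of_forall fun q => by simp)
  filter_upwards [hs, hl hf.eventually_analyticAt,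
    hl (eventually_wedge_ne_zero analyticAt_const (analyticAt_grad hf) hJ),
    h.ne r s hrs', h.ne s t hst', h.ne r t hrt'] with q h2 h3 h4 h5 h6 h7
  have h8 := etaForm_normalized (c := fun i => c i q) h3 h4 (h2.1 r) (h2.1 s) (h2.1 t) h5 h6 h7
  have h9 : etaForm (slopeForm f ξ c q r) (slopeForm f ξ c q s) (slopeForm f ξ c q t) q = _ := h8
  rw [h9, smul_smul, add_smul, ← div_eq_mul_inv, div_div]
  abel

end

/-- The curvature of the superposition of a web with a totally invariant curve of minimal
multiplicity and of a smooth web transverse to this curve extends analytically. -/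
theorem IsInvariantGerm.exists_curvature {ν l : ℕ} {P P' : ℂ × ℂ → BinaryForm} {f : ℂ × ℂ → ℂ}
    {x : ℂ × ℂ} (h : IsInvariantGerm ν P f x) (hP' : ∀ᶠ y in 𝓝 x, (P' y).IsHomogeneous l)
    (hc' : ∀ m, AnalyticAt ℂ (fun y => (P' y).coeff m) x)
    (hlead : evalForm (P' x) (kernelVec (grad f x)) ≠ 0) (hd : formDiscr l (P' x) ≠ 0) :
    (∀ᶠ y in 𝓝[{y | f y ≠ 0}] x, formDiscr (ν + l) (P y * P' y) ≠ 0) ∧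
    ∃ κ : ℂ × ℂ → ℂ, AnalyticAt ℂ κ x ∧ ∀ᶠ y in 𝓝[{y | f y ≠ 0}] x,
      HasCurvatureAt (ν + l) (fun y => P y * P' y) y (κ y) := by
  classical
  obtain ⟨ξ, hJ⟩ := exists_wedge_ne_zero h.grad_ne_zero
  have hf := h.analyticAt
  have hν : ν ≠ 0 := by have := h.two_le; omega
  have hl : 𝓝[{y | f y ≠ 0}] x ≤ 𝓝 x := nhdsWithin_le_nhds
  set τ : ℂ × ℂ → ℝ := fun y => ‖f y‖ ^ (ν : ℝ)⁻¹ with hτ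
  have hτ0 : ∀ y, 0 ≤ τ y := fun y => Real.rpow_nonneg (norm_nonneg _) _
  have hτf : ∀ y, τ y ^ ν = ‖f y‖ := fun y => Real.rpow_inv_natCast_pow (norm_nonneg _) hν
  obtain ⟨c, hs, hfam⟩ := exists_slopeFamily h hJ hP' hc' hlead hd hτ0 hτf
  have hdec := hs.isDecomposition hf hJ hfam.ne
  refine ⟨hdec.mono fun q hq => hq.formDiscr_ne_zero, ?_⟩
  set e : Fin (ν + l) → Fin (ν + l) → Fin (ν + l) → ℂ := fun r s t =>
    (if (r : ℕ) < ν ∨ (s : ℕ) < ν ∨ (t : ℕ) < ν then 1 else 0) / ν with he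
  -- The decomposition used at `q` changes with `q`, but the sum of the `η` does not depend on it,
  -- so `G` is analytic off the curve.
  set G : ℂ × ℂ → ℂ × ℂ := fun q =>
    etaSum (slopeForm f ξ c q) q - polarPart (ν + l) f ξ e q with hG
  have hGO : G =O[𝓝[{y | f y ≠ 0}] x] fun q => τ q / ‖f q‖ := by
    convert hfam.isBigO_etaSum_sub hs hf hJ
  have hloc := eventually_etaSum_slopeForm_eq hf hJ hdec
  have hGloc : ∀ᶠ q in 𝓝[{y | f y ≠ 0}] x, AnalyticAt ℂ G q ∧
      HasCurvatureAt (ν + l) (fun y => P y * P' y) q (extDer G q) := by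
    filter_upwards [hdec, hloc, self_mem_nhdsWithin, hl hf.eventually_analyticAt,
      hl (h.eventually_wedge_ne_zero hJ)] with q h1 h2 h3 h4 h5
    have h6 : G =ᶠ[𝓝 q] fun y => etaSum (slopeForm f ξ c q) y - polarPart (ν + l) f ξ e y :=
      h2.mono fun y hy => by simp only [hG]; rw [← hy]
    have h7 := h1.analyticAt_etaSum
    have h8 := analyticAt_polarPart h4 h3 h5 e
    refine ⟨(h7.sub h8).congr h6.symm, ?_⟩
    -- The polar part is closed, so `dG` is the curvature.
    rw [(extDer_congr h6).self_of_nhds, extDer_sub h7.differentiableAt h8.differentiableAt,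
      extDer_polarPart h4 h3 h5, sub_zero]
    exact h1.extDer_etaSum
  have hGa : ∀ᶠ y in 𝓝 x, f y ≠ 0 → AnalyticAt ℂ G y :=
    eventually_nhdsWithin_iff.mp (hGloc.mono fun q hq => hq.1)
  have hlim {g : ℂ × ℂ → ℂ} (hg : g =O[𝓝[{y | f y ≠ 0}] x] G) : ∀ᶠ y in 𝓝 x, f y = 0 →
      Tendsto (fun t => f t * g t) (𝓝[{t | f t ≠ 0}] y) (𝓝 0) := by
    -- `f G = O(τ)`, and `τ` tends to `0` at every nearby point of the curve.
    have h1 : (fun t => f t * g t) =O[𝓝[{y | f y ≠ 0}] x] τ := by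
      refine ((isBigO_norm_right.mpr (isBigO_refl f _)).mul (hg.trans hGO)).congr' .rfl ?_
      filter_upwards [self_mem_nhdsWithin] with q hq
      have : ‖f q‖ ≠ 0 := norm_ne_zero_iff.mpr hq
      field_simp
    obtain ⟨K, hK⟩ := h1.bound
    filter_upwards [eventually_nhds_nhdsWithin.mpr hK, hf.eventually_analyticAt]
      with y h2 h3 h4
    have h5 : Tendsto τ (𝓝[{t | f t ≠ 0}] y) (𝓝 0) := by
      have h6 : ContinuousAt τ y :=
        (h3.continuousAt.norm).rpow_const (.inr (by positivity))
      have h7 : τ y = 0 := by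
        simp only [hτ, h4, norm_zero]
        exact Real.zero_rpow (inv_ne_zero (Nat.cast_ne_zero.mpr hν))
      rw [← h7]
      exact h6.tendsto.mono_left nhdsWithin_le_nhds
    exact (IsBigO.of_bound K h2).trans_tendsto h5
  obtain ⟨H₁, hH₁, hG₁⟩ := exists_analytic_extension hf h.eq_zero h.grad_ne_zero
    (hGa.mono fun y hy h0 => analyticAt_fst_comp (hy h0)) (hlim isBigO_fst_prod')
  obtain ⟨H₂, hH₂, hG₂⟩ := exists_analytic_extension hf h.eq_zero h.grad_ne_zero
    (hGa.mono fun y hy h0 => analyticAt_snd_comp (hy h0)) (hlim isBigO_snd_prod')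
  refine ⟨extDer fun y => (H₁ y, H₂ y), analyticAt_extDer (hH₁.prod hH₂), ?_⟩
  have hHG : ∀ᶠ y in 𝓝[{y | f y ≠ 0}] x, (H₁ y, H₂ y) = G y := by
    filter_upwards [hl hG₁, hl hG₂, self_mem_nhdsWithin] with y h1 h2 h3
    rw [h1 h3, h2 h3]
  filter_upwards [hGloc, eventually_nhds_of_nhdsWithin_ne_zero hf hHG] with q h1 h2
  rw [(extDer_congr h2).self_of_nhds]
  exact h1.2

end Webs

namespace Webs

/-! ### Charts -/

section Charts

variable {S : Type*} [TopologicalSpace S] [ChartedSpace (ℂ × ℂ) S]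

lemma analyticAt_transition [IsManifold 𝓘(ℂ, ℂ × ℂ) ω S] (p q : S) {z : S}
    (hp : z ∈ (chartAt (ℂ × ℂ) p).source) (hq : z ∈ (chartAt (ℂ × ℂ) q).source) :
    AnalyticAt ℂ (fun t => chartAt (ℂ × ℂ) q ((chartAt (ℂ × ℂ) p).symm t))
      (chartAt (ℂ × ℂ) p z) := by
  have h := contDiffWithinAt_ext_coord_change (I := 𝓘(ℂ, ℂ × ℂ)) (n := ω) q p
    (y := chartAt (ℂ × ℂ) p z) (by simp [hp, hq])
  simp only [modelWithCornersSelf_coe, Set.range_id, contDiffWithinAt_univ, mfld_simps] at h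
  rw [← contDiffWithinAt_univ, contDiffWithinAt_omega_iff_analyticWithinAt,
    analyticWithinAt_univ] at h
  exact h

lemma tendsto_chart_symm {p z : S} (hz : z ∈ (chartAt (ℂ × ℂ) p).source) :
    Tendsto (chartAt (ℂ × ℂ) p).symm (𝓝 (chartAt (ℂ × ℂ) p z)) (𝓝 z) := by
  have := (chartAt (ℂ × ℂ) p).continuousAt_symm ((chartAt (ℂ × ℂ) p).map_source hz)
  rwa [ContinuousAt, (chartAt (ℂ × ℂ) p).left_inv hz] at this

lemma eventually_chart_right_inv {p z : S} (hz : z ∈ (chartAt (ℂ × ℂ) p).source) :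
    ∀ᶠ y in 𝓝 (chartAt (ℂ × ℂ) p z),
      chartAt (ℂ × ℂ) p ((chartAt (ℂ × ℂ) p).symm y) = y := by
  filter_upwards [(chartAt (ℂ × ℂ) p).open_target.mem_nhds
    ((chartAt (ℂ × ℂ) p).map_source hz)] with y hy using (chartAt (ℂ × ℂ) p).right_inv hy

lemma injective_fderiv_transition [IsManifold 𝓘(ℂ, ℂ × ℂ) ω S] (p q : S) {z : S}
    (hp : z ∈ (chartAt (ℂ × ℂ) p).source) (hq : z ∈ (chartAt (ℂ × ℂ) q).source) :
    Function.Injective (fderiv ℂ (fun t => chartAt (ℂ × ℂ) q ((chartAt (ℂ × ℂ) p).symm t))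
      (chartAt (ℂ × ℂ) p z)) := by
  have h1 := (analyticAt_transition p q hp hq).differentiableAt.hasFDerivAt
  have h2 := (analyticAt_transition q p hq hp).differentiableAt.hasFDerivAt
  have e : chartAt (ℂ × ℂ) q ((chartAt (ℂ × ℂ) p).symm (chartAt (ℂ × ℂ) p z)) =
      chartAt (ℂ × ℂ) q z := by rw [(chartAt (ℂ × ℂ) p).left_inv hp]
  rw [← e] at h2
  have h3 := h2.comp (chartAt (ℂ × ℂ) p z) h1
  have h4 : (fun t => chartAt (ℂ × ℂ) p ((chartAt (ℂ × ℂ) q).symm t)) ∘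
      (fun t => chartAt (ℂ × ℂ) q ((chartAt (ℂ × ℂ) p).symm t)) =ᶠ[𝓝 (chartAt (ℂ × ℂ) p z)] id := by
    filter_upwards [eventually_chart_right_inv hp, (tendsto_chart_symm hp).eventually
      ((chartAt (ℂ × ℂ) q).open_source.mem_nhds hq)] with y h5 h6
    simp only [Function.comp, id]
    rw [(chartAt (ℂ × ℂ) q).left_inv h6, h5]
  have h5 := h3.unique ((hasFDerivAt_id _).congr_of_eventuallyEq h4)
  refine Function.LeftInverse.injective (g := fderiv ℂ
    (fun t => chartAt (ℂ × ℂ) p ((chartAt (ℂ × ℂ) q).symm t))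
    (chartAt (ℂ × ℂ) q ((chartAt (ℂ × ℂ) p).symm (chartAt (ℂ × ℂ) p z)))) fun v => ?_
  exact congrArg (fun L => L v) h5

lemma analyticAt_comp_chart_symm [IsManifold 𝓘(ℂ, ℂ × ℂ) ω S] {f : S → ℂ} {p z : S}
    (hf : ContMDiffAt 𝓘(ℂ, ℂ × ℂ) 𝓘(ℂ, ℂ) ω f z) (hp : z ∈ (chartAt (ℂ × ℂ) p).source) :
    AnalyticAt ℂ (f ∘ (chartAt (ℂ × ℂ) p).symm) (chartAt (ℂ × ℂ) p z) := by
  rw [contMDiffAt_iff_source_of_mem_source hp, contMDiffWithinAt_iff_contDiffWithinAt] at hf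
  simp only [modelWithCornersSelf_coe, Set.range_id, mfld_simps] at hf
  rw [contDiffWithinAt_omega_iff_analyticWithinAt, analyticWithinAt_univ] at hf
  exact hf

lemma mfderiv_eq_fderiv {f : S → ℂ} {z : S} (hf : ContMDiffAt 𝓘(ℂ, ℂ × ℂ) 𝓘(ℂ, ℂ) ω f z)
    (v : ℂ × ℂ) : mfderiv 𝓘(ℂ, ℂ × ℂ) 𝓘(ℂ, ℂ) f z v =
      fderiv ℂ (f ∘ (chartAt (ℂ × ℂ) z).symm) (chartAt (ℂ × ℂ) z z) v := by
  rw [(hf.mdifferentiableAt (by simp)).mfderiv]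
  simp only [writtenInExtChartAt, modelWithCornersSelf_coe, Set.range_id, fderivWithin_univ,
    mfld_simps]
  rfl

lemma fderiv_comp_chart_symm [IsManifold 𝓘(ℂ, ℂ × ℂ) ω S] {f : S → ℂ} {p z : S}
    (hf : ContMDiffAt 𝓘(ℂ, ℂ × ℂ) 𝓘(ℂ, ℂ) ω f z) (hp : z ∈ (chartAt (ℂ × ℂ) p).source)
    (v : ℂ × ℂ) : fderiv ℂ (f ∘ (chartAt (ℂ × ℂ) p).symm) (chartAt (ℂ × ℂ) p z) v =
      mfderiv 𝓘(ℂ, ℂ × ℂ) 𝓘(ℂ, ℂ) f z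
        (fderiv ℂ (fun t => chartAt (ℂ × ℂ) z ((chartAt (ℂ × ℂ) p).symm t))
          (chartAt (ℂ × ℂ) p z) v) := by
  have hz := mem_chart_source (ℂ × ℂ) z
  have h1 := (analyticAt_transition p z hp hz).differentiableAt.hasFDerivAt
  have h2 := (analyticAt_comp_chart_symm hf hz).differentiableAt.hasFDerivAt
  have e : chartAt (ℂ × ℂ) z ((chartAt (ℂ × ℂ) p).symm (chartAt (ℂ × ℂ) p z)) =
      chartAt (ℂ × ℂ) z z := by rw [(chartAt (ℂ × ℂ) p).left_inv hp]
  rw [mfderiv_eq_fderiv hf]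
  rw [← e] at h2
  have h3 := h2.comp (chartAt (ℂ × ℂ) p z) h1
  have h4 : f ∘ (chartAt (ℂ × ℂ) p).symm =ᶠ[𝓝 (chartAt (ℂ × ℂ) p z)]
      (f ∘ (chartAt (ℂ × ℂ) z).symm) ∘
        fun t => chartAt (ℂ × ℂ) z ((chartAt (ℂ × ℂ) p).symm t) := by
    filter_upwards [(tendsto_chart_symm hp).eventually
      ((chartAt (ℂ × ℂ) z).open_source.mem_nhds hz)] with y h6
    simp only [Function.comp]
    rw [(chartAt (ℂ × ℂ) z).left_inv h6]
  rw [(h3.congr_of_eventuallyEq h4).fderiv, e]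
  rfl

end Charts

lemma fderiv_eq_evalForm_grad (f : ℂ × ℂ → ℂ) (y v : ℂ × ℂ) :
    fderiv ℂ f y v = evalForm (linearForm (grad f y)) v := by
  rw [evalForm_linearForm]
  have e : v = v.1 • ((1, 0) : ℂ × ℂ) + v.2 • ((0, 1) : ℂ × ℂ) := by ext <;> simp
  conv_lhs => rw [e]
  rw [map_add, map_smul, map_smul]
  simp only [grad, smul_eq_mul]
  ring

/-! ### From the surface to the germ of the web in a chart -/

section Surface

variable {S : Type*} [TopologicalSpace S] [ChartedSpace (ℂ × ℂ) S]

namespace TwistedForm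

variable {k l : ℕ}

lemma mem_nhds_dom (W : TwistedForm S k) (p : S) : W.dom p ∈ 𝓝 p :=
  (W.isOpen_dom p).mem_nhds (W.mem_dom p)

/-- `discrSet` is computed at each point in its own chart. Passing to the chart at `p` changes the
form by a nonzero factor and an invertible linear substitution, which do not affect the vanishing of
the discriminant. -/
lemma mem_discrSet_iff [IsManifold 𝓘(ℂ, ℂ × ℂ) ω S] (W : TwistedForm S k) {p q : S}
    (hq : q ∈ W.dom p) : q ∈ W.discrSet ↔ formDiscr k (W.form p (chartAt (ℂ × ℂ) p q)) = 0 := by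
  have hqp := W.dom_subset p hq
  obtain ⟨g, -, hg, h⟩ := W.compatible p q q ⟨hq, W.mem_dom q⟩
  have h1 := h.self_of_nhds
  rw [(chartAt (ℂ × ℂ) p).left_inv hqp] at h1
  exact (formDiscr_eq_zero_iff_of_comp (W.isHomogeneous q q (W.mem_dom q))
    (injective_fderiv_transition p q hqp (mem_chart_source (ℂ × ℂ) q)) hg h1).symm

lemma eventually_isHomogeneous (W : TwistedForm S k) (p : S) :
    ∀ᶠ y in 𝓝 (chartAt (ℂ × ℂ) p p), (W.form p y).IsHomogeneous k := by
  have hp := mem_chart_source (ℂ × ℂ) p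
  filter_upwards [eventually_chart_right_inv hp,
    (tendsto_chart_symm hp).eventually (W.mem_nhds_dom p)] with y h1 h2
  have := W.isHomogeneous p _ h2
  rwa [h1] at this

end TwistedForm

/-- Near a point of a totally invariant curve of minimal multiplicity, the form defining the web,
written in a chart. -/
lemma Web.exists_isInvariantGerm [IsManifold 𝓘(ℂ, ℂ × ℂ) ω S] {ν : ℕ} (W : Web S ν) {C : Set S}
    (hinv : W.IsTotallyInvariant C) (hmult : W.HasMultiplicity C (ν - 1)) {p : S}
    (hp : p ∈ C ∩ regularPart W.discrSet) :
    ∃ f : S → ℂ, IsLocalEquation C f p ∧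
      IsInvariantGerm ν (W.form p) (f ∘ (chartAt (ℂ × ℂ) p).symm) (chartAt (ℂ × ℂ) p p) := by
  obtain ⟨f, u, hf, hu, hu0, hd⟩ := hmult p hp
  have hps := mem_chart_source (ℂ × ℂ) p
  have hfp : f p = 0 := hf.eventually_mem_iff.self_of_nhds.mp hp.1
  have hfa := analyticAt_comp_chart_symm hf.contMDiffAt hps
  have hsymm := tendsto_chart_symm hps
  have hgrad : grad (f ∘ (chartAt (ℂ × ℂ) p).symm) (chartAt (ℂ × ℂ) p p) ≠ 0 := by
    intro h0
    refine hf.mfderiv_ne_zero (ContinuousLinearMap.ext fun v => ?_)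
    have h1 (w : ℂ × ℂ) : fderiv ℂ (f ∘ (chartAt (ℂ × ℂ) p).symm) (chartAt (ℂ × ℂ) p p) w = 0 := by
      rw [fderiv_eq_evalForm_grad, h0, evalForm_linearForm]
      simp
    exact (mfderiv_eq_fderiv hf.contMDiffAt v).trans (h1 v)
  refine ⟨f, hf, ?_, W.eventually_isHomogeneous p, W.analyticAt p p (W.mem_dom p), hfa, ?_, hgrad,
    ⟨u ∘ (chartAt (ℂ × ℂ) p).symm, ?_, ?_, ?_⟩, ?_⟩
  -- For `ν ≤ 1` the discriminant is `1`, yet `p` lies in its zero set.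
  · by_contra hν
    have : formDiscr ν (W.formAt p) = 0 := hp.2.1
    rw [formDiscr_of_le_one (by omega)] at this
    exact one_ne_zero this
  · simp only [Function.comp, (chartAt (ℂ × ℂ) p).left_inv hps, hfp]
  · exact (analyticAt_comp_chart_symm hu hps).continuousAt
  · simpa only [Function.comp, (chartAt (ℂ × ℂ) p).left_inv hps] using hu0
  · filter_upwards [eventually_chart_right_inv hps, hsymm.eventually hd] with y h1 h2
    rwa [h1] at h2
  · have hcont : ∀ᶠ q in 𝓝 p, ContMDiffAt 𝓘(ℂ, ℂ × ℂ) 𝓘(ℂ, ℂ) ω f q :=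
      (contMDiffAt_iff_contMDiffAt_nhds (by simp)).mp hf.contMDiffAt
    filter_upwards [eventually_chart_right_inv hps, hsymm.eventually hcont,
      hsymm.eventually hf.eventually_mem_iff.eventually_nhds,
      hsymm.eventually (W.mem_nhds_dom p),
      (analyticAt_grad hfa).continuousAt.eventually_ne hgrad] with y h1 h2 h3 h4 h5 h6 h7
    set q := (chartAt (ℂ × ℂ) p).symm y with hq
    have hqp := W.dom_subset p h4
    have hT := fderiv_comp_chart_symm h2 hqp
    rw [h1] at hT
    -- Invariance at a nearby point `q` is stated in the chart at `q`. The same `f` is a local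
    -- equation of `C` at `q`, and the derivative of the transition map carries both sides of the
    -- equivalence to the chart at `p`.
    have hloc : IsLocalEquation C f q := by
      refine ⟨h2, fun h0 => h5 ?_, h3⟩
      simp only [h0] at hT
      ext
      · exact hT (1, 0)
      · exact hT (0, 1)
    obtain ⟨g, -, hg, hcomp⟩ := W.compatible p q q ⟨h4, W.mem_dom q⟩
    have hcomp' := hcomp.self_of_nhds
    rw [h1] at hcomp' hg
    rw [← hq] at hcomp'
    have hne : W.formAt q ≠ 0 := by
      intro h0
      refine h7 (binaryForm_ext fun v => ?_)
      have h8 := hcomp' v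
      have h9 : W.form q (chartAt (ℂ × ℂ) q q) = 0 := h0
      rw [h9] at h8
      simp only [evalForm, map_zero] at h8 ⊢
      exact (mul_eq_zero.mp h8.symm).resolve_left hg
    intro v
    rw [← fderiv_eq_evalForm_grad, hT]
    refine Iff.trans ?_ (hinv q (h3.self_of_nhds.mpr h6) f hloc hne _)
    have h8 := hcomp' v
    have h9 : W.form q (chartAt (ℂ × ℂ) q q) = W.formAt q := rfl
    rw [h9] at h8
    rw [h8]
    simp [hg]

end Surface

end Webs

/-! ### Holomorphy of the curvature along the component -/

theorem mainTheorem9 {S : Type*} [TopologicalSpace S] [T2Space S] [ChartedSpace (ℂ × ℂ) S]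
    [IsManifold 𝓘(ℂ, ℂ × ℂ) ω S] {ν d : ℕ} (hνd : ν ≤ d)
    (W : Webs.Web S ν) (W' : Webs.Web S (d - ν)) (C : Set S)
    (hC : Webs.IsIrreducibleComponent W.discrSet C)
    (hinv : W.IsTotallyInvariant C)
    (hmult : W.HasMultiplicity C (ν - 1))
    (hsmooth : W'.IsSmooth)
    (htrans : W'.IsTransverse C) :
    ∀ p ∈ C ∩ Webs.regularPart W.discrSet, (W.superposition W').CurvatureHolomorphicAt p := by
  intro p hp
  obtain ⟨f, hf, hgerm⟩ := W.exists_isInvariantGerm hinv hmult hp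
  have hps := mem_chart_source (ℂ × ℂ) p
  set x := chartAt (ℂ × ℂ) p p with hx
  set F := f ∘ (chartAt (ℂ × ℂ) p).symm with hF
  -- The kernel vector of `dF` is tangent to `C`, so transversality makes the second web nonzero on
  -- it. This says that its linear factors have a nonzero component along `ξ` and can be normalised
  -- as `ξ + c df`.
  have hlead : Webs.evalForm (W'.form p x) (Webs.kernelVec (Webs.grad F x)) ≠ 0 := by
    refine htrans p hp.1 f hf _ (fun h0 => hgerm.grad_ne_zero ?_) ?_
    · have h1 := congrArg Prod.fst h0
      have h2 := congrArg Prod.snd h0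
      simp only [Webs.kernelVec, Prod.fst_zero, Prod.snd_zero, neg_eq_zero] at h1 h2
      exact Prod.ext h2 h1
    · rw [Webs.mfderiv_eq_fderiv hf.contMDiffAt, Webs.fderiv_eq_evalForm_grad,
        Webs.evalForm_linearForm_kernelVec, Webs.wedge_self]
      rfl
  obtain ⟨hdisc, κ, hκ, hcurv⟩ := hgerm.exists_curvature (W'.eventually_isHomogeneous p)
    (W'.analyticAt p p (W'.mem_dom p)) hlead (hsmooth p).2
  have hdom := (W.superposition W').mem_nhds_dom p
  have hsymm := Webs.tendsto_chart_symm hps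
  refine ⟨fun hall => ?_, κ, hκ, ?_⟩
  · have := Webs.neBot_nhdsWithin_ne_zero hgerm.grad_ne_zero
    have h1 : ∀ᶠ y in 𝓝 x, Webs.formDiscr (ν + (d - ν)) (W.form p y * W'.form p y) = 0 := by
      filter_upwards [hsymm.eventually hall, hsymm.eventually hdom,
        Webs.eventually_chart_right_inv hps] with y h2 h3 h4
      have h5 := ((W.superposition W').mem_discrSet_iff h3).mp (not_not.mp h2)
      rwa [h4] at h5
    obtain ⟨y, h2, h3⟩ := (hdisc.and (nhdsWithin_le_nhds h1)).exists
    exact h2 h3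
  · have hcont : Tendsto (chartAt (ℂ × ℂ) p) (𝓝 p) (𝓝 x) :=
      (chartAt (ℂ × ℂ) p).continuousAt hps
    obtain ⟨u, -, -, hu⟩ := hgerm.formDiscr_eq
    filter_upwards [hcont.eventually (eventually_nhdsWithin_iff.mp hcurv), hcont.eventually hu,
      hcont.eventually (W.eventually_isHomogeneous p),
      hcont.eventually (W'.eventually_isHomogeneous p), hdom] with q h1 h2 h3 h4 h5 h6
    -- The curve `f = 0` lies in the discriminant of the first web, hence in that of the
    -- superposition; so the points off the latter satisfy `f ≠ 0`, where the local result applies.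
    refine h1 fun h0 => h6 ?_
    rw [(W.superposition W').mem_discrSet_iff h5]
    refine Webs.formDiscr_mul_eq_zero h3 h4 ?_
    have := hgerm.two_le
    rw [h2, h0, zero_pow (by omega), zero_mul]
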